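/- **Annealed CLT for the Ising model on the generalized random graph.** *Random graph.* For every $N\ge 1$ let $w_1,\dots,w_N>0$ be deterministic weights ($w_i=w_i^{(N)}$ may depend on $N$), and put $\ell_N=\sum_{i=1}^N w_i$. Let $G_N=\mathrm{GRG}_N(\boldsymbol w)$ be the random graph on $[N]=\{1,\dots,N\}$ in which the edges $\{i,j\}$, $i<j$, are present independently with probability $p_{ij}=\frac{w_iw_j}{\ell_N+w_iw_j}$; let $Q_N$ denote its law (and expectation). Assume the weight regularity condition: there is a real random variable $W$ with $0<\mathbb E[W]<\infty$ and $\mathbb E[W^2]<\infty$ such that, as $N\to\infty$, (a) $W_N\to W$ in distribution, where $W_N=w_I$ with $I$ uniform on $[N]$; (b) $\frac1N\sum_{i=1}^N w_i\to\mathbb E[W]$; (c) $\frac1N\sum_{i=1}^N w_i^2\to\mathbb E[W^2]$. *Annealed measure.* For $\beta\ge0$, $B\in\mathbb R$, and $\sigma\in\{-1,1\}^N$ let $$\widetilde P_N(\sigma)=\frac{Q_N\big(e^{\beta\sum_{(i,j)\in E_N}\sigma_i\sigma_j+B\sum_i\sigma_i}\big)}{Q_N(Z_N(\beta,B))},\qquad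 Z_N(\beta,B)=\sum_{\sigma\in\{-1,1\}^N}e^{\beta\sum_{(i,j)\in E_N}\sigma_i\sigma_j+B\sum_i\sigma_i},$$ where each edge is counted once; $\widetilde P_N(\cdot)$ also denotes the corresponding expectation. Let $S_N=\sum_{i=1}^N\sigma_i$, $\widetilde\psi_N(\beta,B)=\frac1N\log Q_N(Z_N(\beta,B))$, $\widetilde M_N(\beta,B)=\widetilde P_N(S_N/N)$ and $\widetilde\chi_N(\beta,B)=\frac{\partial}{\partial B}\widetilde M_N(\beta,B)$. *Uniqueness regime.* Let $$\beta_c^{\mathrm{an}}=\inf\Big\{\beta>0:\ \lim_{B\to0^+}\lim_{N\to\infty}\widetilde M_N(\beta,B)>0\Big\},$$ $$\mathcal U^{\mathrm{an}}=\{(\beta,B):\ \beta\ge0,\ B\ne0\}\cup\{(\beta,0):\ 0<\beta<\beta_c^{\mathrm{an}}\}.$$ *Theorem.* Let $(\beta,B)\in\mathcal U^{\mathrm{an}}$. Then the limiting annealed pressure $\widetilde\psi(\beta,b)=\lim_{N\to\infty}\widetilde\psi_N(\beta,b)$ exists for all $b\in\mathbb R$; the function $b\mapsto\widetilde\psi(\beta,b)$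 is differentiable near $B$ and twice differentiable at $B$; the limiting annealed susceptibility exists and satisfies $$\widetilde\chi=\widetilde\chi(\beta,B)=\lim_{N\to\infty}\widetilde\chi_N(\beta,B)=\frac{\partial^2}{\partial B^2}\widetilde\psi(\beta,B)\in[0,\infty);$$ and, under $\widetilde P_N$, $$\frac{S_N-\widetilde P_N(S_N)}{\sqrt N}\ \longrightarrow\ \mathcal N(0,\widetilde\chi)\quad\text{in distribution as }N\to\infty .$$ -/

import Mathlib

open MeasureTheory ProbabilityTheory Filter Topology
open scoped NNReal ENNReal

noncomputable section

namespace AnnealedGRG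

/-- Unordered pairs of distinct vertices of `[N]`, each listed once as `(i, j)` with `i < j`. -/
abbrev VertexPair (N : ℕ) : Type := {e : Fin N × Fin N // e.1 < e.2}

/-- A graph on `[N]`, given by its edge indicators `I_{ij}`, `i < j`. -/
abbrev GraphConfig (N : ℕ) : Type := VertexPair N → Bool

/-- A spin configuration, an element of `{-1, 1}^N`. -/
abbrev SpinConfig (N : ℕ) : Type := Fin N → ℤˣ

/-- The σ-algebra on `{-1, 1}` is the discrete one. -/
instance discreteMeasurableSpaceSpin : DiscreteMeasurableSpace ℤˣ where
  forall_measurableSet s :=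
    ⟨Units.val '' s, MeasurableSet.of_discrete, Set.preimage_image_eq s Units.val_injective⟩

/-- The real value `±1` of a spin. -/
def spinVal (s : ℤˣ) : ℝ := ((s : ℤ) : ℝ)

/-- Total weight `ℓ_N = ∑ w_i`. -/
def totalWeight {N : ℕ} (w : Fin N → ℝ≥0) : ℝ≥0 := ∑ i, w i

/-- Edge probability `p_{ij} = w_i w_j / (ℓ_N + w_i w_j)`. -/
def edgeProb {N : ℕ} (w : Fin N → ℝ≥0) (i j : Fin N) : ℝ≥0 :=
  w i * w j / (totalWeight w + w i * w j)

theorem edgeProb_le_one {N : ℕ} (w : Fin N → ℝ≥0) (i j : Fin N) : edgeProb w i j ≤ 1 :=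
  div_le_one_of_le₀ le_add_self zero_le

/-- The law of the generalized random graph: the edge indicators are independent, `I_{ij}` being
Bernoulli with success probability `p_{ij}`. -/
def grgLaw {N : ℕ} (w : Fin N → ℝ≥0) : Measure (GraphConfig N) :=
  Measure.pi fun e : VertexPair N =>
    bernoulliMeasure true false
      (⟨edgeProb w e.1.1 e.1.2, (edgeProb w e.1.1 e.1.2).coe_nonneg,
        NNReal.coe_le_one.2 (edgeProb_le_one w e.1.1 e.1.2)⟩ : unitInterval)

instance {N : ℕ} (w : Fin N → ℝ≥0) : IsProbabilityMeasure (grgLaw w) := by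
  unfold grgLaw; infer_instance

/-- Total spin `S_N = ∑ σ_i`. -/
def totalSpin {N : ℕ} (σ : SpinConfig N) : ℝ := ∑ i, spinVal (σ i)

/-- The Boltzmann factor `exp (β ∑_{(i,j) ∈ E_N} σ_i σ_j + B ∑_i σ_i)` on the graph `G`. -/
def boltzmannFactor {N : ℕ} (β B : ℝ) (G : GraphConfig N) (σ : SpinConfig N) : ℝ :=
  Real.exp (β * ∑ e : VertexPair N,
      (if G e = true then spinVal (σ e.1.1) * spinVal (σ e.1.2) else 0) + B * totalSpin σ)

/-- The partition function `Z_N(β, B)` on the graph `G`. -/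
def partitionFunction {N : ℕ} (β B : ℝ) (G : GraphConfig N) : ℝ :=
  ∑ σ : SpinConfig N, boltzmannFactor β B G σ

/-- The graph average of the partition function. -/
def annealedPartition {N : ℕ} (w : Fin N → ℝ≥0) (β B : ℝ) : ℝ :=
  ∫ G, partitionFunction β B G ∂(grgLaw w)

/-- The graph average of the Boltzmann factor. -/
def annealedFactor {N : ℕ} (w : Fin N → ℝ≥0) (β B : ℝ) (σ : SpinConfig N) : ℝ :=
  ∫ G, boltzmannFactor β B G σ ∂(grgLaw w)

/-- The annealed measure on spin configurations: numerator and denominator of the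
Boltzmann--Gibbs distribution are averaged separately over the graph. -/
def annealedMeasure {N : ℕ} (w : Fin N → ℝ≥0) (β B : ℝ) : Measure (SpinConfig N) :=
  ∑ σ : SpinConfig N,
    ENNReal.ofReal (annealedFactor w β B σ / annealedPartition w β B) • Measure.dirac σ

theorem annealedFactor_pos {N : ℕ} (w : Fin N → ℝ≥0) (β B : ℝ) (σ : SpinConfig N) :
    0 < annealedFactor w β B σ :=
  integral_exp_pos Integrable.of_finite

theorem annealedPartition_eq {N : ℕ} (w : Fin N → ℝ≥0) (β B : ℝ) :
    annealedPartition w β B = ∑ σ : SpinConfig N, annealedFactor w β B σ :=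
  integral_finsetSum _ fun _ _ => Integrable.of_finite

instance {N : ℕ} (w : Fin N → ℝ≥0) (β B : ℝ) : IsProbabilityMeasure (annealedMeasure w β B) := by
  have hZ : 0 < annealedPartition w β B := by
    rw [annealedPartition_eq]
    exact Finset.sum_pos (fun σ _ => annealedFactor_pos w β B σ) Finset.univ_nonempty
  constructor
  simp only [annealedMeasure, Measure.finsetSum_apply, Measure.smul_apply, measure_univ,
    smul_eq_mul, mul_one]
  rw [← ENNReal.ofReal_sum_of_nonneg
    (fun σ _ => (div_pos (annealedFactor_pos w β B σ) hZ).le), ← Finset.sum_div,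
    ← annealedPartition_eq, div_self hZ.ne', ENNReal.ofReal_one]

/-- The annealed pressure in finite volume. -/
def annealedPressure {N : ℕ} (w : Fin N → ℝ≥0) (β B : ℝ) : ℝ :=
  1 / (N : ℝ) * Real.log (annealedPartition w β B)

/-- The annealed magnetization in finite volume: the annealed mean of `S_N / N`. -/
def annealedMagnetization {N : ℕ} (w : Fin N → ℝ≥0) (β B : ℝ) : ℝ :=
  ∫ σ, totalSpin σ / (N : ℝ) ∂(annealedMeasure w β B)

/-- The annealed susceptibility in finite volume. -/
def annealedSusceptibility {N : ℕ} (w : Fin N → ℝ≥0) (β B : ℝ) : ℝ :=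
  deriv (fun b => annealedMagnetization w β b) B

/-- The weight `W_N` of a uniformly chosen vertex, as a random variable on the set of vertices with
the uniform distribution. -/
def vertexWeight {N : ℕ} (w : Fin N → ℝ≥0) (i : Fin N) : ℝ := (w i : ℝ)

/-- The weight regularity condition with limiting random variable `W`. -/
structure WeightRegularity (w : (N : ℕ+) → Fin N → ℝ≥0) {Ω : Type*} [MeasurableSpace Ω]
    (P : Measure Ω) [IsProbabilityMeasure P] (W : Ω → ℝ) : Prop where
  tendsto_law : TendstoInDistribution (fun N : ℕ+ => vertexWeight (w N)) atTop W
    (fun N : ℕ+ => uniformOn (Set.univ : Set (Fin N))) P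
  integrable : Integrable W P
  tendsto_mean : Tendsto (fun N : ℕ+ => 1 / ((N : ℕ) : ℝ) * ∑ i, (w N i : ℝ)) atTop
    (𝓝 (∫ ω, W ω ∂P))
  integrable_sq : Integrable (fun ω => W ω ^ 2) P
  tendsto_sq : Tendsto (fun N : ℕ+ => 1 / ((N : ℕ) : ℝ) * ∑ i, (w N i : ℝ) ^ 2) atTop
    (𝓝 (∫ ω, W ω ^ 2 ∂P))
  mean_pos : 0 < ∫ ω, W ω ∂P

/-- `m` is the spontaneous magnetization `lim_{B → 0+} lim_{N → ∞} M_N(β, B)`; both limits are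
required to exist. -/
def HasSpontaneousMagnetization (w : (N : ℕ+) → Fin N → ℝ≥0) (β m : ℝ) : Prop :=
  ∃ M : ℝ → ℝ,
    (∀ B : ℝ, 0 < B →
      Tendsto (fun N : ℕ+ => annealedMagnetization (w N) β B) atTop (𝓝 (M B))) ∧
    Tendsto M (𝓝[>] 0) (𝓝 m)

/-- The annealed critical inverse temperature `inf {β > 0 : M(β, 0+) > 0}`, with `inf ∅ = ∞`. -/
def criticalInverseTemp (w : (N : ℕ+) → Fin N → ℝ≥0) : EReal :=
  sInf {x : EReal | ∃ β : ℝ, x = (β : EReal) ∧ 0 < β ∧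
    ∃ m : ℝ, HasSpontaneousMagnetization w β m ∧ 0 < m}

/-- The annealed uniqueness regime. -/
def UniquenessRegime (w : (N : ℕ+) → Fin N → ℝ≥0) : Set (ℝ × ℝ) :=
  {q | (0 ≤ q.1 ∧ q.2 ≠ 0) ∨ (0 < q.1 ∧ (q.1 : EReal) < criticalInverseTemp w ∧ q.2 = 0)}

end AnnealedGRG

end

/-! Averaging over independent edges factorises the annealed weight, and any positive function of
`σ_i σ_j = ±1` is the exponential of an affine function of it. So the annealed measure is a
ferromagnetic Ising measure on the complete graph in field `B`. The `B`-derivatives of `log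
Q_N(Z_N)` are the mean and the variance of `S_N`. Taylor's formula writes the logarithmic moment
generating function of the normalized spin at `t` as `t²/2 · χ_N(c_N)` with `|c_N - B| ≤ |t|/√N`.
Convergence of moment generating functions implies convergence in law (`tendsto_of_tendsto_mgf`), so
the CLT reduces to `χ_N(c_N) → χ` along all sequences `c_N → B`.

The limit is identified through the pressure. Up to a configuration-independent constant and a
factor that stays bounded in `N`, the weight is `exp (B S_N + sinh β · L² / (2ℓ_N))` with `L = ∑ w_i
σ_i`, a rank-one Curie-Weiss weight. Replacing the square by its tangents leaves independent spins,
and the pressure converges to a constant plus `sup_u` of `limitAction`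
(`WeightRegularity.tendsto_pressure`). Stationary points solve `E[W] u = E[W tanh(sinh β W u + b)]`.
For `b > 0` concavity of `tanh` on the half-line makes the positive solution unique; if `sinh β
E[W²] < E[W]` the solution is unique for every `b`. The implicit function theorem and the envelope
principle then differentiate the limit twice.

Limits and derivatives are interchanged by monotonicity. The pressures are convex in `B`, so
magnetizations converge. By the GHS inequality `χ_N` decreases on `[0, ∞)`, so magnetizations are
concave there and `χ_N` converges for `B > 0`; spin flip gives `B < 0`. At `B = 0` concavity yields
only the lower bound. The upper bound comes from Griffiths' inequalities (`isingVar_zero_le`), and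
its limit is exactly the derivative of the limiting magnetization.

Finally, `β < β_c` must imply `sinh β E[W²] < E[W]`: otherwise every `β' > β` would have spontaneous
magnetization. Only this half of the identification of `β_c` is needed. -/

noncomputable section

namespace AnnealedGRG

/-! ### Positivity of exponential sums -/

/-- If all functions of a submonoid have nonnegative sums, so do their products with exponentials
of nonnegative combinations of such functions. -/
theorem sum_mul_exp_nonneg {X ι : Type*} [Fintype X] (K : Submonoid (X → ℝ))
    (hK : ∀ f ∈ K, 0 ≤ ∑ x, f x) (s : Finset ι) (c : ι → ℝ) (hc : ∀ i, 0 ≤ c i)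
    (f : ι → X → ℝ) (hf : ∀ i, f i ∈ K) {g : X → ℝ} (hg : g ∈ K) :
    0 ≤ ∑ x, g x * Real.exp (∑ i ∈ s, c i * f i x) := by
  classical
  induction s using Finset.induction_on generalizing g with
  | empty => simpa using hK g hg
  | insert i s hi ih =>
    -- Only the new exponential factor is expanded in its power series; the powers of `f i` are
    -- absorbed into `g`, which is why the induction is over all `g ∈ K`.
    have hs : HasSum (fun n : ℕ => ∑ x, g x * Real.exp (∑ j ∈ s, c j * f j x) *
        ((c i * f i x) ^ n / n.factorial))
        (∑ x, g x * Real.exp (∑ j ∈ insert i s, c j * f j x)) := by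
      refine hasSum_sum fun x _ => ?_
      have h := (NormedSpace.expSeries_div_hasSum_exp (c i * f i x)).mul_left
        (g x * Real.exp (∑ j ∈ s, c j * f j x))
      rw [← Real.exp_eq_exp_ℝ] at h
      rw [Finset.sum_insert hi, Real.exp_add, mul_comm (Real.exp _), ← mul_assoc]
      exact h
    refine hs.nonneg fun n => ?_
    have h := ih (mul_mem hg (pow_mem (hf i) n))
    have e : ∑ x, g x * Real.exp (∑ j ∈ s, c j * f j x) * ((c i * f i x) ^ n / n.factorial) =
        c i ^ n / n.factorial * ∑ x, (g * f i ^ n) x * Real.exp (∑ j ∈ s, c j * f j x) := by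
      rw [Finset.mul_sum]
      refine Finset.sum_congr rfl fun x _ => ?_
      simp only [Pi.mul_apply, Pi.pow_apply, mul_pow]
      ring
    rw [e]
    exact mul_nonneg (div_nonneg (pow_nonneg (hc i) n) (by positivity)) h

/-- Products over the sites of functions of the single-site state taken from `K`. -/
def siteProducts {S : Type*} (V : Type*) [Fintype V] (K : Submonoid (S → ℝ)) :
    Submonoid ((V → S) → ℝ) where
  carrier := {f | ∃ φ : V → S → ℝ, (∀ v, φ v ∈ K) ∧ f = fun x => ∏ v, φ v (x v)}
  one_mem' := ⟨fun _ => 1, fun _ => one_mem K, by ext x; simp⟩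
  mul_mem' := by
    rintro _ _ ⟨φ, hφ, rfl⟩ ⟨χ, hχ, rfl⟩
    exact ⟨fun v => φ v * χ v, fun v => mul_mem (hφ v) (hχ v), by
      ext x; simp [Finset.prod_mul_distrib]⟩

/-- The sum over configurations of a product function factorises into single-site sums, so
positivity only has to be checked on one site. -/
theorem sum_nonneg_of_mem_siteProducts {S V : Type*} [Fintype S] [Fintype V] [DecidableEq V]
    (K : Submonoid (S → ℝ)) (hK : ∀ f ∈ K, 0 ≤ ∑ s, f s) :
    ∀ f ∈ siteProducts V K, 0 ≤ ∑ x, f x := by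
  rintro _ ⟨φ, hφ, rfl⟩
  have h := Finset.prod_univ_sum (fun _ : V => (Finset.univ : Finset S)) φ
  rw [Fintype.piFinset_univ] at h
  rw [← h]
  exact Finset.prod_nonneg fun v _ => hK _ (hφ v)

theorem comp_apply_mem_siteProducts {S V : Type*} [Fintype V] {K : Submonoid (S → ℝ)}
    {φ : S → ℝ} (hφ : φ ∈ K) (v : V) : (fun x : V → S => φ (x v)) ∈ siteProducts V K := by
  classical
  refine ⟨fun u => if u = v then φ else 1, fun u => ?_, ?_⟩
  · dsimp only
    split_ifs
    exacts [hφ, one_mem K]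
  · ext x
    rw [Finset.prod_eq_single v]
    · simp
    · intro u _ hu
      simp [hu]
    · simp

/-! ### Single-site positivity for one, two and four copies of a spin. -/

theorem sum_spin (f : ℤˣ → ℝ) : ∑ s, f s = f 1 + f (-1) := by
  rw [show (Finset.univ : Finset ℤˣ) = {1, -1} from rfl, Finset.sum_pair (by decide)]

@[simp] theorem spinVal_one : spinVal 1 = 1 := by simp [spinVal]

@[simp] theorem spinVal_neg_one : spinVal (-1) = -1 := by simp [spinVal]

theorem spinVal_sq (s : ℤˣ) : spinVal s ^ 2 = 1 := by
  rcases Int.units_eq_one_or s with rfl | rfl <;> simp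

theorem abs_spinVal (s : ℤˣ) : |spinVal s| = 1 := by
  rcases Int.units_eq_one_or s with rfl | rfl <;> simp

/-- Powers of a single spin. -/
def spinPowers : Submonoid (ℤˣ → ℝ) := Submonoid.powers spinVal

theorem sum_nonneg_of_mem_spinPowers : ∀ f ∈ spinPowers, 0 ≤ ∑ s, f s := by
  rintro _ ⟨n, rfl⟩
  rw [sum_spin]
  rcases neg_one_pow_eq_or ℝ n with h | h <;> simp [h]

/-- Monomials in the sum and the difference of two spins. -/
def pairMonomials : Submonoid (ℤˣ × ℤˣ → ℝ) where
  carrier := {f | ∃ k l : ℕ, f = fun s =>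
    (spinVal s.1 + spinVal s.2) ^ k * (spinVal s.1 - spinVal s.2) ^ l}
  one_mem' := ⟨0, 0, by ext s; simp⟩
  mul_mem' := by
    rintro _ _ ⟨k, l, rfl⟩ ⟨k', l', rfl⟩
    exact ⟨k + k', l + l', by ext s; simp only [Pi.mul_apply]; ring⟩

theorem one_add_neg_one_pow_nonneg (n : ℕ) : (0 : ℝ) ≤ 1 + (-1) ^ n := by
  rcases neg_one_pow_eq_or ℝ n with h | h <;> norm_num [h]

/-- In each of the four states one of the sum and the difference vanishes, and the flip of both
copies pairs a value `2` with a value `-2`. -/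
theorem sum_nonneg_of_mem_pairMonomials : ∀ f ∈ pairMonomials, 0 ≤ ∑ s, f s := by
  rintro _ ⟨k, l, rfl⟩
  simp only [Fintype.sum_prod_type, sum_spin, spinVal_one, spinVal_neg_one]
  have h1 : (0 : ℝ) ≤ 2 ^ k * 0 ^ l * (1 + (-1) ^ k) :=
    mul_nonneg (by positivity) (one_add_neg_one_pow_nonneg k)
  have h2 : (0 : ℝ) ≤ 0 ^ k * 2 ^ l * (1 + (-1) ^ l) :=
    mul_nonneg (by positivity) (one_add_neg_one_pow_nonneg l)
  refine (add_nonneg h1 h2).trans_eq ?_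
  norm_num only
  rw [neg_pow (2 : ℝ) k, neg_pow (2 : ℝ) l]
  ring

/-- Four copies of a spin. -/
abbrev QuadSpin : Type := (ℤˣ × ℤˣ) × (ℤˣ × ℤˣ)

/-- The orthogonal change of variables on four copies of a spin (up to a factor `2`). -/
def quadVar (a : Fin 4) (s : QuadSpin) : ℝ :=
  ![spinVal s.1.1 + spinVal s.1.2 + spinVal s.2.1 + spinVal s.2.2,
    spinVal s.1.1 + spinVal s.1.2 - spinVal s.2.1 - spinVal s.2.2,
    spinVal s.1.1 - spinVal s.1.2 + spinVal s.2.1 - spinVal s.2.2,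
    -spinVal s.1.1 + spinVal s.1.2 + spinVal s.2.1 - spinVal s.2.2] a

/-- Monomials in the rotated variables of four spins. -/
def quadMonomials : Submonoid (QuadSpin → ℝ) where
  carrier := {f | ∃ k : Fin 4 → ℕ, f = fun s => ∏ a, quadVar a s ^ k a}
  one_mem' := ⟨0, by ext s; simp⟩
  mul_mem' := by
    rintro _ _ ⟨k, rfl⟩ ⟨l, rfl⟩
    exact ⟨k + l, by ext s; simp [pow_add, Finset.prod_mul_distrib]⟩

theorem quadVar_mem (a : Fin 4) : quadVar a ∈ quadMonomials :=
  ⟨Pi.single a 1, by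
    ext s
    rw [Finset.prod_eq_single a (fun b _ h => by simp [h]) (by simp)]
    simp⟩

/-- The states with an even number of minus signs make one rotated variable `±4` and the others `0`
(`e1` to `e4`). In the remaining eight all four variables are `±2` with positive product (`e5`). The
sign of the fourth row of `quadVar` is chosen for this: with the opposite sign the product would be
negative. -/
theorem sum_nonneg_of_mem_quadMonomials : ∀ f ∈ quadMonomials, 0 ≤ ∑ s, f s := by
  rintro _ ⟨k, rfl⟩
  have h4 (i : ℕ) : (-4 : ℝ) ^ i = (-1) ^ i * 4 ^ i := by rw [← mul_pow]; norm_num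
  have h2 (i : ℕ) : (-2 : ℝ) ^ i = (-1) ^ i * 2 ^ i := by rw [← mul_pow]; norm_num
  simp only [Fintype.sum_prod_type, sum_spin, Fin.prod_univ_four, quadVar, spinVal_one,
    spinVal_neg_one, Matrix.cons_val]
  norm_num only
  simp only [h4, h2]
  generalize k 0 = p
  generalize k 1 = q
  generalize k 2 = r
  generalize k 3 = t
  have hz (i : ℕ) : (0 : ℝ) ≤ 0 ^ i := by positivity
  have ht (i : ℕ) : (0 : ℝ) < 2 ^ i := by positivity
  have hf (i : ℕ) : (0 : ℝ) < 4 ^ i := by positivity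
  have e1 : (0 : ℝ) ≤ 4 ^ p * 0 ^ q * 0 ^ r * 0 ^ t * (1 + (-1) ^ p) :=
    mul_nonneg (by positivity) (one_add_neg_one_pow_nonneg _)
  have e2 : (0 : ℝ) ≤ 0 ^ p * 4 ^ q * 0 ^ r * 0 ^ t * (1 + (-1) ^ q) :=
    mul_nonneg (by positivity) (one_add_neg_one_pow_nonneg _)
  have e3 : (0 : ℝ) ≤ 0 ^ p * 0 ^ q * 4 ^ r * 0 ^ t * (1 + (-1) ^ r) :=
    mul_nonneg (by positivity) (one_add_neg_one_pow_nonneg _)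
  have e4 : (0 : ℝ) ≤ 0 ^ p * 0 ^ q * 0 ^ r * 4 ^ t * (1 + (-1) ^ t) :=
    mul_nonneg (by positivity) (one_add_neg_one_pow_nonneg _)
  have e5 : (0 : ℝ) ≤ 2 ^ p * 2 ^ q * 2 ^ r * 2 ^ t *
      ((1 + (-1) ^ (p + q + r + t)) *
        (1 + (-1) ^ (r + t) + (-1) ^ (q + t) + (-1) ^ (q + r))) := by
    refine mul_nonneg (by positivity) (mul_nonneg (one_add_neg_one_pow_nonneg _) ?_)
    simp only [pow_add]
    rcases neg_one_pow_eq_or ℝ q with h | h <;> rcases neg_one_pow_eq_or ℝ r with h' | h' <;>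
      rcases neg_one_pow_eq_or ℝ t with h'' | h'' <;> norm_num [h, h', h'']
  refine (add_nonneg (add_nonneg (add_nonneg (add_nonneg e1 e2) e3) e4) e5).trans_eq ?_
  simp only [pow_add]
  rcases neg_one_pow_eq_or ℝ p with h0 | h0 <;> rcases neg_one_pow_eq_or ℝ q with h | h <;>
    rcases neg_one_pow_eq_or ℝ r with h' | h' <;>
      rcases neg_one_pow_eq_or ℝ t with h'' | h'' <;> simp only [h0, h, h', h''] <;> ring

/-! ### Correlation inequalities for ferromagnetic Ising models -/

/-- The Gibbs weight of an Ising model with couplings `J e` between the sites `p e` and `q e` and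
homogeneous field `t`. -/
def isingWeight {V E : Type*} [Fintype V] [Fintype E] (J : E → ℝ) (p q : E → V) (t : ℝ)
    (σ : V → ℤˣ) : ℝ :=
  Real.exp (∑ e, J e * (spinVal (σ (p e)) * spinVal (σ (q e))) + t * ∑ v, spinVal (σ v))

theorem sum_arrow_prod {V S T : Type*} [Fintype V] [DecidableEq V] [Fintype S] [Fintype T]
    (F : (V → S × T) → ℝ) : ∑ x, F x = ∑ f : V → S, ∑ g : V → T, F fun v => (f v, g v) := by
  rw [← Fintype.sum_prod_type' (f := fun (f : V → S) (g : V → T) => F fun v => (f v, g v))]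
  exact Fintype.sum_equiv (Equiv.arrowProdEquivProdArrow V (fun _ => S) (fun _ => T)) _ _
    fun x => rfl

section Ising

variable {V E : Type*} [Fintype V] [DecidableEq V] [Fintype E] (J : E → ℝ) (p q : E → V)

omit [DecidableEq V] in
theorem isingWeight_pos (t : ℝ) (σ : V → ℤˣ) : 0 < isingWeight J p q t σ := Real.exp_pos _

/-- For four independent copies, the product of the three rotated variables other than the total sum
has mean `-4` times the third cumulant; the copies are integrated out one at a time, from the fourth
to the first. -/
theorem sum_cumulant_copies {X : Type*} [Fintype X] (r s : X → ℝ) :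
    ∑ x₁, ∑ x₂, ∑ x₃, ∑ x₄, (s x₁ + s x₂ - s x₃ - s x₄) * (s x₁ - s x₂ + s x₃ - s x₄) *
      (-s x₁ + s x₂ + s x₃ - s x₄) * (r x₁ * r x₂ * r x₃ * r x₄) =
    -4 * ((∑ x, r x) * ((∑ x, r x * s x ^ 3) * (∑ x, r x) ^ 2
      - 3 * (∑ x, r x * s x) * (∑ x, r x * s x ^ 2) * (∑ x, r x) + 2 * (∑ x, r x * s x) ^ 3)) := by
  have key (c₀ c₁ c₂ c₃ : ℝ) : ∑ x, r x * (c₀ + c₁ * s x + c₂ * s x ^ 2 + c₃ * s x ^ 3) =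
      c₀ * (∑ x, r x) + c₁ * (∑ x, r x * s x) + c₂ * (∑ x, r x * s x ^ 2)
        + c₃ * (∑ x, r x * s x ^ 3) := by
    simp only [Finset.mul_sum, ← Finset.sum_add_distrib]
    exact Finset.sum_congr rfl fun x _ => by ring
  generalize hz : ∑ x, r x = z at *
  generalize ha : ∑ x, r x * s x = a at *
  generalize hb : ∑ x, r x * s x ^ 2 = b at *
  generalize hc : ∑ x, r x * s x ^ 3 = c at *
  have i4 (x₁ x₂ x₃ : X) : ∑ x₄, (s x₁ + s x₂ - s x₃ - s x₄) * (s x₁ - s x₂ + s x₃ - s x₄) *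
      (-s x₁ + s x₂ + s x₃ - s x₄) * (r x₁ * r x₂ * r x₃ * r x₄) =
      r x₁ * r x₂ * r x₃ * (((s x₁ + s x₂ - s x₃) * (s x₁ - s x₂ + s x₃) * (-s x₁ + s x₂ + s x₃)) * z
        + (-((s x₁ + s x₂ - s x₃) * (s x₁ - s x₂ + s x₃)
          + (s x₁ + s x₂ - s x₃) * (-s x₁ + s x₂ + s x₃)
          + (s x₁ - s x₂ + s x₃) * (-s x₁ + s x₂ + s x₃))) * a
        + (s x₁ + s x₂ + s x₃) * b + (-1) * c) := by
    rw [← key, Finset.mul_sum]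
    exact Finset.sum_congr rfl fun x _ => by ring
  have i3 (x₁ x₂ : X) : ∑ x₃, r x₁ * r x₂ * r x₃ *
      (((s x₁ + s x₂ - s x₃) * (s x₁ - s x₂ + s x₃) * (-s x₁ + s x₂ + s x₃)) * z
        + (-((s x₁ + s x₂ - s x₃) * (s x₁ - s x₂ + s x₃)
          + (s x₁ + s x₂ - s x₃) * (-s x₁ + s x₂ + s x₃)
          + (s x₁ - s x₂ + s x₃) * (-s x₁ + s x₂ + s x₃))) * a
        + (s x₁ + s x₂ + s x₃) * b + (-1) * c) =
      r x₁ * r x₂ * (((-(s x₁ ^ 3) + s x₁ ^ 2 * s x₂ + s x₁ * s x₂ ^ 2 - s x₂ ^ 3) * z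
        + (s x₁ ^ 2 - 2 * s x₁ * s x₂ + s x₂ ^ 2) * a + (s x₁ + s x₂) * b - c) * z
        + ((s x₁ ^ 2 - 2 * s x₁ * s x₂ + s x₂ ^ 2) * z - 2 * (s x₁ + s x₂) * a + b) * a
        + ((s x₁ + s x₂) * z + a) * b + (-z) * c) := by
    have h := key ((-(s x₁ ^ 3) + s x₁ ^ 2 * s x₂ + s x₁ * s x₂ ^ 2 - s x₂ ^ 3) * z
        + (s x₁ ^ 2 - 2 * s x₁ * s x₂ + s x₂ ^ 2) * a + (s x₁ + s x₂) * b - c)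
      ((s x₁ ^ 2 - 2 * s x₁ * s x₂ + s x₂ ^ 2) * z - 2 * (s x₁ + s x₂) * a + b)
      ((s x₁ + s x₂) * z + a) (-z)
    rw [← h, Finset.mul_sum]
    exact Finset.sum_congr rfl fun x _ => by ring
  have i2 (x₁ : X) : ∑ x₂, r x₁ * r x₂ *
      (((-(s x₁ ^ 3) + s x₁ ^ 2 * s x₂ + s x₁ * s x₂ ^ 2 - s x₂ ^ 3) * z
        + (s x₁ ^ 2 - 2 * s x₁ * s x₂ + s x₂ ^ 2) * a + (s x₁ + s x₂) * b - c) * z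
        + ((s x₁ ^ 2 - 2 * s x₁ * s x₂ + s x₂ ^ 2) * z - 2 * (s x₁ + s x₂) * a + b) * a
        + ((s x₁ + s x₂) * z + a) * b + (-z) * c) =
      r x₁ * ((-(s x₁ ^ 3) * z ^ 2 + 2 * s x₁ ^ 2 * a * z + 2 * s x₁ * b * z - 2 * c * z
          - 2 * s x₁ * a ^ 2 + 2 * a * b) * z
        + (s x₁ ^ 2 * z ^ 2 - 4 * s x₁ * a * z + 2 * b * z - 2 * a ^ 2) * a
        + (s x₁ * z ^ 2 + 2 * a * z) * b + (-z ^ 2) * c) := by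
    have h := key (-(s x₁ ^ 3) * z ^ 2 + 2 * s x₁ ^ 2 * a * z + 2 * s x₁ * b * z - 2 * c * z
          - 2 * s x₁ * a ^ 2 + 2 * a * b)
        (s x₁ ^ 2 * z ^ 2 - 4 * s x₁ * a * z + 2 * b * z - 2 * a ^ 2)
        (s x₁ * z ^ 2 + 2 * a * z) (-z ^ 2)
    rw [← h, Finset.mul_sum]
    exact Finset.sum_congr rfl fun x _ => by ring
  have i1 : ∑ x₁, r x₁ * ((-(s x₁ ^ 3) * z ^ 2 + 2 * s x₁ ^ 2 * a * z + 2 * s x₁ * b * z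
          - 2 * c * z - 2 * s x₁ * a ^ 2 + 2 * a * b) * z
        + (s x₁ ^ 2 * z ^ 2 - 4 * s x₁ * a * z + 2 * b * z - 2 * a ^ 2) * a
        + (s x₁ * z ^ 2 + 2 * a * z) * b + (-z ^ 2) * c) =
      -4 * (z * (c * z ^ 2 - 3 * a * b * z + 2 * a ^ 3)) := by
    have h := key (-2 * c * z ^ 2 + 2 * a * b * z + 2 * a * b * z - 2 * a ^ 3 + 2 * a * b * z
        - c * z ^ 2)
      (2 * b * z ^ 2 - 2 * a ^ 2 * z - 4 * a ^ 2 * z + b * z ^ 2) (2 * a * z ^ 2 + a * z ^ 2)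
      (-z ^ 3)
    refine Eq.trans ?_ (h.trans ?_)
    · exact Finset.sum_congr rfl fun x _ => by ring
    · ring
  simp only [i4, i3, i2, i1]

/-- The Griffiths--Hurst--Sherman inequality in a homogeneous field: the third cumulant of the
total spin is nonpositive. -/
theorem ghs_inequality (hJ : ∀ e, 0 ≤ J e) {t : ℝ} (ht : 0 ≤ t) :
    (∑ σ, isingWeight J p q t σ * (∑ v, spinVal (σ v)) ^ 3) * (∑ σ, isingWeight J p q t σ) ^ 2
      - 3 * (∑ σ, isingWeight J p q t σ * ∑ v, spinVal (σ v)) *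
        (∑ σ, isingWeight J p q t σ * (∑ v, spinVal (σ v)) ^ 2) * (∑ σ, isingWeight J p q t σ)
      + 2 * (∑ σ, isingWeight J p q t σ * ∑ v, spinVal (σ v)) ^ 3 ≤ 0 := by
  set K := siteProducts V quadMonomials
  have hK := sum_nonneg_of_mem_siteProducts (V := V) quadMonomials sum_nonneg_of_mem_quadMonomials
  have hφ (a : Fin 4) (v : V) : (fun x : V → QuadSpin => quadVar a (x v)) ∈ K :=
    comp_apply_mem_siteProducts (quadVar_mem a) v
  -- The rows of the rotation are orthogonal of squared norm `4`, so the energy of four copies is `J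
  -- / 4` times a sum of products of like rotated variables. The field couples only to the variable
  -- of index `0`.
  let c : (E × Fin 4) ⊕ V → ℝ := Sum.elim (fun e => J e.1 / 4) fun _ => t
  let f : (E × Fin 4) ⊕ V → (V → QuadSpin) → ℝ := Sum.elim
    (fun e => (fun x => quadVar e.2 (x (p e.1))) * fun x => quadVar e.2 (x (q e.1)))
    fun v x => quadVar 0 (x v)
  have hc : ∀ i, 0 ≤ c i := by
    rintro (e | v)
    exacts [div_nonneg (hJ _) (by norm_num), ht]
  have hf : ∀ i, f i ∈ K := by
    rintro (e | v)
    exacts [mul_mem (hφ _ _) (hφ _ _), hφ _ _]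
  have hpos : 0 ≤ ∑ x : V → QuadSpin, (∑ v, quadVar 1 (x v)) * (∑ v, quadVar 2 (x v)) *
      (∑ v, quadVar 3 (x v)) * Real.exp (∑ i, c i * f i x) := by
    have : ∀ u v w : V, 0 ≤ ∑ x : V → QuadSpin, (quadVar 1 (x u) * quadVar 2 (x v) *
        quadVar 3 (x w)) * Real.exp (∑ i, c i * f i x) := fun u v w =>
      sum_mul_exp_nonneg K hK Finset.univ c hc f hf
        (mul_mem (mul_mem (hφ 1 u) (hφ 2 v)) (hφ 3 w))
    have h := Finset.sum_nonneg fun u (_ : u ∈ Finset.univ) =>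
      Finset.sum_nonneg fun v (_ : v ∈ Finset.univ) =>
        Finset.sum_nonneg fun w (_ : w ∈ Finset.univ) => this u v w
    refine h.trans_eq ?_
    rw [Finset.sum_congr rfl fun u _ => Finset.sum_congr rfl fun v _ => Finset.sum_comm,
      Finset.sum_congr rfl fun u _ => Finset.sum_comm, Finset.sum_comm]
    refine Finset.sum_congr rfl fun x _ => ?_
    rw [Finset.sum_mul_sum]
    simp only [Finset.sum_mul]
    simp only [Finset.mul_sum, Finset.sum_mul]
  have hexp (σ₁ σ₂ σ₃ σ₄ : V → ℤˣ) :
      Real.exp (∑ i, c i * f i fun v => ((σ₁ v, σ₂ v), (σ₃ v, σ₄ v))) =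
      isingWeight J p q t σ₁ * isingWeight J p q t σ₂ * isingWeight J p q t σ₃ *
        isingWeight J p q t σ₄ := by
    simp only [isingWeight, ← Real.exp_add]
    congr 1
    simp only [Fintype.sum_sum_type, c, f, Sum.elim_inl, Sum.elim_inr, Fintype.sum_prod_type,
      Fin.sum_univ_four, Pi.mul_apply, quadVar, Matrix.cons_val, Finset.mul_sum]
    have h (A B C D a b c d : ℝ) : A + a + (B + b) + (C + c) + (D + d) =
      (A + B + C + D) + (a + b + c + d) := by ring
    rw [h]
    simp only [← Finset.sum_add_distrib]
    congr 1 <;> exact Finset.sum_congr rfl fun x _ => by ring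
  simp only [sum_arrow_prod, hexp, quadVar, Matrix.cons_val, Finset.sum_add_distrib,
    Finset.sum_sub_distrib, Finset.sum_neg_distrib] at hpos
  rw [sum_cumulant_copies] at hpos
  have hz : 0 < ∑ σ, isingWeight J p q t σ :=
    Finset.sum_pos (fun σ _ => isingWeight_pos J p q t σ) Finset.univ_nonempty
  nlinarith [hpos, hz]

/-- Griffiths' first inequality for two-point functions in zero field. -/
theorem griffiths_first (hJ : ∀ e, 0 ≤ J e) (i j : V) :
    0 ≤ ∑ σ, isingWeight J p q 0 σ * (spinVal (σ i) * spinVal (σ j)) := by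
  have hK := sum_nonneg_of_mem_siteProducts (V := V) spinPowers sum_nonneg_of_mem_spinPowers
  have hφ (v : V) : (fun x : V → ℤˣ => spinVal (x v)) ∈ siteProducts V spinPowers :=
    comp_apply_mem_siteProducts (Submonoid.mem_powers _) v
  have h := sum_mul_exp_nonneg _ hK Finset.univ J hJ
    (fun e => (fun x => spinVal (x (p e))) * fun x => spinVal (x (q e)))
    (fun e => mul_mem (hφ _) (hφ _)) (mul_mem (hφ i) (hφ j))
  refine h.trans_eq (Finset.sum_congr rfl fun σ _ => ?_)
  simp [isingWeight, mul_comm]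

/-- Griffiths' second inequality for two-point functions in zero field. -/
theorem griffiths_second (hJ : ∀ e, 0 ≤ J e) (i j k l : V) :
    (∑ σ, isingWeight J p q 0 σ * (spinVal (σ i) * spinVal (σ j))) *
      (∑ σ, isingWeight J p q 0 σ * (spinVal (σ k) * spinVal (σ l))) ≤
    (∑ σ, isingWeight J p q 0 σ * (spinVal (σ i) * spinVal (σ j) * (spinVal (σ k) * spinVal (σ l))))
      * ∑ σ, isingWeight J p q 0 σ := by
  set K := siteProducts V pairMonomials
  have hK := sum_nonneg_of_mem_siteProducts (V := V) pairMonomials sum_nonneg_of_mem_pairMonomials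
  have ha (v : V) : (fun x : V → ℤˣ × ℤˣ => spinVal (x v).1 + spinVal (x v).2) ∈ K :=
    comp_apply_mem_siteProducts (K := pairMonomials) (φ := fun s => spinVal s.1 + spinVal s.2)
      ⟨1, 0, by ext s; simp⟩ v
  have hd (v : V) : (fun x : V → ℤˣ × ℤˣ => spinVal (x v).1 - spinVal (x v).2) ∈ K :=
    comp_apply_mem_siteProducts (K := pairMonomials) (φ := fun s => spinVal s.1 - spinVal s.2)
      ⟨0, 1, by ext s; simp⟩ v
  -- Two copies: `σ_p σ_q + τ_p τ_q` is half the product of the sums plus half the product of the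
  -- differences, hence the coefficients `J e / 2` below.
  let f : E ⊕ E → (V → ℤˣ × ℤˣ) → ℝ := Sum.elim
    (fun e => (fun x => spinVal (x (p e)).1 + spinVal (x (p e)).2) *
      fun x => spinVal (x (q e)).1 + spinVal (x (q e)).2)
    (fun e => (fun x => spinVal (x (p e)).1 - spinVal (x (p e)).2) *
      fun x => spinVal (x (q e)).1 - spinVal (x (q e)).2)
  let c : E ⊕ E → ℝ := Sum.elim (fun e => J e / 2) fun e => J e / 2
  have hc : ∀ e, 0 ≤ c e := by
    rintro (e | e) <;> exact div_nonneg (hJ e) (by norm_num)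
  have hf : ∀ e, f e ∈ K := by
    rintro (e | e)
    exacts [mul_mem (ha _) (ha _), mul_mem (hd _) (hd _)]
  have hexp (σ τ : V → ℤˣ) : Real.exp (∑ e, c e * f e fun v => (σ v, τ v)) =
      isingWeight J p q 0 σ * isingWeight J p q 0 τ := by
    simp only [isingWeight, ← Real.exp_add, Fintype.sum_sum_type, c, f, Sum.elim_inl,
      Sum.elim_inr, Pi.mul_apply, zero_mul, add_zero, ← Finset.sum_add_distrib]
    congr 1
    exact Finset.sum_congr rfl fun x _ => by ring
  have pos (g : (V → ℤˣ × ℤˣ) → ℝ) (hg : g ∈ K) :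
      0 ≤ ∑ σ, ∑ τ, g (fun v => (σ v, τ v)) *
        (isingWeight J p q 0 σ * isingWeight J p q 0 τ) := by
    have h := sum_mul_exp_nonneg K hK Finset.univ c hc f hf hg
    simpa only [sum_arrow_prod, hexp] using h
  -- With `a = σ + τ` and `d = σ - τ`, one has `8 σ_i σ_j (σ_k σ_l - τ_k τ_l) = (a_i + d_i)(a_j +
  -- d_j)(a_k d_l + d_k a_l)`; these are its eight monomials.
  have h := add_nonneg (add_nonneg (add_nonneg
    (pos _ (mul_mem (mul_mem (ha i) (ha j)) (mul_mem (ha k) (hd l))))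
    (pos _ (mul_mem (mul_mem (ha i) (hd j)) (mul_mem (ha k) (hd l)))))
    (add_nonneg (pos _ (mul_mem (mul_mem (hd i) (ha j)) (mul_mem (ha k) (hd l))))
    (pos _ (mul_mem (mul_mem (hd i) (hd j)) (mul_mem (ha k) (hd l))))))
    (add_nonneg (add_nonneg (pos _ (mul_mem (mul_mem (ha i) (ha j)) (mul_mem (hd k) (ha l))))
    (pos _ (mul_mem (mul_mem (ha i) (hd j)) (mul_mem (hd k) (ha l)))))
    (add_nonneg (pos _ (mul_mem (mul_mem (hd i) (ha j)) (mul_mem (hd k) (ha l))))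
    (pos _ (mul_mem (mul_mem (hd i) (hd j)) (mul_mem (hd k) (ha l))))))
  simp only [← Finset.sum_add_distrib, Pi.mul_apply] at h
  rw [← sub_nonneg, ← mul_nonneg_iff_of_pos_left (show (0 : ℝ) < 8 by norm_num),
    Finset.sum_mul_sum, Finset.sum_mul_sum, ← Finset.sum_sub_distrib, Finset.mul_sum]
  refine h.trans_eq (Finset.sum_congr rfl fun σ _ => ?_)
  rw [← Finset.sum_sub_distrib, Finset.mul_sum]
  exact Finset.sum_congr rfl fun τ _ => by ring

end Ising

/-! ### Gibbs averages and their derivatives -/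

/-- The average of `f` with respect to the normalized weights `r`. -/
def gibbsMean {X : Type*} [Fintype X] (r f : X → ℝ) : ℝ := (∑ x, r x * f x) / ∑ x, r x

section GibbsMean

variable {X : Type*} [Fintype X] [Nonempty X]

omit [Nonempty X] in
theorem hasDerivAt_sum_exp (ρ h f : X → ℝ) (t : ℝ) :
    HasDerivAt (fun t => ∑ x, ρ x * Real.exp (t * h x) * f x)
      (∑ x, ρ x * Real.exp (t * h x) * (f x * h x)) t := by
  refine HasDerivAt.fun_sum fun x _ => ?_
  have h1 : HasDerivAt (fun t => t * h x) (h x) t := by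
    simpa using (hasDerivAt_id t).mul_const (h x)
  convert! (h1.exp.const_mul (ρ x)).mul_const (f x) using 1
  ring

theorem hasDerivAt_gibbsMean {ρ : X → ℝ} (hρ : ∀ x, 0 < ρ x) (h f : X → ℝ) (t : ℝ) :
    HasDerivAt (fun t => gibbsMean (fun x => ρ x * Real.exp (t * h x)) f)
      (gibbsMean (fun x => ρ x * Real.exp (t * h x)) (fun x => f x * h x) -
        gibbsMean (fun x => ρ x * Real.exp (t * h x)) f *
          gibbsMean (fun x => ρ x * Real.exp (t * h x)) h) t := by
  have hz : ∑ x, ρ x * Real.exp (t * h x) ≠ 0 :=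
    (Finset.sum_pos (fun x _ => mul_pos (hρ x) (Real.exp_pos _)) Finset.univ_nonempty).ne'
  have h1 := hasDerivAt_sum_exp ρ h 1 t
  simp only [Pi.one_apply, mul_one, one_mul] at h1
  convert! (hasDerivAt_sum_exp ρ h f t).div h1 hz using 1
  simp only [gibbsMean]
  field_simp

theorem hasDerivAt_log_sum_exp {ρ : X → ℝ} (hρ : ∀ x, 0 < ρ x) (h : X → ℝ) (t : ℝ) :
    HasDerivAt (fun t => Real.log (∑ x, ρ x * Real.exp (t * h x)))
      (gibbsMean (fun x => ρ x * Real.exp (t * h x)) h) t := by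
  have hz : ∑ x, ρ x * Real.exp (t * h x) ≠ 0 :=
    (Finset.sum_pos (fun x _ => mul_pos (hρ x) (Real.exp_pos _)) Finset.univ_nonempty).ne'
  have h1 := hasDerivAt_sum_exp ρ h 1 t
  simp only [Pi.one_apply, mul_one, one_mul] at h1
  exact h1.log hz

/-- Cauchy-Schwarz for the vectors `√r` and `√r f`. -/
theorem gibbsMean_sq_sub_nonneg {r : X → ℝ} (hr : ∀ x, 0 < r x) (f : X → ℝ) :
    0 ≤ gibbsMean r (fun x => f x ^ 2) - gibbsMean r f ^ 2 := by
  have hz : 0 < ∑ x, r x := Finset.sum_pos (fun x _ => hr x) Finset.univ_nonempty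
  have h := Finset.sum_mul_sq_le_sq_mul_sq Finset.univ (fun x => √(r x)) (fun x => √(r x) * f x)
  have e1 : ∀ x, √(r x) * (√(r x) * f x) = r x * f x := fun x => by
    rw [← mul_assoc, Real.mul_self_sqrt (hr x).le]
  have e2 : ∀ x, (√(r x) * f x) ^ 2 = r x * f x ^ 2 := fun x => by
    rw [mul_pow, Real.sq_sqrt (hr x).le]
  simp only [e1, e2, Real.sq_sqrt (hr _).le] at h
  rw [sub_nonneg, gibbsMean, gibbsMean, div_pow, div_le_div_iff₀ (by positivity) hz]
  calc _ ≤ (∑ x, r x) * (∑ x, r x * f x ^ 2) * ∑ x, r x := by gcongr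
    _ = _ := by ring

omit [Nonempty X] in
theorem gibbsMean_const_mul (r f : X → ℝ) (c : ℝ) :
    gibbsMean r (fun x => c * f x) = c * gibbsMean r f := by
  simp only [gibbsMean, mul_left_comm _ c, ← Finset.mul_sum, mul_div_assoc]

omit [Nonempty X] in
theorem gibbsMean_sum {ι : Type*} (r : X → ℝ) (s : Finset ι) (f : ι → X → ℝ) :
    gibbsMean r (fun x => ∑ i ∈ s, f i x) = ∑ i ∈ s, gibbsMean r (f i) := by
  simp only [gibbsMean, Finset.mul_sum, ← Finset.sum_div]
  rw [Finset.sum_comm]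

theorem gibbsMean_one {r : X → ℝ} (hr : ∀ x, 0 < r x) : gibbsMean r (fun _ => 1) = 1 := by
  have hz : 0 < ∑ x, r x := Finset.sum_pos (fun x _ => hr x) Finset.univ_nonempty
  simp [gibbsMean, div_self hz.ne']

end GibbsMean

/-! ### Cumulants of the total spin and two-point functions. -/

section IsingMean

variable {V E : Type*} [Fintype V] [DecidableEq V] [Fintype E] (J : E → ℝ) (p q : E → V)

/-- The mean of the total spin of an Ising model. -/
def isingMean (t : ℝ) : ℝ := gibbsMean (isingWeight J p q t) fun σ => ∑ v, spinVal (σ v)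

/-- The variance of the total spin of an Ising model. -/
def isingVar (t : ℝ) : ℝ :=
  gibbsMean (isingWeight J p q t) (fun σ => (∑ v, spinVal (σ v)) ^ 2) - isingMean J p q t ^ 2

/-- The zero-field two-point function of an Ising model. -/
def twoPoint (i j : V) : ℝ :=
  gibbsMean (isingWeight J p q 0) fun σ => spinVal (σ i) * spinVal (σ j)

omit [DecidableEq V] in
theorem isingWeight_eq (t : ℝ) (σ : V → ℤˣ) : isingWeight J p q t σ =
    isingWeight J p q 0 σ * Real.exp (t * ∑ v, spinVal (σ v)) := by
  simp [isingWeight, Real.exp_add]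

theorem hasDerivAt_log_ising (t : ℝ) :
    HasDerivAt (fun t => Real.log (∑ σ, isingWeight J p q t σ)) (isingMean J p q t) t := by
  have h := hasDerivAt_log_sum_exp (isingWeight_pos J p q 0) (fun σ => ∑ v, spinVal (σ v)) t
  simpa only [← isingWeight_eq, isingMean] using h

theorem hasDerivAt_isingWeight_gibbsMean (f : (V → ℤˣ) → ℝ) (t : ℝ) :
    HasDerivAt (fun t => gibbsMean (isingWeight J p q t) f)
      (gibbsMean (isingWeight J p q t) (fun σ => f σ * ∑ v, spinVal (σ v)) -
        gibbsMean (isingWeight J p q t) f * isingMean J p q t) t := by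
  have h := hasDerivAt_gibbsMean (isingWeight_pos J p q 0) (fun σ => ∑ v, spinVal (σ v)) f t
  have e (t : ℝ) : (fun σ => isingWeight J p q 0 σ * Real.exp (t * ∑ v, spinVal (σ v))) =
      isingWeight J p q t := by ext σ; rw [← isingWeight_eq]
  simpa only [e, isingMean] using h

theorem hasDerivAt_isingMean (t : ℝ) :
    HasDerivAt (isingMean J p q) (isingVar J p q t) t := by
  convert! hasDerivAt_isingWeight_gibbsMean J p q (fun σ => ∑ v, spinVal (σ v)) t using 1
  simp only [isingVar, isingMean, sq]

theorem isingVar_nonneg (t : ℝ) : 0 ≤ isingVar J p q t :=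
  gibbsMean_sq_sub_nonneg (isingWeight_pos J p q t) _

theorem hasDerivAt_isingVar (t : ℝ) :
    HasDerivAt (isingVar J p q)
      (gibbsMean (isingWeight J p q t) (fun σ => (∑ v, spinVal (σ v)) ^ 3) -
        gibbsMean (isingWeight J p q t) (fun σ => (∑ v, spinVal (σ v)) ^ 2) * isingMean J p q t -
        2 * isingMean J p q t * isingVar J p q t) t := by
  convert! (hasDerivAt_isingWeight_gibbsMean J p q (fun σ => (∑ v, spinVal (σ v)) ^ 2) t).sub
    ((hasDerivAt_isingMean J p q t).pow 2) using 1
  simp only [← pow_succ]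
  norm_num

/-- The derivative of the variance in the field is the third cumulant, nonpositive by GHS. -/
theorem antitoneOn_isingVar (hJ : ∀ e, 0 ≤ J e) : AntitoneOn (isingVar J p q) (Set.Ici 0) := by
  refine antitoneOn_of_deriv_nonpos (convex_Ici 0)
    (fun t _ => (hasDerivAt_isingVar J p q t).continuousAt.continuousWithinAt)
    (fun t _ => (hasDerivAt_isingVar J p q t).differentiableAt.differentiableWithinAt) ?_
  intro t ht
  rw [interior_Ici, Set.mem_Ioi] at ht
  rw [(hasDerivAt_isingVar J p q t).deriv]
  have h := ghs_inequality J p q hJ ht.le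
  have hz : 0 < ∑ σ, isingWeight J p q t σ :=
    Finset.sum_pos (fun σ _ => isingWeight_pos J p q t σ) Finset.univ_nonempty
  have h' := div_nonpos_of_nonpos_of_nonneg h (pow_nonneg hz.le 3)
  refine Eq.trans_le ?_ h'
  simp only [isingVar, isingMean, gibbsMean]
  field_simp
  ring

theorem sum_isingWeight_neg (f : (V → ℤˣ) → ℝ) (t : ℝ) :
    ∑ σ, isingWeight J p q (-t) σ * f σ = ∑ σ, isingWeight J p q t σ * f (-σ) := by
  refine Fintype.sum_equiv (Equiv.neg _) _ _ fun σ => ?_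
  simp [isingWeight, spinVal]

theorem isingMean_neg (t : ℝ) : isingMean J p q (-t) = -isingMean J p q t := by
  have h1 := sum_isingWeight_neg J p q (fun σ => ∑ v, spinVal (σ v)) t
  have h2 := sum_isingWeight_neg J p q (fun _ => 1) t
  simp only [mul_one] at h2
  rw [isingMean, gibbsMean, h1, h2]
  simp [spinVal, isingMean, gibbsMean, neg_div]

theorem isingVar_neg (t : ℝ) : isingVar J p q (-t) = isingVar J p q t := by
  have h1 := sum_isingWeight_neg J p q (fun σ => (∑ v, spinVal (σ v)) ^ 2) t
  have h2 := sum_isingWeight_neg J p q (fun _ => 1) t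
  simp only [mul_one] at h2
  rw [isingVar, isingMean_neg, gibbsMean, h1, h2]
  simp [spinVal, isingVar, gibbsMean]

theorem isingMean_zero : isingMean J p q 0 = 0 := by
  have h := isingMean_neg J p q 0
  rw [neg_zero] at h
  linarith

theorem isingVar_zero : isingVar J p q 0 = ∑ i, ∑ j, twoPoint J p q i j := by
  rw [isingVar, isingMean_zero]
  simp only [sq, Finset.sum_mul_sum, gibbsMean_sum, twoPoint]
  simp

theorem twoPoint_nonneg (hJ : ∀ e, 0 ≤ J e) (i j : V) : 0 ≤ twoPoint J p q i j :=
  div_nonneg (griffiths_first J p q hJ i j)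
    (Finset.sum_nonneg fun σ _ => (isingWeight_pos J p q 0 σ).le)

theorem twoPoint_self (i : V) : twoPoint J p q i i = 1 := by
  simp only [twoPoint, ← sq, spinVal_sq]
  exact gibbsMean_one (isingWeight_pos J p q 0)

theorem griffiths_second_mean (hJ : ∀ e, 0 ≤ J e) (i j k l : V) :
    twoPoint J p q i j * twoPoint J p q k l ≤ gibbsMean (isingWeight J p q 0)
      fun σ => spinVal (σ i) * spinVal (σ j) * (spinVal (σ k) * spinVal (σ l)) := by
  have hz : 0 < ∑ σ, isingWeight J p q 0 σ :=
    Finset.sum_pos (fun σ _ => isingWeight_pos J p q 0 σ) Finset.univ_nonempty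
  simp only [twoPoint, gibbsMean]
  rw [div_mul_div_comm, div_le_div_iff₀ (by positivity) hz]
  calc _ ≤ _ := mul_le_mul_of_nonneg_right (griffiths_second J p q hJ i j k l) hz.le
    _ = _ := by ring

/-- The two-point function along a linear interpolation of the couplings. -/
theorem hasDerivAt_twoPoint_interpolation (J₀ J₁ : E → ℝ) (i j : V) (t : ℝ) :
    HasDerivAt (fun t => twoPoint (J₀ + t • J₁) p q i j)
      (∑ e, J₁ e * (gibbsMean (isingWeight (J₀ + t • J₁) p q 0)
          (fun σ => spinVal (σ i) * spinVal (σ j) * (spinVal (σ (p e)) * spinVal (σ (q e)))) -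
        twoPoint (J₀ + t • J₁) p q i j * twoPoint (J₀ + t • J₁) p q (p e) (q e))) t := by
  have h := hasDerivAt_gibbsMean (isingWeight_pos J₀ p q 0)
    (fun σ => ∑ e, J₁ e * (spinVal (σ (p e)) * spinVal (σ (q e))))
    (fun σ => spinVal (σ i) * spinVal (σ j)) t
  have e (t : ℝ) : (fun σ => isingWeight J₀ p q 0 σ *
      Real.exp (t * ∑ e, J₁ e * (spinVal (σ (p e)) * spinVal (σ (q e))))) =
      isingWeight (J₀ + t • J₁) p q 0 := by
    ext σ
    simp only [isingWeight, ← Real.exp_add, zero_mul, add_zero, Pi.add_apply, Pi.smul_apply,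
      smul_eq_mul]
    rw [Finset.mul_sum, ← Finset.sum_add_distrib]
    congr 1
    exact Finset.sum_congr rfl fun x _ => by ring
  simp only [e] at h
  convert! h using 1
  simp only [Finset.mul_sum, gibbsMean_sum]
  rw [← Finset.sum_sub_distrib]
  refine Finset.sum_congr rfl fun e _ => ?_
  rw [gibbsMean_const_mul, mul_sub, ← gibbsMean_const_mul]
  simp only [twoPoint]
  congr 1
  · congr 1
    ext σ
    ring
  · ring

/-- By Griffiths' second inequality two-point functions increase with each coupling. -/
theorem twoPoint_le_of_interpolation {J₀ J₁ : E → ℝ} (h₀ : ∀ e, 0 ≤ J₀ e) (h₁ : ∀ e, 0 ≤ J₁ e)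
    (i j : V) {t : ℝ} (ht : t ∈ Set.Icc (0 : ℝ) 1) :
    twoPoint (J₀ + t • J₁) p q i j ≤ twoPoint (J₀ + (1 : ℝ) • J₁) p q i j := by
  have hm : MonotoneOn (fun t : ℝ => twoPoint (J₀ + t • J₁) p q i j) (Set.Ici 0) := by
    refine monotoneOn_of_deriv_nonneg (convex_Ici 0)
      (fun t _ => (hasDerivAt_twoPoint_interpolation p q J₀ J₁ i j t).continuousAt.continuousWithinAt)
      (fun t _ => (hasDerivAt_twoPoint_interpolation p q J₀ J₁ i j
        t).differentiableAt.differentiableWithinAt) fun t ht => ?_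
    rw [interior_Ici, Set.mem_Ioi] at ht
    rw [(hasDerivAt_twoPoint_interpolation p q J₀ J₁ i j t).deriv]
    refine Finset.sum_nonneg fun e _ => mul_nonneg (h₁ e) (sub_nonneg.2 ?_)
    exact griffiths_second_mean _ p q
      (fun e => add_nonneg (h₀ e) (mul_nonneg ht.le (h₁ e))) i j (p e) (q e)
  exact hm ht.1 (Set.mem_Ici.2 zero_le_one) ht.2

/-- Flipping the isolated spin at `i` preserves the weight and changes the sign of the observable.
-/
theorem twoPoint_eq_zero {i j : V} (hij : i ≠ j) (hp : ∀ e, p e = i ∨ q e = i → J e = 0) :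
    twoPoint J p q i j = 0 := by
  let φ : (V → ℤˣ) ≃ (V → ℤˣ) := Equiv.mulLeft (Pi.mulSingle i (-1))
  have hφ (σ : V → ℤˣ) (v : V) (hv : v ≠ i) : φ σ v = σ v := by
    simp [φ, Pi.mulSingle_eq_of_ne hv]
  have h : ∑ σ, isingWeight J p q 0 σ * (spinVal (σ i) * spinVal (σ j)) =
      ∑ σ, -(isingWeight J p q 0 σ * (spinVal (σ i) * spinVal (σ j))) := by
    refine Fintype.sum_equiv φ _ _ fun σ => ?_
    have h1 : isingWeight J p q 0 (φ σ) = isingWeight J p q 0 σ := by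
      simp only [isingWeight, zero_mul, add_zero]
      congr 1
      refine Finset.sum_congr rfl fun e _ => ?_
      by_cases he : p e = i ∨ q e = i
      · simp [hp e he]
      · rw [not_or] at he
        rw [hφ _ _ he.1, hφ _ _ he.2]
    rw [h1, hφ σ j hij.symm]
    simp [φ, spinVal]
  rw [Finset.sum_neg_distrib] at h
  rw [twoPoint, gibbsMean, show ∑ σ, isingWeight J p q 0 σ * (spinVal (σ i) * spinVal (σ j)) = 0 by
    linarith, zero_div]

/-- The edges at `i` are switched on linearly, starting from a two-point function equal to zero.
Since `σ_i² = 1`, an edge from `i` to `k` contributes to the derivative at most its coupling times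
the two-point function of `k` and `j`, which is largest at the full couplings. -/
theorem twoPoint_le_sum (hJ : ∀ e, 0 ≤ J e) (hpq : ∀ e, p e ≠ q e) {i j : V} (hij : i ≠ j) :
    twoPoint J p q i j ≤ ∑ e, ((if p e = i then J e * twoPoint J p q (q e) j else 0) +
      if q e = i then J e * twoPoint J p q (p e) j else 0) := by
  set J₁ : E → ℝ := fun e => if p e = i ∨ q e = i then J e else 0 with hJ₁
  set J₀ : E → ℝ := J - J₁ with hJ₀
  have h₁ e : 0 ≤ J₁ e := by
    simp only [hJ₁]; split_ifs; exacts [hJ e, le_rfl]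
  have h₀ e : 0 ≤ J₀ e := by
    simp only [hJ₀, hJ₁, Pi.sub_apply]; split_ifs; exacts [(sub_self _).ge, by simpa using hJ e]
  have hone : J₀ + (1 : ℝ) • J₁ = J := by simp [hJ₀]
  set C := ∑ e, ((if p e = i then J e * twoPoint J p q (q e) j else 0) +
      if q e = i then J e * twoPoint J p q (p e) j else 0)
  have hzero : twoPoint (J₀ + (0 : ℝ) • J₁) p q i j = 0 := by
    refine twoPoint_eq_zero _ p q hij fun e he => ?_
    simp [hJ₀, hJ₁, he]
  have hd : ∀ t ∈ interior (Set.Icc (0 : ℝ) 1),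
      deriv (fun t : ℝ => twoPoint (J₀ + t • J₁) p q i j) t ≤ C := by
    intro t ht
    rw [interior_Icc] at ht
    rw [(hasDerivAt_twoPoint_interpolation p q J₀ J₁ i j t).deriv]
    refine Finset.sum_le_sum fun e _ => ?_
    have hJt : ∀ e, 0 ≤ (J₀ + t • J₁) e := fun e =>
      add_nonneg (h₀ e) (mul_nonneg ht.1.le (h₁ e))
    have hmono (k : V) : twoPoint (J₀ + t • J₁) p q k j ≤ twoPoint J p q k j := by
      have := twoPoint_le_of_interpolation p q h₀ h₁ k j ⟨ht.1.le, ht.2.le⟩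
      rwa [hone] at this
    have hprod := mul_nonneg (twoPoint_nonneg _ p q hJt i j) (twoPoint_nonneg _ p q hJt (p e) (q e))
    by_cases hp : p e = i
    · have hq : q e ≠ i := fun h => hpq e (hp.trans h.symm)
      have e1 : (gibbsMean (isingWeight (J₀ + t • J₁) p q 0) fun σ =>
          spinVal (σ i) * spinVal (σ j) * (spinVal (σ (p e)) * spinVal (σ (q e)))) =
          twoPoint (J₀ + t • J₁) p q (q e) j := by
        rw [twoPoint]
        congr 1
        ext σ
        rw [hp]
        linear_combination (spinVal (σ j) * spinVal (σ (q e))) * spinVal_sq (σ i)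
      rw [e1]
      simp only [hJ₁, hp, hq, true_or, if_true, if_false, add_zero]
      rw [hp] at hprod
      exact mul_le_mul_of_nonneg_left (by linarith [hmono (q e)]) (hJ e)
    · by_cases hq : q e = i
      · have e1 : (gibbsMean (isingWeight (J₀ + t • J₁) p q 0) fun σ =>
            spinVal (σ i) * spinVal (σ j) * (spinVal (σ (p e)) * spinVal (σ (q e)))) =
            twoPoint (J₀ + t • J₁) p q (p e) j := by
          rw [twoPoint]
          congr 1
          ext σ
          rw [hq]
          linear_combination (spinVal (σ j) * spinVal (σ (p e))) * spinVal_sq (σ i)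
        rw [e1]
        simp only [hJ₁, hp, hq, or_true, if_true, if_false, zero_add]
        rw [hq] at hprod
        exact mul_le_mul_of_nonneg_left (by linarith [hmono (p e)]) (hJ e)
      · simp [hJ₁, hp, hq]
  have h := (convex_Icc (0 : ℝ) 1).image_sub_le_mul_sub_of_deriv_le
    (f := fun t : ℝ => twoPoint (J₀ + t • J₁) p q i j)
    (fun t _ => (hasDerivAt_twoPoint_interpolation p q J₀ J₁ i j t).continuousAt.continuousWithinAt)
    (fun t _ => (hasDerivAt_twoPoint_interpolation p q J₀ J₁ i j
        t).differentiableAt.differentiableWithinAt) hd 0 (by simp) 1 (by simp) zero_le_one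
  simp only [hone, hzero] at h
  linarith

/-- Susceptibility bound for couplings dominated by a rank-one matrix. -/
theorem isingVar_zero_le (hJ : ∀ e, 0 ≤ J e) (hpq : ∀ e, p e ≠ q e) {w : V → ℝ}
    (hw : ∀ v, 0 ≤ w v) {κ : ℝ} (hκ : 0 ≤ κ) (hJw : ∀ e, J e ≤ κ * (w (p e) * w (q e)))
    (hinj : ∀ (i : V) (F : V → ℝ), (∀ v, 0 ≤ F v) →
      ∑ e, ((if p e = i then F (q e) else 0) + if q e = i then F (p e) else 0) ≤ ∑ k, F k)
    (hlt : κ * ∑ v, w v ^ 2 < 1) :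
    isingVar J p q 0 ≤
      Fintype.card V + κ * (∑ v, w v) ^ 2 / (1 - κ * ∑ v, w v ^ 2) := by
  have hc := twoPoint_nonneg J p q hJ
  have h1 (i j : V) : twoPoint J p q i j ≤
      (if i = j then 1 else 0) + κ * w i * ∑ k, w k * twoPoint J p q k j := by
    have hs : 0 ≤ κ * w i * ∑ k, w k * twoPoint J p q k j :=
      mul_nonneg (mul_nonneg hκ (hw i)) (Finset.sum_nonneg fun k _ => mul_nonneg (hw k) (hc k j))
    split_ifs with hij
    · rw [hij, twoPoint_self]
      rw [hij] at hs
      linarith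
    · rw [zero_add]
      refine (twoPoint_le_sum J p q hJ hpq hij).trans ?_
      refine le_trans (Finset.sum_le_sum fun e _ => ?_)
        ((hinj i (fun k => κ * w i * (w k * twoPoint J p q k j)) fun k =>
          mul_nonneg (mul_nonneg hκ (hw i)) (mul_nonneg (hw k) (hc k j))).trans_eq
          (Finset.mul_sum _ _ _).symm)
      refine add_le_add ?_ ?_
      · split_ifs with h
        · calc _ ≤ κ * (w (p e) * w (q e)) * twoPoint J p q (q e) j :=
              mul_le_mul_of_nonneg_right (hJw e) (hc _ _)
            _ = _ := by rw [h]; ring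
        · rfl
      · split_ifs with h
        · calc _ ≤ κ * (w (p e) * w (q e)) * twoPoint J p q (p e) j :=
              mul_le_mul_of_nonneg_right (hJw e) (hc _ _)
            _ = _ := by rw [h]; ring
        · rfl
  -- Summing the pointwise bound over `j`, and then over `i` with weights `w i`, gives a closed
  -- linear inequality for `T`; the rank-one domination makes one scalar suffice. It is solved using
  -- `κ ∑ w² < 1`.
  set T := ∑ k, ∑ j, w k * twoPoint J p q k j with hT
  have h2 (i : V) : ∑ j, twoPoint J p q i j ≤ 1 + κ * w i * T := by
    refine (Finset.sum_le_sum fun j _ => h1 i j).trans_eq ?_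
    rw [Finset.sum_add_distrib, ← Finset.mul_sum, Finset.sum_comm, ← hT]
    simp
  have h3 : T ≤ ∑ v, w v + κ * (∑ v, w v ^ 2) * T := by
    calc T = ∑ i, w i * ∑ j, twoPoint J p q i j := by rw [hT]; simp only [Finset.mul_sum]
      _ ≤ ∑ i, w i * (1 + κ * w i * T) :=
        Finset.sum_le_sum fun i _ => mul_le_mul_of_nonneg_left (h2 i) (hw i)
      _ = _ := by
        rw [mul_assoc, Finset.sum_mul, Finset.mul_sum, ← Finset.sum_add_distrib]
        exact Finset.sum_congr rfl fun i _ => by ring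
  have h4 : T ≤ (∑ v, w v) / (1 - κ * ∑ v, w v ^ 2) := by
    rw [le_div_iff₀ (by linarith)]
    linarith
  rw [isingVar_zero]
  refine (Finset.sum_le_sum fun i _ => h2 i).trans ?_
  rw [Finset.sum_add_distrib, ← Finset.sum_mul, ← Finset.mul_sum]
  have h5 := mul_le_mul_of_nonneg_left h4
    (mul_nonneg hκ (Finset.sum_nonneg fun v (_ : v ∈ Finset.univ) => hw v))
  refine add_le_add (by simp) (h5.trans_eq ?_)
  ring

end IsingMean

/-! ### The annealed measure as an Ising measure -/

/-- The odds ratio `w_i w_j / ℓ_N` of the edge `e`. -/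
def edgeOdds {N : ℕ} (w : Fin N → ℝ≥0) (e : VertexPair N) : ℝ :=
  (w e.1.1 : ℝ) * w e.1.2 / totalWeight w

/-- The effective coupling of the annealed model along the edge `e`. -/
def annealedCoupling {N : ℕ} (w : Fin N → ℝ≥0) (β : ℝ) (e : VertexPair N) : ℝ :=
  2⁻¹ * (Real.log (1 + edgeOdds w e * Real.exp β) - Real.log (1 + edgeOdds w e * Real.exp (-β)))

/-- The configuration-independent factor of the annealed Boltzmann weight. -/
def annealedConst {N : ℕ} (w : Fin N → ℝ≥0) (β : ℝ) : ℝ :=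
  ∏ e : VertexPair N, Real.exp (2⁻¹ * (Real.log (1 + edgeOdds w e * Real.exp β) +
    Real.log (1 + edgeOdds w e * Real.exp (-β)))) / (1 + edgeOdds w e)

section Factor

variable {N : ℕ} (w : Fin N → ℝ≥0)

theorem edgeOdds_nonneg (e : VertexPair N) : 0 ≤ edgeOdds w e := by
  unfold edgeOdds; positivity

theorem edgeProb_eq (hw : ∀ i, 0 < w i) (e : VertexPair N) :
    (edgeProb w e.1.1 e.1.2 : ℝ) = edgeOdds w e / (1 + edgeOdds w e) := by
  have hl : (0 : ℝ) < totalWeight w := by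
    rw [NNReal.coe_pos]
    exact Finset.sum_pos (fun i _ => hw i) ⟨e.1.1, Finset.mem_univ _⟩
  rw [edgeProb, edgeOdds]
  push_cast
  field_simp

/-- Edges are independent, so the graph average is a product of Bernoulli averages `1 - p + p exp (β
σ_i σ_j)`. -/
theorem annealedFactor_eq_prod (hw : ∀ i, 0 < w i) (β B : ℝ) (σ : SpinConfig N) :
    annealedFactor w β B σ = Real.exp (B * totalSpin σ) * ∏ e : VertexPair N,
      (1 + edgeOdds w e * Real.exp (β * (spinVal (σ e.1.1) * spinVal (σ e.1.2)))) /
        (1 + edgeOdds w e) := by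
  have h (G : GraphConfig N) : boltzmannFactor β B G σ = Real.exp (B * totalSpin σ) *
      ∏ e : VertexPair N, Real.exp (β * if G e = true then
        spinVal (σ e.1.1) * spinVal (σ e.1.2) else 0) := by
    rw [boltzmannFactor, add_comm, Real.exp_add, Finset.mul_sum, Real.exp_sum]
  simp only [annealedFactor, h, integral_const_mul, grgLaw]
  congr 1
  rw [integral_fintype_prod_eq_prod (f := fun (e : VertexPair N) (b : Bool) =>
    Real.exp (β * if b = true then spinVal (σ e.1.1) * spinVal (σ e.1.2) else 0))]
  refine Finset.prod_congr rfl fun e _ => ?_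
  have hx := edgeOdds_nonneg w e
  rw [integral_bernoulliMeasure]
  simp only [if_true, Bool.false_eq_true, if_false, mul_zero, Real.exp_zero, smul_eq_mul, mul_one,
    edgeProb_eq w hw e]
  field_simp
  ring

/-- A positive function of `s = ±1` equals `exp (a + J s)`, where `a` and `J` are half the sum and
half the difference of the logarithms of its values at `1` and `-1`. -/
theorem annealedFactor_eq_isingWeight (hw : ∀ i, 0 < w i) (β B : ℝ) (σ : SpinConfig N) :
    annealedFactor w β B σ = annealedConst w β *
      isingWeight (annealedCoupling w β) (fun e => e.1.1) (fun e => e.1.2) B σ := by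
  rw [annealedFactor_eq_prod w hw, isingWeight, add_comm, Real.exp_add, annealedConst,
    mul_left_comm]
  congr 1
  rw [Real.exp_sum, ← Finset.prod_mul_distrib]
  refine Finset.prod_congr rfl fun e _ => ?_
  rw [div_mul_eq_mul_div, ← Real.exp_add]
  congr 1
  have hx := edgeOdds_nonneg w e
  have h1 : 0 < 1 + edgeOdds w e * Real.exp β := by positivity
  have h2 : 0 < 1 + edgeOdds w e * Real.exp (-β) := by positivity
  have hs : spinVal (σ e.1.1) * spinVal (σ e.1.2) = 1 ∨
      spinVal (σ e.1.1) * spinVal (σ e.1.2) = -1 := by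
    rcases Int.units_eq_one_or (σ e.1.1) with h | h <;>
      rcases Int.units_eq_one_or (σ e.1.2) with h' | h' <;> simp [h, h']
  rcases hs with h | h
  · rw [h, annealedCoupling]
    conv_lhs => rw [mul_one, ← Real.exp_log h1]
    congr 1
    ring
  · rw [h, annealedCoupling]
    conv_lhs => rw [mul_neg_one, ← Real.exp_log h2]
    congr 1
    ring

theorem annealedConst_pos (β : ℝ) : 0 < annealedConst w β :=
  Finset.prod_pos fun e _ => div_pos (Real.exp_pos _) (by linarith [edgeOdds_nonneg w e])

theorem integral_annealedMeasure (hw : ∀ i, 0 < w i) (β B : ℝ) (f : SpinConfig N → ℝ) :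
    ∫ σ, f σ ∂(annealedMeasure w β B) =
      gibbsMean (isingWeight (annealedCoupling w β) (fun e => e.1.1) (fun e => e.1.2) B) f := by
  have hC := (annealedConst_pos w β).ne'
  rw [annealedMeasure, integral_finsetSum_measure fun σ _ =>
    Integrable.of_finite.smul_measure ENNReal.ofReal_ne_top, gibbsMean,
    Finset.sum_div]
  refine Finset.sum_congr rfl fun σ _ => ?_
  rw [integral_smul_measure, integral_dirac, annealedPartition_eq, smul_eq_mul,
    ENNReal.toReal_ofReal (div_nonneg (annealedFactor_pos w β B σ).le
      (Finset.sum_nonneg fun τ _ => (annealedFactor_pos w β B τ).le))]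
  simp only [annealedFactor_eq_isingWeight w hw, ← Finset.mul_sum]
  rw [mul_div_mul_left _ _ hC, div_mul_eq_mul_div]

theorem annealedMagnetization_eq (hw : ∀ i, 0 < w i) (β B : ℝ) :
    annealedMagnetization w β B =
      isingMean (annealedCoupling w β) (fun e => e.1.1) (fun e => e.1.2) B / N := by
  rw [annealedMagnetization, integral_div, integral_annealedMeasure w hw]
  rfl

theorem hasDerivAt_annealedMagnetization (hw : ∀ i, 0 < w i) (β B : ℝ) :
    HasDerivAt (annealedMagnetization w β) (annealedSusceptibility w β B) B := by
  have h : HasDerivAt (annealedMagnetization w β)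
      (isingVar (annealedCoupling w β) (fun e => e.1.1) (fun e => e.1.2) B / N) B := by
    rw [funext (annealedMagnetization_eq w hw β)]
    exact (hasDerivAt_isingMean _ _ _ B).div_const _
  rw [annealedSusceptibility, h.deriv]
  exact h

theorem annealedSusceptibility_eq (hw : ∀ i, 0 < w i) (β B : ℝ) :
    annealedSusceptibility w β B =
      isingVar (annealedCoupling w β) (fun e => e.1.1) (fun e => e.1.2) B / N := by
  rw [annealedSusceptibility, funext (annealedMagnetization_eq w hw β)]
  exact ((hasDerivAt_isingMean _ _ _ B).div_const _).deriv

theorem annealedSusceptibility_nonneg (hw : ∀ i, 0 < w i) (β B : ℝ) :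
    0 ≤ annealedSusceptibility w β B := by
  rw [annealedSusceptibility_eq w hw]
  exact div_nonneg (isingVar_nonneg _ _ _ _) (Nat.cast_nonneg _)

theorem annealedPartition_pos (β B : ℝ) : 0 < annealedPartition w β B := by
  rw [annealedPartition_eq]
  exact Finset.sum_pos (fun σ _ => annealedFactor_pos w β B σ) Finset.univ_nonempty

theorem hasDerivAt_log_annealedPartition (hw : ∀ i, 0 < w i) (β B : ℝ) :
    HasDerivAt (fun b => Real.log (annealedPartition w β b))
      (isingMean (annealedCoupling w β) (fun e => e.1.1) (fun e => e.1.2) B) B := by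
  have h (b : ℝ) : Real.log (annealedPartition w β b) = Real.log (annealedConst w β) +
      Real.log (∑ σ, isingWeight (annealedCoupling w β) (fun e => e.1.1) (fun e => e.1.2) b σ) := by
    rw [annealedPartition_eq, ← Real.log_mul (annealedConst_pos w β).ne'
      (Finset.sum_pos (fun σ _ => isingWeight_pos _ _ _ b σ) Finset.univ_nonempty).ne',
      Finset.mul_sum]
    simp only [annealedFactor_eq_isingWeight w hw]
  simp only [h]
  exact (hasDerivAt_log_ising _ _ _ B).const_add _

theorem hasDerivAt_annealedPressure (hw : ∀ i, 0 < w i) (β B : ℝ) :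
    HasDerivAt (annealedPressure w β) (annealedMagnetization w β B) B := by
  rw [annealedMagnetization_eq w hw, div_eq_inv_mul, ← one_div]
  exact (hasDerivAt_log_annealedPartition w hw β B).const_mul _

theorem monotone_annealedMagnetization (hw : ∀ i, 0 < w i) (β : ℝ) :
    Monotone (annealedMagnetization w β) :=
  monotone_of_deriv_nonneg
    (fun B => (hasDerivAt_annealedMagnetization w hw β B).differentiableAt) fun B => by
    rw [(hasDerivAt_annealedMagnetization w hw β B).deriv]
    exact annealedSusceptibility_nonneg w hw β B

theorem annealedSusceptibility_neg (hw : ∀ i, 0 < w i) (β B : ℝ) :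
    annealedSusceptibility w β (-B) = annealedSusceptibility w β B := by
  rw [annealedSusceptibility_eq w hw, annealedSusceptibility_eq w hw, isingVar_neg]

theorem annealedPressure_neg (hw : ∀ i, 0 < w i) (β B : ℝ) :
    annealedPressure w β (-B) = annealedPressure w β B := by
  have h := sum_isingWeight_neg (annealedCoupling w β) (fun e => e.1.1) (fun e => e.1.2)
    (fun _ => 1) B
  simp only [mul_one] at h
  simp only [annealedPressure, annealedPartition_eq, annealedFactor_eq_isingWeight w hw,
    ← Finset.mul_sum, h]

theorem annealedCoupling_nonneg {β : ℝ} (hβ : 0 ≤ β) (e : VertexPair N) :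
    0 ≤ annealedCoupling w β e := by
  have hx := edgeOdds_nonneg w e
  refine mul_nonneg (by norm_num) (sub_nonneg.2 (Real.log_le_log (by positivity) ?_))
  gcongr
  linarith

/-- As a function of the odds `x`, the coupling vanishes at `0` and has derivative `sinh β / ((1 + x
e^β)(1 + x e^(-β))) ≤ sinh β`. This gives the rank-one domination. -/
theorem annealedCoupling_le {β : ℝ} (hβ : 0 ≤ β) (e : VertexPair N) :
    annealedCoupling w β e ≤ Real.sinh β * edgeOdds w e := by
  set x := edgeOdds w e with hxd
  have hx : 0 ≤ x := edgeOdds_nonneg w e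
  have hp (c y : ℝ) (hy : 0 ≤ y) : 0 < 1 + y * Real.exp c := by positivity
  have hd (c y : ℝ) (hy : 0 ≤ y) : HasDerivAt (fun y => Real.log (1 + y * Real.exp c))
      (Real.exp c / (1 + y * Real.exp c)) y := by
    have h := ((hasDerivAt_id y).mul_const (Real.exp c)).const_add 1
    simpa using h.log (hp c y hy).ne'
  have hD (y : ℝ) (hy : 0 ≤ y) := (((hd β y hy).sub (hd (-β) y hy)).const_mul 2⁻¹)
  have h := (convex_Ici (0 : ℝ)).image_sub_le_mul_sub_of_deriv_le (C := Real.sinh β)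
    (fun y hy => (hD y hy).continuousAt.continuousWithinAt)
    (fun y hy => (hD y (interior_subset hy)).differentiableAt.differentiableWithinAt)
    (fun y hy => by
      have hy0 : 0 ≤ y := interior_subset hy
      rw [(hD y hy0).deriv, div_sub_div _ _ (hp _ _ hy0).ne' (hp _ _ hy0).ne', Real.sinh_eq,
        inv_mul_eq_div]
      gcongr
      refine div_le_of_le_mul₀ (mul_pos (hp _ _ hy0) (hp _ _ hy0)).le
        (sub_nonneg.2 (Real.exp_le_exp.2 (by linarith))) ?_
      have h1 : (1 : ℝ) ≤ (1 + y * Real.exp β) * (1 + y * Real.exp (-β)) :=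
        one_le_mul_of_one_le_of_one_le (by nlinarith [Real.exp_pos β, mul_nonneg hy0 (Real.exp_pos β).le])
          (by nlinarith [mul_nonneg hy0 (Real.exp_pos (-β)).le])
      have h2 : 0 ≤ Real.exp β - Real.exp (-β) :=
        sub_nonneg.2 (Real.exp_le_exp.2 (by linarith))
      nlinarith)
    0 (Set.mem_Ici.2 le_rfl) x hx hx
  simpa [annealedCoupling, ← hxd] using h

theorem sum_vertexPair (F : Fin N → Fin N → ℝ) :
    ∑ e : VertexPair N, (F e.1.1 e.1.2 + F e.1.2 e.1.1) = ∑ i, ∑ j, F i j - ∑ i, F i i := by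
  have h1 (G : Fin N → Fin N → ℝ) : ∑ e : VertexPair N, G e.1.1 e.1.2 =
      ∑ i, ∑ j, if i < j then G i j else 0 := by
    rw [← Fintype.sum_prod_type' (f := fun i j => if i < j then G i j else 0),
      ← Finset.sum_filter]
    exact (Finset.sum_subtype _ (by simp) fun x : Fin N × Fin N => G x.1 x.2).symm
  rw [Finset.sum_add_distrib, h1 F, h1 fun i j => F j i, Finset.sum_comm (f := fun i j : Fin N =>
    if i < j then F j i else 0), ← Finset.sum_add_distrib, ← Finset.sum_sub_distrib]
  refine Finset.sum_congr rfl fun i _ => ?_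
  rw [← Finset.sum_add_distrib, eq_sub_iff_add_eq,
    ← Finset.sum_ite_eq Finset.univ i (fun j => F i j) |>.trans (if_pos (Finset.mem_univ i)),
    ← Finset.sum_add_distrib]
  refine Finset.sum_congr rfl fun j _ => ?_
  rcases lt_trichotomy i j with h | h | h
  · simp [h, h.not_gt, h.ne]
  · simp [h]
  · simp [h, h.not_gt, h.ne']

theorem sum_vertexPair_mul (a : Fin N → ℝ) :
    ∑ e : VertexPair N, a e.1.1 * a e.1.2 = ((∑ i, a i) ^ 2 - ∑ i, a i ^ 2) / 2 := by
  have h := sum_vertexPair fun i j => a i * a j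
  rw [← Finset.sum_mul_sum] at h
  have e : ∀ e : VertexPair N, a e.1.1 * a e.1.2 + a e.1.2 * a e.1.1 =
    2 * (a e.1.1 * a e.1.2) := fun e => by ring
  simp only [e, ← Finset.mul_sum, ← sq] at h
  linarith

theorem sum_vertexPair_incident_le (i : Fin N) (F : Fin N → ℝ) (hF : ∀ v, 0 ≤ F v) :
    ∑ e : VertexPair N, ((if e.1.1 = i then F e.1.2 else 0) + if e.1.2 = i then F e.1.1 else 0) ≤
      ∑ k, F k := by
  rw [sum_vertexPair fun a b => if a = i then F b else 0, Finset.sum_comm]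
  simp only [Finset.sum_ite_eq', Finset.mem_univ, if_true]
  linarith [hF i]

/-- Zero-field susceptibility bound in the annealed model. -/
theorem annealedSusceptibility_zero_le (hw : ∀ i, 0 < w i) {β : ℝ} (hβ : 0 ≤ β)
    (hlt : Real.sinh β * ((∑ i, (w i : ℝ) ^ 2) / ∑ i, (w i : ℝ)) < 1) (hN : 0 < N) :
    annealedSusceptibility w β 0 ≤ 1 + Real.sinh β * (1 / N * ∑ i, (w i : ℝ)) /
      (1 - Real.sinh β * ((∑ i, (w i : ℝ) ^ 2) / ∑ i, (w i : ℝ))) := by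
  have hl : (totalWeight w : ℝ) = ∑ i, (w i : ℝ) := by simp [totalWeight]
  have hpos : 0 < ∑ i, (w i : ℝ) :=
    Finset.sum_pos (fun i _ => NNReal.coe_pos.2 (hw i)) ⟨⟨0, hN⟩, Finset.mem_univ _⟩
  have hs := Real.sinh_nonneg_iff.2 hβ
  have e : Real.sinh β / (∑ i, (w i : ℝ)) * ∑ i, (w i : ℝ) ^ 2 =
      Real.sinh β * ((∑ i, (w i : ℝ) ^ 2) / ∑ i, (w i : ℝ)) := by ring
  have h := isingVar_zero_le (annealedCoupling w β) (fun e => e.1.1) (fun e => e.1.2)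
    (annealedCoupling_nonneg w hβ) (fun e => e.2.ne) (w := fun i => (w i : ℝ))
    (fun i => (w i).coe_nonneg) (κ := Real.sinh β / ∑ i, (w i : ℝ)) (div_nonneg hs hpos.le)
    (fun e => (annealedCoupling_le w hβ e).trans_eq (by rw [edgeOdds, hl]; ring))
    (fun i F hF => sum_vertexPair_incident_le i F hF) (by rw [e]; exact hlt)
  rw [annealedSusceptibility_eq w hw, div_le_iff₀ (Nat.cast_pos.2 hN)]
  refine h.trans_eq ?_
  rw [e, Fintype.card_fin]
  have hN' : (N : ℝ) ≠ 0 := (Nat.cast_pos.2 hN).ne'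
  have hne : 1 - Real.sinh β * ((∑ i, (w i : ℝ) ^ 2) / ∑ i, (w i : ℝ)) ≠ 0 := by linarith
  generalize 1 - Real.sinh β * ((∑ i, (w i : ℝ) ^ 2) / ∑ i, (w i : ℝ)) = D at *
  field_simp

theorem abs_log_one_add_sub_le {y : ℝ} (hy : 0 ≤ y) : |Real.log (1 + y) - y| ≤ y ^ 2 := by
  have h1 := Real.log_le_sub_one_of_pos (show 0 < 1 + y by linarith)
  have h2 := Real.one_sub_inv_le_log_of_pos (show 0 < 1 + y by linarith)
  have h3 : y - y ^ 2 ≤ 1 - (1 + y)⁻¹ := by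
    rw [← sub_nonneg]
    have : 1 - (1 + y)⁻¹ - (y - y ^ 2) = y ^ 3 / (1 + y) := by field_simp; ring
    rw [this]; positivity
  rw [abs_le]
  constructor <;> linarith [sq_nonneg y]

/-- The annealed weight is a Curie--Weiss weight, up to a bounded factor. -/
theorem abs_log_annealedFactor_sub_le (hw : ∀ i, 0 < w i) {β : ℝ} (hβ : 0 ≤ β) (B : ℝ)
    (hN : 0 < N) (σ : SpinConfig N) :
    |Real.log (annealedFactor w β B σ) - (B * totalSpin σ + (Real.cosh β - 1) / 2 * ∑ i, (w i : ℝ)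
      + Real.sinh β / 2 * ((∑ i, (w i : ℝ) * spinVal (σ i)) ^ 2 / ∑ i, (w i : ℝ)))| ≤
      (Real.cosh β - 1 + Real.sinh β) / 2 * ((∑ i, (w i : ℝ) ^ 2) / ∑ i, (w i : ℝ)) +
      (Real.exp (2 * β) + 1) / 2 * ((∑ i, (w i : ℝ) ^ 2) / ∑ i, (w i : ℝ)) ^ 2 := by
  have hl : (totalWeight w : ℝ) = ∑ i, (w i : ℝ) := by simp [totalWeight]
  have hpos : 0 < ∑ i, (w i : ℝ) :=
    Finset.sum_pos (fun i _ => NNReal.coe_pos.2 (hw i)) ⟨⟨0, hN⟩, Finset.mem_univ _⟩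
  set ℓ := ∑ i, (w i : ℝ) with hℓ
  set Q := ∑ i, (w i : ℝ) ^ 2 with hQ
  have hx := edgeOdds_nonneg w
  set s : VertexPair N → ℝ := fun e => spinVal (σ e.1.1) * spinVal (σ e.1.2) with hs
  have hs1 (e : VertexPair N) : s e = 1 ∨ s e = -1 := by
    rcases Int.units_eq_one_or (σ e.1.1) with h | h <;>
      rcases Int.units_eq_one_or (σ e.1.2) with h' | h' <;> simp [hs, h, h']
  -- On `s = ±1` the exponential is affine in `s`; the constant part gives the `cosh` term and the
  -- linear part the `sinh` interaction.
  have hexp (e : VertexPair N) : Real.exp (β * s e) - 1 =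
      (Real.cosh β - 1) + Real.sinh β * s e := by
    rcases hs1 e with h | h <;> rw [h, Real.cosh_eq, Real.sinh_eq] <;> ring_nf
  have hle (e : VertexPair N) : Real.exp (β * s e) ≤ Real.exp β := by
    refine Real.exp_le_exp.2 ?_
    rcases hs1 e with h | h <;> rw [h] <;> linarith
  have hlog : Real.log (annealedFactor w β B σ) = B * totalSpin σ + ∑ e,
      (Real.log (1 + edgeOdds w e * Real.exp (β * s e)) - Real.log (1 + edgeOdds w e)) := by
    have hne (e : VertexPair N) : 1 + edgeOdds w e ≠ 0 := by linarith [hx e]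
    have hne' (e : VertexPair N) : 1 + edgeOdds w e * Real.exp (β * s e) ≠ 0 := by
      have := hx e
      positivity
    rw [annealedFactor_eq_prod w hw, Real.log_mul (Real.exp_pos _).ne'
      (Finset.prod_ne_zero_iff.2 fun e _ => div_ne_zero (hne' e) (hne e)), Real.log_exp,
      Real.log_prod fun e _ => div_ne_zero (hne' e) (hne e)]
    congr 1
    exact Finset.sum_congr rfl fun e _ => Real.log_div (hne' e) (hne e)
  have hsum1 : ∑ e, edgeOdds w e = (ℓ ^ 2 - Q) / 2 / ℓ := by
    simp only [edgeOdds, hl, ← Finset.sum_div]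
    rw [sum_vertexPair_mul fun i => (w i : ℝ)]
  have hsum2 : ∑ e, edgeOdds w e * s e =
      ((∑ i, (w i : ℝ) * spinVal (σ i)) ^ 2 - Q) / 2 / ℓ := by
    have h := sum_vertexPair_mul fun i => (w i : ℝ) * spinVal (σ i)
    simp only [mul_pow, spinVal_sq, mul_one] at h
    rw [← h, Finset.sum_div]
    refine Finset.sum_congr rfl fun e _ => ?_
    simp only [edgeOdds, hs, hl]
    ring
  have hsum3 : ∑ e, edgeOdds w e ^ 2 ≤ (Q / ℓ) ^ 2 / 2 := by
    have h := sum_vertexPair_mul fun i => (w i : ℝ) ^ 2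
    simp only [edgeOdds, hl, div_pow, mul_pow, ← Finset.sum_div]
    rw [h, div_right_comm]
    gcongr
    have : 0 ≤ ∑ i, ((w i : ℝ) ^ 2) ^ 2 := Finset.sum_nonneg fun i _ => sq_nonneg _
    linarith
  -- Linearising each logarithm costs at most the square of its argument; the squared odds sum to at
  -- most half of `(∑ w² / ∑ w)²`, bounded in `N` under weight regularity.
  have hmain : |∑ e, (Real.log (1 + edgeOdds w e * Real.exp (β * s e)) -
      Real.log (1 + edgeOdds w e)) - ∑ e, edgeOdds w e * (Real.exp (β * s e) - 1)| ≤
      (Real.exp (2 * β) + 1) * ((Q / ℓ) ^ 2 / 2) := by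
    rw [← Finset.sum_sub_distrib]
    refine (Finset.abs_sum_le_sum_abs _ _).trans ?_
    refine le_trans (Finset.sum_le_sum fun e _ => ?_) ((Finset.mul_sum _ _ _).symm.trans_le
      (mul_le_mul_of_nonneg_left hsum3 (by positivity)))
    have h1 := abs_log_one_add_sub_le (mul_nonneg (hx e) (Real.exp_pos (β * s e)).le)
    have h2 := abs_log_one_add_sub_le (hx e)
    have h3 : (edgeOdds w e * Real.exp (β * s e)) ^ 2 ≤ Real.exp (2 * β) * edgeOdds w e ^ 2 := by
      rw [mul_pow, mul_comm (edgeOdds w e ^ 2), two_mul, Real.exp_add, ← sq]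
      exact mul_le_mul_of_nonneg_right (pow_le_pow_left₀ (Real.exp_pos _).le (hle e) 2)
        (sq_nonneg _)
    rw [abs_le] at h1 h2 ⊢
    constructor <;> nlinarith
  have hlin : ∑ e, edgeOdds w e * (Real.exp (β * s e) - 1) =
      (Real.cosh β - 1) / 2 * ℓ + Real.sinh β / 2 * ((∑ i, (w i : ℝ) * spinVal (σ i)) ^ 2 / ℓ)
        - (Real.cosh β - 1 + Real.sinh β) / 2 * (Q / ℓ) := by
    simp only [hexp, mul_add, Finset.sum_add_distrib]
    have e1 : ∑ e, edgeOdds w e * (Real.cosh β - 1) = (Real.cosh β - 1) * ∑ e, edgeOdds w e := by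
      rw [← Finset.sum_mul, mul_comm]
    have e2 : ∑ e, edgeOdds w e * (Real.sinh β * s e) = Real.sinh β * ∑ e, edgeOdds w e * s e := by
      rw [Finset.mul_sum]
      exact Finset.sum_congr rfl fun e _ => by ring
    rw [e1, e2, hsum1, hsum2]
    field_simp
    ring
  have hnn : 0 ≤ (Real.cosh β - 1 + Real.sinh β) / 2 * (Q / ℓ) := by
    have := Real.one_le_cosh β
    have := Real.sinh_nonneg_iff.2 hβ
    have : 0 ≤ Q := Finset.sum_nonneg fun i _ => sq_nonneg _
    exact mul_nonneg (by linarith) (by positivity)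
  rw [hlin] at hmain
  rw [hlog]
  rw [abs_le] at hmain ⊢
  constructor <;> linarith [hmain.1, hmain.2]

end Factor

/-! ### Convergence of derivatives -/

/-- The slope of `f` over `[x₀ + h, x₀ + 2h]` tends to `d`, and by the mean value theorem the slope
of `F n` there bounds `F' n (x₀ + h)` from above. Starting the interval at `x₀ + h` uses data only
strictly to the right of `x₀`, as required at zero field where monotonicity is one-sided. -/
theorem exists_eventually_deriv_lt {ι : Type*} {l : Filter ι} {F F' : ι → ℝ → ℝ} {f : ℝ → ℝ}
    {d x₀ r a : ℝ} (hr : 0 < r)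
    (hF : ∀ n, ∀ x ∈ Set.Ioo x₀ (x₀ + r), HasDerivAt (F n) (F' n x) x)
    (hmono : ∀ n, MonotoneOn (F' n) (Set.Ioo x₀ (x₀ + r)))
    (hlim : ∀ x ∈ Set.Ioo x₀ (x₀ + r), Tendsto (fun n => F n x) l (𝓝 (f x)))
    (hf : HasDerivAt f d x₀) (ha : d < a) :
    ∃ h ∈ Set.Ioo 0 r, ∀ᶠ n in l, F' n (x₀ + h) < a := by
  have h1 := (hasDerivAt_iff_tendsto_slope_zero.1 hf).mono_left
    (nhdsWithin_mono 0 fun x (hx : 0 < x) => hx.ne')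
  have h2 : Tendsto (fun h : ℝ => 2 * h) (𝓝[>] 0) (𝓝[>] 0) := by
    refine tendsto_nhdsWithin_iff.2 ⟨?_, ?_⟩
    · have : Tendsto (fun h : ℝ => 2 * h) (𝓝 0) (𝓝 (2 * 0)) :=
        tendsto_id.const_mul 2
      rw [mul_zero] at this
      exact this.mono_left nhdsWithin_le_nhds
    · filter_upwards [self_mem_nhdsWithin] with h (hh : 0 < h)
      exact mul_pos two_pos hh
  have h3 : Tendsto (fun h : ℝ => (f (x₀ + 2 * h) - f (x₀ + h)) / h) (𝓝[>] 0) (𝓝 d) := by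
    have := ((h1.comp h2).const_mul 2).sub h1
    rw [show 2 * d - d = d by ring] at this
    refine this.congr' ?_
    filter_upwards [self_mem_nhdsWithin] with h (hh : 0 < h)
    simp only [Function.comp_apply, smul_eq_mul]
    field_simp
    ring
  have h4 : ∀ᶠ h : ℝ in 𝓝[>] 0, h ∈ Set.Ioo 0 (r / 2) := Ioo_mem_nhdsGT (half_pos hr)
  obtain ⟨h, hlt, hh⟩ := ((h3.eventually (gt_mem_nhds ha)).and h4).exists
  have hm1 : x₀ + h ∈ Set.Ioo x₀ (x₀ + r) := ⟨by linarith [hh.1], by linarith [hh.2]⟩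
  have hm2 : x₀ + 2 * h ∈ Set.Ioo x₀ (x₀ + r) := ⟨by linarith [hh.1], by linarith [hh.2]⟩
  refine ⟨h, ⟨hh.1, by linarith [hh.2]⟩, ?_⟩
  have h5 := (((hlim _ hm2).sub (hlim _ hm1)).div_const h).eventually (gt_mem_nhds hlt)
  filter_upwards [h5] with n hn
  refine lt_of_le_of_lt ?_ hn
  have hsub : Set.Icc (x₀ + h) (x₀ + 2 * h) ⊆ Set.Ioo x₀ (x₀ + r) := fun x hx =>
    ⟨hm1.1.trans_le hx.1, hx.2.trans_lt hm2.2⟩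
  obtain ⟨c, hc, hce⟩ := exists_hasDerivAt_eq_slope (F n) (F' n)
    (show x₀ + h < x₀ + 2 * h by linarith [hh.1])
    (fun x hx => (hF n x (hsub hx)).continuousAt.continuousWithinAt)
    (fun x hx => hF n x (hsub ⟨hx.1.le, hx.2.le⟩))
  rw [show x₀ + 2 * h - (x₀ + h) = h by ring] at hce
  rw [← hce]
  exact hmono n hm1 (hsub ⟨hc.1.le, hc.2.le⟩) hc.1.le

theorem eventually_deriv_lt {ι : Type*} {l : Filter ι} {F F' : ι → ℝ → ℝ} {f : ℝ → ℝ}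
    {d x₀ a : ℝ} {D : Set ℝ} (hD : D ∈ 𝓝 x₀) (hF : ∀ n, ∀ x ∈ D, HasDerivAt (F n) (F' n x) x)
    (hmono : ∀ n, MonotoneOn (F' n) D)
    (hlim : ∀ x ∈ D, Tendsto (fun n => F n x) l (𝓝 (f x)))
    (hf : HasDerivAt f d x₀) (ha : d < a) {xs : ι → ℝ} (hxs : Tendsto xs l (𝓝 x₀)) :
    ∀ᶠ n in l, F' n (xs n) < a := by
  obtain ⟨r, hr, hrD⟩ := Metric.mem_nhds_iff.1 hD
  rw [Real.ball_eq_Ioo] at hrD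
  have hsub : Set.Ioo x₀ (x₀ + r) ⊆ D := fun x hx => hrD ⟨by linarith [hx.1], hx.2⟩
  obtain ⟨h, hh, hev⟩ := exists_eventually_deriv_lt hr (fun n x hx => hF n x (hsub hx))
    (fun n => (hmono n).mono hsub) (fun x hx => hlim x (hsub hx)) hf ha
  filter_upwards [hev, hxs.eventually (gt_mem_nhds (show x₀ < x₀ + h by linarith [hh.1])),
    hxs.eventually hD] with n hn hn' hn''
  exact (hmono n hn'' (hsub ⟨by linarith [hh.1], by linarith [hh.2]⟩) hn'.le).trans_lt hn

/-- If functions with monotone derivatives converge pointwise, their derivatives converge along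
convergent sequences of points, wherever the limit is differentiable. -/
theorem tendsto_deriv_of_monotoneOn {ι : Type*} {l : Filter ι} {F F' : ι → ℝ → ℝ} {f : ℝ → ℝ}
    {d x₀ : ℝ} {D : Set ℝ} (hD : D ∈ 𝓝 x₀) (hF : ∀ n, ∀ x ∈ D, HasDerivAt (F n) (F' n x) x)
    (hmono : ∀ n, MonotoneOn (F' n) D)
    (hlim : ∀ x ∈ D, Tendsto (fun n => F n x) l (𝓝 (f x)))
    (hf : HasDerivAt f d x₀) {xs : ι → ℝ} (hxs : Tendsto xs l (𝓝 x₀)) :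
    Tendsto (fun n => F' n (xs n)) l (𝓝 d) := by
  refine tendsto_order.2 ⟨fun a ha => ?_, fun a ha => eventually_deriv_lt hD hF hmono hlim hf ha hxs⟩
  -- The lower bound is the upper bound for the reflected functions `x ↦ F n (-x)`, whose
  -- derivatives are again monotone.
  have hneg (n : ι) (x : ℝ) (hx : -x ∈ D) :
      HasDerivAt (fun x => F n (-x)) (-(F' n (-x))) x := by
    have h := (hF n (-x) hx).comp x (hasDerivAt_neg x)
    rwa [mul_neg_one] at h
  have hf' : HasDerivAt (fun x => f (-x)) (-d) (-x₀) := by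
    have h : HasDerivAt f d (- -x₀) := by rwa [neg_neg]
    have h' := h.comp (-x₀) (hasDerivAt_neg (-x₀))
    rwa [mul_neg_one] at h'
  have h := eventually_deriv_lt (l := l) (F := fun n x => F n (-x)) (F' := fun n x => -(F' n (-x)))
    (f := fun x => f (-x)) (d := -d) (x₀ := -x₀) (a := -a) (D := {x | -x ∈ D})
    (by
      have : Tendsto (fun x : ℝ => -x) (𝓝 (-x₀)) (𝓝 x₀) := by
        simpa using (continuous_neg (G := ℝ)).tendsto (-x₀)
      exact this hD) hneg
    (fun n x hx y hy hxy => neg_le_neg (hmono n hy hx (neg_le_neg hxy)))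
    (fun x hx => hlim _ hx) hf' (neg_lt_neg ha) (xs := fun n => -xs n) hxs.neg
  filter_upwards [h] with n hn
  simpa using hn

/-! ### Convergence of moment generating functions -/

/-- Fatou's lemma gives integrability and dominated convergence the value. This serves for a weak
limit point, against which only bounded functions can be tested directly. -/
theorem integrable_and_integral_eq_of_truncation {μ : Measure ℝ} [IsProbabilityMeasure μ]
    {g : ℝ → ℝ} (hg : Continuous g) (hg0 : ∀ x, 0 ≤ g x) {m C : ℝ}
    (h : ∀ K : ℕ, ∫ x, min (g x) (K + 1) ∂μ ∈ Set.Icc (m - C / (K + 1)) m) :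
    Integrable g μ ∧ ∫ x, g x ∂μ = m := by
  have hpos (K : ℕ) (x : ℝ) : 0 ≤ min (g x) ((K : ℝ) + 1) := le_min (hg0 x) (by positivity)
  have hlim (x : ℝ) : Tendsto (fun K : ℕ => min (g x) ((K : ℝ) + 1)) atTop (𝓝 (g x)) := by
    obtain ⟨n, hn⟩ := exists_nat_ge (g x)
    refine tendsto_const_nhds.congr' ?_
    filter_upwards [eventually_ge_atTop n] with K hK
    rw [min_eq_left]
    have : (n : ℝ) ≤ K := by exact_mod_cast hK
    linarith
  have hbdd (K : ℕ) : Integrable (fun x => min (g x) ((K : ℝ) + 1)) μ := by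
    refine Integrable.of_bound (by fun_prop) ((K : ℝ) + 1) (ae_of_all _ fun x => ?_)
    rw [Real.norm_of_nonneg (hpos K x)]
    exact min_le_right _ _
  have hint : Integrable g μ := by
    refine ⟨by fun_prop, ?_⟩
    rw [hasFiniteIntegral_iff_ofReal (ae_of_all _ hg0)]
    have hF := lintegral_liminf_le (μ := μ) (u := atTop)
      (f := fun (K : ℕ) x => ENNReal.ofReal (min (g x) ((K : ℝ) + 1))) (fun K => by fun_prop)
    refine lt_of_le_of_lt ((lintegral_congr fun x => ?_).trans_le hF) (lt_of_le_of_lt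
      (b := ENNReal.ofReal m) ?_ ENNReal.ofReal_lt_top)
    · exact (((ENNReal.continuous_ofReal.tendsto _).comp (hlim x)).liminf_eq).symm
    · refine (liminf_le_liminf (v := fun _ => ENNReal.ofReal m) (Eventually.of_forall fun K => ?_)).trans
        (by simp)
      rw [← ofReal_integral_eq_lintegral_ofReal (hbdd K) (ae_of_all _ (hpos K))]
      exact ENNReal.ofReal_le_ofReal (h K).2
  refine ⟨hint, ?_⟩
  have h1 : Tendsto (fun K : ℕ => ∫ x, min (g x) ((K : ℝ) + 1) ∂μ) atTop (𝓝 (∫ x, g x ∂μ)) := by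
    refine tendsto_integral_of_dominated_convergence g (fun K => by fun_prop) hint
      (fun K => ae_of_all _ fun x => ?_) (ae_of_all _ hlim)
    rw [Real.norm_of_nonneg (hpos K x)]
    exact min_le_left _ _
  refine tendsto_nhds_unique h1 (tendsto_of_tendsto_of_tendsto_of_le_of_le ?_ tendsto_const_nhds
    (fun K => (h K).1) fun K => (h K).2)
  have := (tendsto_one_div_add_atTop_nhds_zero_nat (𝕜 := ℝ)).const_mul C
  simpa [div_eq_mul_inv] using this.const_sub m

/-- Chernoff bounds with exponents `1` and `-1` control the two tails. -/
theorem isTightMeasureSet_of_mgf_le {S : Set (Measure ℝ)} (hS : ∀ μ ∈ S, IsProbabilityMeasure μ)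
    (hint : ∀ μ ∈ S, ∀ t : ℝ, Integrable (fun x => Real.exp (t * x)) μ) {C : ℝ}
    (h1 : ∀ μ ∈ S, mgf id μ 1 ≤ C) (h2 : ∀ μ ∈ S, mgf id μ (-1) ≤ C) : IsTightMeasureSet S := by
  rw [isTightMeasureSet_iff_exists_isCompact_measure_compl_le]
  intro ε hε
  have hlim : Tendsto (fun r : ℝ => ENNReal.ofReal (2 * C * Real.exp (-r))) atTop (𝓝 0) := by
    have := (Real.tendsto_exp_neg_atTop_nhds_zero).const_mul (2 * C)
    rw [mul_zero] at this
    simpa using ENNReal.tendsto_ofReal this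
  obtain ⟨r, hr⟩ := (hlim.eventually (ge_mem_nhds hε)).exists
  refine ⟨Set.Icc (-r) r, isCompact_Icc, fun μ hμ => le_trans ?_ hr⟩
  have := hS μ hμ
  have a1 := measure_ge_le_exp_mul_mgf (μ := μ) (X := id) r zero_le_one (hint μ hμ 1)
  have a2 := measure_le_le_exp_mul_mgf (μ := μ) (X := id) (-r) (t := -1) (by norm_num) (hint μ hμ (-1))
  have hsub : (Set.Icc (-r) r)ᶜ ⊆ {x : ℝ | r ≤ id x} ∪ {x : ℝ | id x ≤ -r} := by
    intro x hx
    simp only [Set.mem_compl_iff, Set.mem_Icc, not_and_or, not_le] at hx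
    rcases hx with h | h
    · exact Or.inr h.le
    · exact Or.inl h.le
  rw [← ofReal_measureReal]
  refine ENNReal.ofReal_le_ofReal ((measureReal_mono hsub).trans ((measureReal_union_le _ _).trans ?_))
  have e := Real.exp_pos (-r)
  have b1 := mul_le_mul_of_nonneg_left (h1 μ hμ) e.le
  have b2 := mul_le_mul_of_nonneg_left (h2 μ hμ) e.le
  norm_num at a1 a2
  simp only [id_eq]
  linarith

/-- Convergence of moment generating functions to that of a probability measure implies weak convergence. -/
theorem tendsto_of_tendsto_mgf {μ : ℕ → ProbabilityMeasure ℝ} {ν : ProbabilityMeasure ℝ}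
    (hμ : ∀ n (t : ℝ), Integrable (fun x => Real.exp (t * x)) (μ n : Measure ℝ))
    (h : ∀ t, Tendsto (fun n => mgf id (μ n : Measure ℝ) t) atTop (𝓝 (mgf id (ν : Measure ℝ) t))) :
    Tendsto μ atTop (𝓝 ν) := by
  obtain ⟨C₁, hC₁⟩ := (h 1).bddAbove_range
  obtain ⟨C₂, hC₂⟩ := (h (-1)).bddAbove_range
  have htight : IsTightMeasureSet {((ρ : ProbabilityMeasure ℝ) : Measure ℝ) | ρ ∈ {μ n | n}} := by
    refine isTightMeasureSet_of_mgf_le (C := max C₁ C₂) ?_ ?_ ?_ ?_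
    · rintro _ ⟨ρ, -, rfl⟩
      infer_instance
    · rintro _ ⟨_, ⟨n, rfl⟩, rfl⟩
      exact hμ n
    · rintro _ ⟨_, ⟨n, rfl⟩, rfl⟩
      exact (hC₁ ⟨n, rfl⟩).trans (le_max_left _ _)
    · rintro _ ⟨_, ⟨n, rfl⟩, rfl⟩
      exact (hC₂ ⟨n, rfl⟩).trans (le_max_right _ _)
  -- Tightness gives a limit point along every ultrafilter; each one is shown to have the moment
  -- generating function of `ν`.
  refine (tendsto_iff_ultrafilter _ _ _).2 fun U hU => ?_
  obtain ⟨μ', -, hμ'⟩ := (isCompact_closure_of_isTightMeasureSet htight).ultrafilter_le_nhds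
    (U.map μ) (.trans (by simp) (monotone_principal subset_closure))
  have hμ'T : Tendsto μ U (𝓝 μ') := hμ'
  have key (t : ℝ) : Integrable (fun x => Real.exp (t * x)) (μ' : Measure ℝ) ∧
      ∫ x, Real.exp (t * x) ∂(μ' : Measure ℝ) = mgf id (ν : Measure ℝ) t := by
    refine integrable_and_integral_eq_of_truncation (C := mgf id (ν : Measure ℝ) (2 * t))
      (by fun_prop) (fun x => (Real.exp_pos _).le) fun K => ?_
    let g : BoundedContinuousFunction ℝ ℝ := BoundedContinuousFunction.ofNormedAddCommGroup
      (fun x => min (Real.exp (t * x)) ((K : ℝ) + 1)) (by fun_prop) ((K : ℝ) + 1) fun x => by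
        rw [Real.norm_of_nonneg (le_min (Real.exp_pos _).le (by positivity))]
        exact min_le_right _ _
    have hg := (ProbabilityMeasure.tendsto_iff_forall_integral_tendsto.1 hμ'T) g
    have hub (n : ℕ) : ∫ x, g x ∂(μ n : Measure ℝ) ≤ mgf id (μ n : Measure ℝ) t :=
      integral_mono (g.integrable _) (hμ n t) fun x => min_le_left _ _
    -- With `y = exp (t x)`, the inequality `y - y² / (K + 1) ≤ min y (K + 1)` bounds the loss from
    -- truncation by the moment generating function at `2t`.
    have hlb (n : ℕ) : mgf id (μ n : Measure ℝ) t - mgf id (μ n : Measure ℝ) (2 * t) / (K + 1) ≤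
        ∫ x, g x ∂(μ n : Measure ℝ) := by
      have e : mgf id (μ n : Measure ℝ) t - mgf id (μ n : Measure ℝ) (2 * t) / (K + 1) =
          ∫ x, (Real.exp (t * x) - Real.exp (2 * t * x) / (K + 1)) ∂(μ n : Measure ℝ) := by
        rw [integral_sub (hμ n t) ((hμ n (2 * t)).div_const _), integral_div]
        rfl
      rw [e]
      refine integral_mono ((hμ n t).sub ((hμ n (2 * t)).div_const _)) (g.integrable _) fun x => ?_
      change Real.exp (t * x) - Real.exp (2 * t * x) / (K + 1) ≤
        min (Real.exp (t * x)) ((K : ℝ) + 1)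
      have hK : (0 : ℝ) < (K : ℝ) + 1 := by positivity
      have e2 : Real.exp (2 * t * x) = Real.exp (t * x) ^ 2 := by
        rw [← Real.exp_nat_mul]; congr 1; push_cast; ring
      rw [e2]
      refine le_min (sub_le_self _ (by positivity)) ?_
      rw [sub_le_iff_le_add, ← sub_le_iff_le_add', le_div_iff₀ hK]
      nlinarith [sq_nonneg (Real.exp (t * x) - (K + 1))]
    exact ⟨le_of_tendsto_of_tendsto' (((h t).mono_left hU).sub
        (((h (2 * t)).mono_left hU).div_const _)) hg hlb,
      le_of_tendsto_of_tendsto' hg ((h t).mono_left hU) hub⟩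
  -- A moment generating function finite on the whole line extends to the complex plane, and so
  -- determines the measure.
  have heq : (μ' : Measure ℝ) = ν := by
    refine Measure.ext_of_complexMGF_id_eq (funext fun z => ?_)
    have hmgf : mgf id (μ' : Measure ℝ) = mgf id (ν : Measure ℝ) := funext fun t => (key t).2
    refine eqOn_complexMGF_of_mgf hmgf ?_
    have : integrableExpSet id (μ' : Measure ℝ) = Set.univ :=
      Set.eq_univ_of_forall fun t => (key t).1
    simp [this]
  have : μ' = ν := Subtype.ext heq
  rw [← this]
  exact hμ'T

/-! ### Averages over the weights -/

theorem integral_uniformOn_univ {N : ℕ} (f : Fin N → ℝ) :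
    ∫ i, f i ∂(uniformOn (Set.univ : Set (Fin N))) = 1 / (N : ℝ) * ∑ i, f i := by
  have h (i : Fin N) : (uniformOn (Set.univ : Set (Fin N))).real {i} = 1 / (N : ℝ) := by
    rw [measureReal_def, uniformOn_univ]
    simp
  rcases Nat.eq_zero_or_pos N with rfl | hN
  · have : (uniformOn (Set.univ : Set (Fin 0))) = 0 := Subsingleton.elim _ _
    simp [this]
  · have : Nonempty (Fin N) := ⟨⟨0, hN⟩⟩
    have : IsProbabilityMeasure (uniformOn (Set.univ : Set (Fin N))) :=
      isProbabilityMeasure_uniformOn Set.finite_univ Set.univ_nonempty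
    rw [integral_fintype Integrable.of_finite, Finset.mul_sum]
    simp only [h, smul_eq_mul]

section Averages

variable {Ω : Type*} [MeasurableSpace Ω] {P : Measure Ω} [IsProbabilityMeasure P]
  {W : Ω → ℝ} {w : (N : ℕ+) → Fin N → ℝ≥0}

theorem WeightRegularity.tendsto_average_bounded (hreg : WeightRegularity w P W)
    (g : BoundedContinuousFunction ℝ ℝ) :
    Tendsto (fun N : ℕ+ => 1 / ((N : ℕ) : ℝ) * ∑ i, g (w N i)) atTop (𝓝 (∫ ω, g (W ω) ∂P)) := by
  have h := (ProbabilityMeasure.tendsto_iff_forall_integral_tendsto.1 hreg.tendsto_law.tendsto) g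
  simp only [ProbabilityMeasure.coe_mk] at h
  rw [integral_map hreg.tendsto_law.aemeasurable_limit g.continuous.aestronglyMeasurable] at h
  refine h.congr fun N => ?_
  rw [integral_map (hreg.tendsto_law.forall_aemeasurable N) g.continuous.aestronglyMeasurable,
    integral_uniformOn_univ]
  rfl

/-- The test function below is bounded, continuous, zero on `[0, ∞)` and positive on the negative
half-line; its averages over the weights vanish. -/
theorem WeightRegularity.ae_nonneg (hreg : WeightRegularity w P W) : ∀ᵐ ω ∂P, 0 ≤ W ω := by
  let g : BoundedContinuousFunction ℝ ℝ := BoundedContinuousFunction.ofNormedAddCommGroup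
    (fun x => max 0 (min (-x) 1)) (by fun_prop) 1 fun x => by
      rw [Real.norm_of_nonneg (le_max_left _ _)]
      exact max_le zero_le_one (min_le_right _ _)
  have h := hreg.tendsto_average_bounded g
  have h0 (N : ℕ+) (i : Fin N) : g (w N i) = 0 :=
    max_eq_left ((min_le_left _ _).trans (neg_nonpos.2 (w N i).coe_nonneg))
  simp only [h0, Finset.sum_const_zero, mul_zero] at h
  have h1 : ∫ ω, g (W ω) ∂P = 0 := tendsto_nhds_unique h tendsto_const_nhds |>.symm ▸ rfl
  have hm : AEMeasurable W P := hreg.tendsto_law.aemeasurable_limit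
  have hint : Integrable (fun ω => g (W ω)) P :=
    Integrable.of_bound (g.continuous.measurable.comp_aemeasurable hm).aestronglyMeasurable ‖g‖
      (ae_of_all _ fun ω => g.norm_coe_le_norm _)
  have hg0 : 0 ≤ fun ω => g (W ω) := fun ω => le_max_left _ _
  rw [integral_eq_zero_iff_of_nonneg hg0 hint] at h1
  filter_upwards [h1] with ω hω
  by_contra hlt
  rw [not_le] at hlt
  have : 0 < g (W ω) := lt_max_of_lt_right (lt_min (neg_pos.2 hlt) one_pos)
  exact this.ne' hω

/-- Averages of Lipschitz functions of the weights converge. -/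
theorem WeightRegularity.tendsto_average (hreg : WeightRegularity w P W) {f : ℝ → ℝ} {C : ℝ≥0}
    (hf : LipschitzWith C f) :
    Tendsto (fun N : ℕ+ => 1 / ((N : ℕ) : ℝ) * ∑ i, f (w N i)) atTop (𝓝 (∫ ω, f (W ω) ∂P)) := by
  have hm : AEMeasurable W P := hreg.tendsto_law.aemeasurable_limit
  -- Clamping to `[0, k]`. For a Lipschitz function the truncation error is at most `C (x - T k x)`,
  -- whose averages converge by the assumed convergence of means: that assumption plays the role of
  -- uniform integrability.
  let T : ℕ → ℝ → ℝ := fun k x => max 0 (min x k)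
  have hT0 (k : ℕ) (x : ℝ) : 0 ≤ T k x := le_max_left _ _
  have hTk (k : ℕ) (x : ℝ) : T k x ≤ k := max_le (by positivity) (min_le_right _ _)
  have hTx (k : ℕ) {x : ℝ} (hx : 0 ≤ x) : T k x ≤ x := max_le hx (min_le_left _ _)
  have hTc (k : ℕ) : Continuous (T k) := by fun_prop
  have hLip (x y : ℝ) : |f x - f y| ≤ C * |x - y| := by
    simpa [Real.dist_eq] using hf.dist_le_mul x y
  have hTint (k : ℕ) : Integrable (fun ω => T k (W ω)) P :=
    Integrable.of_bound ((hTc k).measurable.comp_aemeasurable hm).aestronglyMeasurable (k : ℝ)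
      (ae_of_all _ fun ω => by rw [Real.norm_of_nonneg (hT0 _ _)]; exact hTk _ _)
  have hfint : Integrable (fun ω => f (W ω)) P := by
    refine Integrable.mono' ((hreg.integrable.norm.const_mul (C : ℝ)).add
      (integrable_const |f 0|)) (hf.continuous.measurable.comp_aemeasurable
        hm).aestronglyMeasurable (ae_of_all _ fun ω => ?_)
    have := hLip (W ω) 0
    rw [sub_zero] at this
    simp only [Pi.add_apply, Real.norm_eq_abs]
    calc |f (W ω)| = |(f (W ω) - f 0) + f 0| := by rw [sub_add_cancel]
      _ ≤ |f (W ω) - f 0| + |f 0| := abs_add_le _ _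
      _ ≤ _ := by gcongr
  let gT (k : ℕ) : BoundedContinuousFunction ℝ ℝ := BoundedContinuousFunction.ofNormedAddCommGroup
    (T k) (hTc k) k fun x => by rw [Real.norm_of_nonneg (hT0 _ _)]; exact hTk _ _
  let gf (k : ℕ) : BoundedContinuousFunction ℝ ℝ := BoundedContinuousFunction.ofNormedAddCommGroup
    (fun x => f (T k x)) (hf.continuous.comp (hTc k)) (C * k + |f 0|) fun x => by
      have := hLip (T k x) 0
      rw [sub_zero, abs_of_nonneg (hT0 _ _)] at this
      calc |f (T k x)| = |(f (T k x) - f 0) + f 0| := by rw [sub_add_cancel]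
        _ ≤ |f (T k x) - f 0| + |f 0| := abs_add_le _ _
        _ ≤ C * T k x + |f 0| := by gcongr
        _ ≤ _ := by gcongr; exact hTk _ _
  have hfTint (k : ℕ) : Integrable (fun ω => f (T k (W ω))) P :=
    Integrable.of_bound (((gf k).continuous.measurable.comp_aemeasurable hm).aestronglyMeasurable)
      ‖gf k‖ (ae_of_all _ fun ω => (gf k).norm_coe_le_norm _)
  have hδ : Tendsto (fun k => ∫ ω, W ω ∂P - ∫ ω, T k (W ω) ∂P) atTop (𝓝 0) := by
    rw [← sub_self (∫ ω, W ω ∂P)]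
    refine tendsto_const_nhds.sub (tendsto_integral_of_dominated_convergence (fun ω => |W ω|)
      (fun k => (hTint k).aestronglyMeasurable) hreg.integrable.abs (fun k => ?_) ?_)
    · filter_upwards [hreg.ae_nonneg] with ω hω
      rw [Real.norm_of_nonneg (hT0 _ _), abs_of_nonneg hω]
      exact hTx k hω
    · filter_upwards [hreg.ae_nonneg] with ω hω
      refine tendsto_const_nhds.congr' ?_
      obtain ⟨n, hn⟩ := exists_nat_ge (W ω)
      filter_upwards [eventually_ge_atTop n] with k hk
      have : (n : ℝ) ≤ k := by exact_mod_cast hk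
      simp only [T]
      rw [min_eq_left (hn.trans this), max_eq_right hω]
  rw [Metric.tendsto_atTop']
  intro ε hε
  -- The denominator has `C + 1` rather than `C` so that `C = 0` is allowed. The final budget is `ε
  -- / 2` for the empirical truncation, `ε / 4` for the limiting truncation and `ε / 4` for the
  -- convergence of the truncated averages.
  obtain ⟨k, hk⟩ := (hδ.eventually (gt_mem_nhds
    (show 0 < ε / (4 * (C + 1)) by positivity))).exists
  set δ := ∫ ω, W ω ∂P - ∫ ω, T k (W ω) ∂P with hδdef
  have hδC : (C : ℝ) * δ ≤ ε / 4 := by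
    have hC : (C : ℝ) ≤ C + 1 := by linarith
    have : (C : ℝ) * δ ≤ (C + 1) * (ε / (4 * (C + 1))) := by
      have hδ0 : 0 ≤ δ := by
        rw [hδdef, sub_nonneg]
        refine integral_mono_ae (hTint k) hreg.integrable ?_
        filter_upwards [hreg.ae_nonneg] with ω hω using hTx k hω
      exact mul_le_mul hC hk.le hδ0 (by positivity)
    refine this.trans_eq ?_
    field_simp
  have hlim1 := (hreg.tendsto_mean.sub (hreg.tendsto_average_bounded (gT k))).const_mul (C : ℝ)
  have hlim2 := hreg.tendsto_average_bounded (gf k)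
  have hev1 := hlim1.eventually (gt_mem_nhds (show (C : ℝ) * (∫ ω, W ω ∂P - ∫ ω, gT k (W ω) ∂P) <
    ε / 2 by change (C : ℝ) * δ < ε / 2; linarith))
  have hev2 := (Metric.tendsto_nhds.1 hlim2) (ε / 4) (by positivity)
  obtain ⟨M, hM⟩ := eventually_atTop.1 (hev1.and hev2)
  refine ⟨M, fun N hN => ?_⟩
  obtain ⟨h1, h2⟩ := hM N hN.le
  have h3 : |1 / ((N : ℕ) : ℝ) * ∑ i, f (w N i) - 1 / ((N : ℕ) : ℝ) * ∑ i, gf k (w N i)| ≤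
      C * (1 / ((N : ℕ) : ℝ) * ∑ i, (w N i : ℝ) - 1 / ((N : ℕ) : ℝ) * ∑ i, gT k (w N i)) := by
    rw [← mul_sub, ← mul_sub, ← Finset.sum_sub_distrib, ← Finset.sum_sub_distrib, abs_mul,
      abs_of_nonneg (by positivity : (0 : ℝ) ≤ 1 / ((N : ℕ) : ℝ)), mul_left_comm]
    refine mul_le_mul_of_nonneg_left ?_ (by positivity)
    rw [Finset.mul_sum]
    refine (Finset.abs_sum_le_sum_abs _ _).trans (Finset.sum_le_sum fun i _ => ?_)
    refine (hLip _ _).trans_eq ?_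
    rw [abs_of_nonneg (sub_nonneg.2 (hTx k (w N i).coe_nonneg))]
    rfl
  have h4 : |∫ ω, f (W ω) ∂P - ∫ ω, gf k (W ω) ∂P| ≤ C * δ := by
    change |∫ ω, f (W ω) ∂P - ∫ ω, f (T k (W ω)) ∂P| ≤ C * δ
    rw [← integral_sub hfint (hfTint k), hδdef, ← integral_sub hreg.integrable (hTint k),
      ← integral_const_mul]
    refine (abs_integral_le_integral_abs).trans (integral_mono_ae (hfint.sub (hfTint k)).abs
      ((hreg.integrable.sub (hTint k)).const_mul _) ?_)
    filter_upwards [hreg.ae_nonneg] with ω hω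
    refine (hLip _ _).trans_eq ?_
    rw [abs_of_nonneg (sub_nonneg.2 (hTx k hω))]
  rw [Real.dist_eq] at h2 ⊢
  rw [abs_le] at h3 h4
  rw [abs_lt] at h2 ⊢
  constructor <;> linarith [h3.1, h3.2, h4.1, h4.2, h2.1, h2.2]

theorem WeightRegularity.sq_pos (hreg : WeightRegularity w P W) : 0 < ∫ ω, W ω ^ 2 ∂P := by
  refine (integral_nonneg fun ω => sq_nonneg _).lt_of_ne' fun h => ?_
  rw [integral_eq_zero_iff_of_nonneg (fun ω => sq_nonneg _) hreg.integrable_sq] at h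
  have : ∫ ω, W ω ∂P = 0 := integral_eq_zero_of_ae (by
    filter_upwards [h] with ω hω
    exact pow_eq_zero_iff two_ne_zero |>.1 hω)
  exact hreg.mean_pos.ne' this

theorem WeightRegularity.tendsto_ratio (hreg : WeightRegularity w P W) :
    Tendsto (fun N : ℕ+ => (∑ i, (w N i : ℝ) ^ 2) / ∑ i, (w N i : ℝ)) atTop
      (𝓝 ((∫ ω, W ω ^ 2 ∂P) / ∫ ω, W ω ∂P)) := by
  refine (hreg.tendsto_sq.div hreg.tendsto_mean hreg.mean_pos.ne').congr fun N => ?_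
  exact mul_div_mul_left _ _ (one_div_ne_zero (Nat.cast_ne_zero.2 N.ne_zero))

end Averages

/-! ### The variational problem for the limiting pressure -/

theorem hasDerivAt_tanh (x : ℝ) : HasDerivAt Real.tanh (1 - Real.tanh x ^ 2) x := by
  have h := (Real.hasDerivAt_sinh x).div (Real.hasDerivAt_cosh x) (Real.cosh_pos x).ne'
  have e : Real.tanh = fun y => Real.sinh y / Real.cosh y :=
    funext Real.tanh_eq_sinh_div_cosh
  rw [e]
  convert! h using 1
  have := (Real.cosh_pos x).ne'
  field_simp

theorem hasDerivAt_log_two_cosh (x : ℝ) :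
    HasDerivAt (fun y => Real.log (2 * Real.cosh y)) (Real.tanh x) x := by
  have h := ((Real.hasDerivAt_cosh x).const_mul 2).log (by positivity)
  rwa [mul_div_mul_left _ _ two_ne_zero, ← Real.tanh_eq_sinh_div_cosh] at h

theorem continuous_tanh : Continuous Real.tanh :=
  continuous_iff_continuousAt.2 fun x => (hasDerivAt_tanh x).continuousAt

theorem abs_one_sub_tanh_sq_le (x : ℝ) : |1 - Real.tanh x ^ 2| ≤ 1 := by
  have h := Real.tanh_sq_lt_one x
  rw [abs_le]
  constructor <;> nlinarith [sq_nonneg (Real.tanh x)]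

theorem tanh_strictMono : StrictMono Real.tanh := by
  refine strictMono_of_deriv_pos fun x => ?_
  rw [(hasDerivAt_tanh x).deriv]
  linarith [Real.tanh_sq_lt_one x]

theorem tanh_pos {x : ℝ} (hx : 0 < x) : 0 < Real.tanh x := by
  simpa using tanh_strictMono hx

/-! ### Differentiation under the expectation. -/

section Integral

variable {Ω : Type*} [MeasurableSpace Ω] {P : Measure Ω} {W : Ω → ℝ}

theorem integrable_mul_comp {V : Ω → ℝ} (hWm : AEMeasurable W P) (hV : Integrable V P)
    (hVW : Integrable (fun ω => V ω * W ω) P) {f f' : ℝ → ℝ}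
    (hf : ∀ y, HasDerivAt f (f' y) y) (hf'1 : ∀ y, |f' y| ≤ 1) (θ : ℝ) (x : ℝ × ℝ) :
    Integrable (fun ω => V ω * f (θ * W ω * x.2 + x.1)) P := by
  have hfc : Continuous f := continuous_iff_continuousAt.2 fun y => (hf y).continuousAt
  have hlip (y : ℝ) : |f y| ≤ |f 0| + |y| := by
    have h := Convex.norm_image_sub_le_of_norm_hasDerivWithin_le (f := f) (f' := f') (C := 1)
      (fun y _ => (hf y).hasDerivWithinAt) (fun y _ => hf'1 y) convex_univ (Set.mem_univ 0)
      (Set.mem_univ y)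
    rw [one_mul, sub_zero, Real.norm_eq_abs, Real.norm_eq_abs] at h
    have := abs_sub_abs_le_abs_sub (f y) (f 0)
    linarith
  refine Integrable.mono' (((hV.norm.mul_const (|f 0| + |x.1|))).add
    (hVW.norm.mul_const (|θ| * |x.2|))) (hV.aestronglyMeasurable.mul
    (hfc.measurable.comp_aemeasurable (by fun_prop)).aestronglyMeasurable)
    (ae_of_all _ fun ω => ?_)
  simp only [Real.norm_eq_abs, abs_mul, Pi.add_apply]
  have h1 := hlip (θ * W ω * x.2 + x.1)
  have h2 := abs_add_le (θ * W ω * x.2) x.1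
  rw [abs_mul, abs_mul] at h2
  calc |V ω| * |f (θ * W ω * x.2 + x.1)| ≤ |V ω| * (|f 0| + (|θ| * |W ω| * |x.2| + |x.1|)) := by
        gcongr; linarith
    _ = _ := by ring

/-- Differentiation under the integral sign for functions of `θ W u + b`, at `x = (b, u)`. -/
theorem hasStrictFDerivAt_integral {V : Ω → ℝ} (hWm : AEMeasurable W P) (hV : Integrable V P)
    (hVW : Integrable (fun ω => V ω * W ω) P) {f f' : ℝ → ℝ}
    (hf : ∀ y, HasDerivAt f (f' y) y) (hf'c : Continuous f') (hf'1 : ∀ y, |f' y| ≤ 1)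
    (θ : ℝ) (x : ℝ × ℝ) :
    HasStrictFDerivAt (fun x : ℝ × ℝ => ∫ ω, V ω * f (θ * W ω * x.2 + x.1) ∂P)
      ((∫ ω, V ω * f' (θ * W ω * x.2 + x.1) ∂P) • ContinuousLinearMap.fst ℝ ℝ ℝ +
        (θ * ∫ ω, V ω * W ω * f' (θ * W ω * x.2 + x.1) ∂P) • ContinuousLinearMap.snd ℝ ℝ ℝ) x := by
  have hcont (U : Ω → ℝ) (hU : Integrable U P) :
      Continuous fun x : ℝ × ℝ => ∫ ω, U ω * f' (θ * W ω * x.2 + x.1) ∂P := by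
    refine continuous_of_dominated (bound := fun ω => |U ω|) (fun x =>
      hU.aestronglyMeasurable.mul
        (hf'c.measurable.comp_aemeasurable (by fun_prop)).aestronglyMeasurable)
      (fun x => ae_of_all _ fun ω => ?_) hU.abs (ae_of_all _ fun ω => by fun_prop)
    rw [Real.norm_eq_abs, abs_mul]
    exact mul_le_of_le_one_right (abs_nonneg _) (hf'1 _)
  have hint (U : Ω → ℝ) (hU : Integrable U P) (x : ℝ × ℝ) :
      Integrable (fun ω => U ω * f' (θ * W ω * x.2 + x.1)) P := by
    refine Integrable.mono' hU.abs (hU.aestronglyMeasurable.mul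
      (hf'c.measurable.comp_aemeasurable (by fun_prop)).aestronglyMeasurable)
      (ae_of_all _ fun ω => ?_)
    rw [Real.norm_eq_abs, abs_mul]
    exact mul_le_of_le_one_right (abs_nonneg _) (hf'1 _)
  have hder (x : ℝ × ℝ) : HasFDerivAt (fun x : ℝ × ℝ => ∫ ω, V ω * f (θ * W ω * x.2 + x.1) ∂P)
      ((∫ ω, V ω * f' (θ * W ω * x.2 + x.1) ∂P) • ContinuousLinearMap.fst ℝ ℝ ℝ +
        (θ * ∫ ω, V ω * W ω * f' (θ * W ω * x.2 + x.1) ∂P) • ContinuousLinearMap.snd ℝ ℝ ℝ) x := by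
    have h := hasFDerivAt_integral_of_dominated_of_fderiv_le (𝕜 := ℝ) (μ := P) (x₀ := x)
      (s := Set.univ) (F := fun (x : ℝ × ℝ) ω => V ω * f (θ * W ω * x.2 + x.1))
      (F' := fun x ω => (V ω * f' (θ * W ω * x.2 + x.1)) • ContinuousLinearMap.fst ℝ ℝ ℝ +
        (θ * (V ω * W ω * f' (θ * W ω * x.2 + x.1))) • ContinuousLinearMap.snd ℝ ℝ ℝ)
      (bound := fun ω => |V ω| + |θ| * |V ω * W ω|) univ_mem
      (Eventually.of_forall fun x =>
        (integrable_mul_comp hWm hV hVW hf hf'1 θ x).aestronglyMeasurable)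
      (integrable_mul_comp hWm hV hVW hf hf'1 θ x)
      (((hint V hV x).aestronglyMeasurable.smul_const _).add
        (((hint _ hVW x).aestronglyMeasurable.const_mul θ).smul_const _))
      (ae_of_all _ fun ω x _ => ?_) (hV.abs.add (hVW.abs.const_mul _))
      (ae_of_all _ fun ω x _ => ?_)
    · convert! h using 1
      rw [integral_add ((hint V hV x).smul_const _) (((hint _ hVW x).const_mul θ).smul_const _),
        integral_smul_const, integral_smul_const, integral_const_mul]
    · refine (norm_add_le _ _).trans (add_le_add ?_ ?_)
      · rw [norm_smul, Real.norm_eq_abs, abs_mul, mul_assoc]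
        refine mul_le_of_le_one_right (abs_nonneg _) ?_
        exact mul_le_one₀ (hf'1 _) (norm_nonneg _) (ContinuousLinearMap.norm_fst_le ℝ ℝ ℝ)
      · rw [norm_smul, Real.norm_eq_abs, abs_mul, abs_mul _ (f' _), mul_assoc, mul_assoc]
        gcongr
        refine mul_le_of_le_one_right (abs_nonneg _) ?_
        exact mul_le_one₀ (hf'1 _) (norm_nonneg _) (ContinuousLinearMap.norm_snd_le ℝ ℝ ℝ)
    · have h1 : HasFDerivAt (fun x : ℝ × ℝ => θ * W ω * x.2 + x.1)
          ((θ * W ω) • ContinuousLinearMap.snd ℝ ℝ ℝ + ContinuousLinearMap.fst ℝ ℝ ℝ) x :=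
        (hasFDerivAt_snd.const_mul _).add hasFDerivAt_fst
      have h2 := ((hf (θ * W ω * x.2 + x.1)).comp_hasFDerivAt x h1).const_mul (V ω)
      convert! h2 using 1
      ext
      · simp
      · simp
        ring
  -- Continuity of the derivative upgrades it to a strict one, as the implicit function theorem
  -- requires.
  refine hasStrictFDerivAt_of_hasFDerivAt_of_continuousAt (Eventually.of_forall hder) ?_
  exact (((hcont V hV).smul continuous_const).add
    ((continuous_const.mul (hcont _ hVW)).smul continuous_const)).continuousAt

end Integral

/-- One-dimensional implicit function theorem for a locally unique zero. -/
theorem hasDerivAt_of_unique_zero {Φ : ℝ × ℝ → ℝ} {c d b₀ : ℝ} {z : ℝ → ℝ} {A : Set ℝ}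
    (hΦ : HasStrictFDerivAt Φ (c • ContinuousLinearMap.fst ℝ ℝ ℝ +
      d • ContinuousLinearMap.snd ℝ ℝ ℝ) (b₀, z b₀)) (hd : d ≠ 0) (h0 : Φ (b₀, z b₀) = 0)
    (hA : A ∈ 𝓝 (z b₀)) (huniq : ∀ᶠ b in 𝓝 b₀, ∀ u ∈ A, Φ (b, u) = 0 → u = z b) :
    HasDerivAt z (-(c / d)) b₀ := by
  have hinv : ((c • ContinuousLinearMap.fst ℝ ℝ ℝ + d • ContinuousLinearMap.snd ℝ ℝ ℝ) ∘L
      .inr ℝ ℝ ℝ).IsInvertible := by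
    refine ⟨ContinuousLinearEquiv.unitsEquivAut ℝ (Units.mk0 d hd), ?_⟩
    ext
    simp
  have h1 := hΦ.eventually_apply_implicitFunctionOfProdDomain hinv
  have h2 := hΦ.tendsto_implicitFunctionOfProdDomain hinv
  have h3 := (hΦ.hasStrictFDerivAt_implicitFunctionOfProdDomain hinv).hasFDerivAt
  set g := hΦ.implicitFunctionOfProdDomain hinv
  -- The implicit function stays in `A` near `b₀` and solves the equation, so uniqueness identifies
  -- it with `z`. The value of the derivative then follows by differentiating `Φ (b, z b) = 0`.
  have hg : z =ᶠ[𝓝 b₀] g := by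
    filter_upwards [h1, h2 hA, huniq] with b hb hb' hb''
    rw [h0] at hb
    exact (hb'' _ hb' hb).symm
  have hz : HasDerivAt z _ b₀ := (h3.congr_of_eventuallyEq hg).hasDerivAt
  have h4 := hΦ.hasFDerivAt.comp_hasDerivAt b₀ ((hasDerivAt_id b₀).prodMk hz)
  have h5 : HasDerivAt (Φ ∘ fun b => (b, z b)) 0 b₀ := by
    refine (hasDerivAt_const b₀ (0 : ℝ)).congr_of_eventuallyEq ?_
    filter_upwards [h1, hg] with b hb hb'
    simp only [Function.comp_apply]
    rw [hb', hb, h0]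
  have h6 := h4.unique h5
  simp only [add_apply, smul_apply, ContinuousLinearMap.coe_fst', ContinuousLinearMap.coe_snd',
    smul_eq_mul, mul_one] at h6
  convert! hz using 1
  field_simp
  linarith

theorem HasStrictFDerivAt.hasDerivAt_curve {F : ℝ × ℝ → ℝ} {c d b φ' : ℝ} {φ : ℝ → ℝ}
    (hF : HasStrictFDerivAt F (c • ContinuousLinearMap.fst ℝ ℝ ℝ +
      d • ContinuousLinearMap.snd ℝ ℝ ℝ) (b, φ b)) (hφ : HasDerivAt φ φ' b) :
    HasDerivAt (fun b => F (b, φ b)) (c + d * φ') b := by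
  have h := hF.hasFDerivAt.comp_hasDerivAt b ((hasDerivAt_id b).prodMk hφ)
  simpa using! h

theorem HasStrictFDerivAt.hasDerivAt_snd {F : ℝ × ℝ → ℝ} {c d b u : ℝ}
    (hF : HasStrictFDerivAt F (c • ContinuousLinearMap.fst ℝ ℝ ℝ +
      d • ContinuousLinearMap.snd ℝ ℝ ℝ) (b, u)) :
    HasDerivAt (fun u => F (b, u)) d u := by
  have h := hF.hasFDerivAt.comp_hasDerivAt u ((hasDerivAt_const u b).prodMk (hasDerivAt_id u))
  simpa using! h

/-- A nonnegative square-integrable weight variable with positive mean. -/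
structure LimitWeight {Ω : Type*} [MeasurableSpace Ω] (P : Measure Ω) (W : Ω → ℝ) : Prop where
  integrable : Integrable W P
  integrable_sq : Integrable (fun ω => W ω ^ 2) P
  nonneg : ∀ᵐ ω ∂P, 0 ≤ W ω
  mean_pos : 0 < ∫ ω, W ω ∂P

/-! ### The limiting action and its stationary points. -/

section Limit

variable {Ω : Type*} [MeasurableSpace Ω] (P : Measure Ω) (W : Ω → ℝ) (θ : ℝ)

/-- The functional whose supremum over `u` is the limiting pressure, at `x = (b, u)`. -/
def limitAction (x : ℝ × ℝ) : ℝ :=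
  ∫ ω, Real.log (2 * Real.cosh (θ * W ω * x.2 + x.1)) ∂P - θ * (∫ ω, W ω ∂P) / 2 * x.2 ^ 2

/-- The mean-field equation is `limitField (b, u) = 0`. -/
def limitField (x : ℝ × ℝ) : ℝ :=
  (∫ ω, W ω ∂P) * x.2 - ∫ ω, W ω * Real.tanh (θ * W ω * x.2 + x.1) ∂P

/-- The mean spin in the field `θ W u + b`, at `x = (b, u)`. -/
def limitMag (x : ℝ × ℝ) : ℝ := ∫ ω, Real.tanh (θ * W ω * x.2 + x.1) ∂P

/-- Weighted averages of `1 - tanh ^ 2` in the field `θ W u + b`, at `x = (b, u)`. -/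
def limitMoment (k : ℕ) (x : ℝ × ℝ) : ℝ :=
  ∫ ω, W ω ^ k * (1 - Real.tanh (θ * W ω * x.2 + x.1) ^ 2) ∂P

/-- The field-dependent part of the limiting pressure. -/
def limitSup (b : ℝ) : ℝ := ⨆ u : ℝ, limitAction P W θ (b, u)

variable {P W θ} [IsProbabilityMeasure P]

omit [IsProbabilityMeasure P] in
theorem LimitWeight.integrable_pow_mul (h : LimitWeight P W) (x : ℝ × ℝ) :
    Integrable (fun ω => W ω ^ 2 * (1 - Real.tanh (θ * W ω * x.2 + x.1) ^ 2)) P := by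
  have hm : AEMeasurable W P := h.integrable.aemeasurable
  refine Integrable.mono' h.integrable_sq (h.integrable_sq.aestronglyMeasurable.mul ?_)
    (ae_of_all _ fun ω => ?_)
  · have hc : Continuous fun y => 1 - Real.tanh y ^ 2 := by
      have := continuous_tanh
      fun_prop
    exact (hc.measurable.comp_aemeasurable (f := fun ω => θ * W ω * x.2 + x.1)
      (by fun_prop)).aestronglyMeasurable
  · rw [Real.norm_eq_abs, abs_mul, abs_of_nonneg (sq_nonneg (W ω))]
    exact mul_le_of_le_one_right (sq_nonneg _) (abs_one_sub_tanh_sq_le _)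

theorem LimitWeight.hasStrictFDerivAt_action (h : LimitWeight P W) (x : ℝ × ℝ) :
    HasStrictFDerivAt (limitAction P W θ) (limitMag P W θ x • ContinuousLinearMap.fst ℝ ℝ ℝ +
      (-(θ * limitField P W θ x)) • ContinuousLinearMap.snd ℝ ℝ ℝ) x := by
  have h1 := hasStrictFDerivAt_integral (V := fun _ => 1) h.integrable.aemeasurable
    (integrable_const (1 : ℝ)) (by simpa using h.integrable) hasDerivAt_log_two_cosh
    continuous_tanh (fun y => (Real.abs_tanh_lt_one y).le) θ x
  have h2 : HasStrictFDerivAt (fun x : ℝ × ℝ => θ * (∫ ω, W ω ∂P) / 2 * x.2 ^ 2) _ x :=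
    ((hasStrictFDerivAt_snd (𝕜 := ℝ) (E := ℝ) (F := ℝ)).pow 2).const_mul _
  simp only [one_mul] at h1
  convert! h1.sub h2 using 1
  ext
  · simp [limitMag]
  · simp only [limitField, add_apply, smul_apply, sub_apply, ContinuousLinearMap.comp_apply,
      ContinuousLinearMap.coe_fst', ContinuousLinearMap.coe_snd', ContinuousLinearMap.inr_apply,
      smul_eq_mul, nsmul_eq_mul]
    simp
    ring

theorem LimitWeight.hasStrictFDerivAt_mag (h : LimitWeight P W) (x : ℝ × ℝ) :
    HasStrictFDerivAt (limitMag P W θ) (limitMoment P W θ 0 x • ContinuousLinearMap.fst ℝ ℝ ℝ +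
      (θ * limitMoment P W θ 1 x) • ContinuousLinearMap.snd ℝ ℝ ℝ) x := by
  have h1 := hasStrictFDerivAt_integral (V := fun _ => 1) h.integrable.aemeasurable
    (integrable_const (1 : ℝ)) (by simpa using h.integrable) hasDerivAt_tanh
    (by have := continuous_tanh; fun_prop) abs_one_sub_tanh_sq_le θ x
  simpa only [limitMoment, limitMag, one_mul, pow_zero, pow_one] using! h1

omit [IsProbabilityMeasure P] in
theorem LimitWeight.hasStrictFDerivAt_field (h : LimitWeight P W) (x : ℝ × ℝ) :
    HasStrictFDerivAt (limitField P W θ)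
      ((-limitMoment P W θ 1 x) • ContinuousLinearMap.fst ℝ ℝ ℝ +
        (∫ ω, W ω ∂P - θ * limitMoment P W θ 2 x) • ContinuousLinearMap.snd ℝ ℝ ℝ) x := by
  have h1 := hasStrictFDerivAt_integral h.integrable.aemeasurable
    h.integrable (by simpa only [← sq] using h.integrable_sq) hasDerivAt_tanh
    (by have := continuous_tanh; fun_prop) abs_one_sub_tanh_sq_le θ x
  have h2 : HasStrictFDerivAt (fun x : ℝ × ℝ => (∫ ω, W ω ∂P) * x.2) _ x :=
    (hasStrictFDerivAt_snd (𝕜 := ℝ) (E := ℝ) (F := ℝ)).const_mul _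
  convert! h2.sub h1 using 1
  ext <;> simp [limitMoment, sq]

omit [IsProbabilityMeasure P] in
theorem LimitWeight.hasDerivAt_field (h : LimitWeight P W) (b u : ℝ) :
    HasDerivAt (fun u => limitField P W θ (b, u))
      (∫ ω, W ω ∂P - θ * limitMoment P W θ 2 (b, u)) u :=
  HasStrictFDerivAt.hasDerivAt_snd (h.hasStrictFDerivAt_field (b, u))

theorem LimitWeight.hasDerivAt_action (h : LimitWeight P W) (b u : ℝ) :
    HasDerivAt (fun u => limitAction P W θ (b, u)) (-(θ * limitField P W θ (b, u))) u :=
  HasStrictFDerivAt.hasDerivAt_snd (h.hasStrictFDerivAt_action (b, u))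

/-- The implicit function theorem differentiates the maximizer `z`. The `u`-derivative of the action
vanishes at `z b`, so by the envelope principle the derivative of the supremum is the partial
derivative in `b`; the chain rule then gives the second derivative. -/
theorem LimitWeight.derivatives_of_zero (h : LimitWeight P W) {D A : Set ℝ} (hD : IsOpen D)
    (hA : IsOpen A) {z : ℝ → ℝ} (hzA : ∀ b ∈ D, z b ∈ A)
    (h0 : ∀ b ∈ D, limitField P W θ (b, z b) = 0)
    (huniq : ∀ b ∈ D, ∀ u ∈ A, limitField P W θ (b, u) = 0 → u = z b)
    (hpos : ∀ b ∈ D, 0 < ∫ ω, W ω ∂P - θ * limitMoment P W θ 2 (b, z b))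
    (hmax : ∀ b ∈ D, ∀ u, limitAction P W θ (b, u) ≤ limitAction P W θ (b, z b))
    {b : ℝ} (hb : b ∈ D) :
    HasDerivAt (limitSup P W θ) (limitMag P W θ (b, z b)) b ∧
      HasDerivAt (fun b => limitMag P W θ (b, z b)) (limitMoment P W θ 0 (b, z b) +
        θ * limitMoment P W θ 1 (b, z b) * (limitMoment P W θ 1 (b, z b) /
          (∫ ω, W ω ∂P - θ * limitMoment P W θ 2 (b, z b)))) b := by
  have hz := hasDerivAt_of_unique_zero (h.hasStrictFDerivAt_field (b, z b)) (hpos b hb).ne'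
    (h0 b hb) (hA.mem_nhds (hzA b hb))
    (by filter_upwards [hD.mem_nhds hb] with b hb using huniq b hb)
  rw [neg_div, neg_neg] at hz
  refine ⟨?_, HasStrictFDerivAt.hasDerivAt_curve (h.hasStrictFDerivAt_mag (b, z b)) hz⟩
  have h1 := HasStrictFDerivAt.hasDerivAt_curve (h.hasStrictFDerivAt_action (θ := θ) (b, z b)) hz
  rw [h0 b hb, mul_zero, neg_zero, zero_mul, add_zero] at h1
  refine h1.congr_of_eventuallyEq ?_
  filter_upwards [hD.mem_nhds hb] with b hb
  exact le_antisymm (ciSup_le (hmax b hb))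
    (le_ciSup (f := fun u => limitAction P W θ (b, u)) ⟨_, by rintro _ ⟨u, rfl⟩; exact hmax b hb u⟩ (z b))

omit [IsProbabilityMeasure P] in
theorem LimitWeight.integrable_mul_tanh (h : LimitWeight P W) (x : ℝ × ℝ) :
    Integrable (fun ω => W ω * Real.tanh (θ * W ω * x.2 + x.1)) P :=
  integrable_mul_comp h.integrable.aemeasurable h.integrable
    (by simpa only [← sq] using h.integrable_sq) hasDerivAt_tanh abs_one_sub_tanh_sq_le θ x

theorem LimitWeight.integrable_tanh (h : LimitWeight P W) (x : ℝ × ℝ) :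
    Integrable (fun ω => Real.tanh (θ * W ω * x.2 + x.1)) P := by
  simpa using integrable_mul_comp (V := fun _ => 1) h.integrable.aemeasurable (integrable_const 1)
    (by simpa using h.integrable) hasDerivAt_tanh abs_one_sub_tanh_sq_le θ x

theorem LimitWeight.integrable_log_cosh (h : LimitWeight P W) (x : ℝ × ℝ) :
    Integrable (fun ω => Real.log (2 * Real.cosh (θ * W ω * x.2 + x.1))) P := by
  simpa using integrable_mul_comp (V := fun _ => 1) h.integrable.aemeasurable (integrable_const 1)
    (by simpa using h.integrable) hasDerivAt_log_two_cosh
    (fun y => (Real.abs_tanh_lt_one y).le) θ x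

-- Since `|tanh| ≤ 1` and `W ≥ 0`, the field has opposite weak signs at `1` and `-1`, which locates
-- a zero by the intermediate value theorem.
omit [IsProbabilityMeasure P] in
theorem LimitWeight.field_one_nonneg (h : LimitWeight P W) (b : ℝ) :
    0 ≤ limitField P W θ (b, 1) := by
  rw [limitField, mul_one, sub_nonneg]
  refine integral_mono_ae (h.integrable_mul_tanh (b, 1)) h.integrable ?_
  filter_upwards [h.nonneg] with ω hω
  exact mul_le_of_le_one_right hω (Real.tanh_lt_one _).le

omit [IsProbabilityMeasure P] in
theorem LimitWeight.field_neg_one_nonpos (h : LimitWeight P W) (b : ℝ) :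
    limitField P W θ (b, -1) ≤ 0 := by
  rw [limitField, mul_neg_one, sub_nonpos, ← integral_neg]
  refine integral_mono_ae h.integrable.neg (h.integrable_mul_tanh (b, -1)) ?_
  filter_upwards [h.nonneg] with ω hω
  have := (Real.neg_one_lt_tanh (θ * W ω * (b, (-1 : ℝ)).2 + (b, (-1 : ℝ)).1)).le
  nlinarith

omit [IsProbabilityMeasure P] in
theorem LimitWeight.continuous_field (h : LimitWeight P W) (b : ℝ) :
    Continuous fun u => limitField P W θ (b, u) :=
  continuous_iff_continuousAt.2 fun u => (h.hasDerivAt_field b u).continuousAt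

omit [IsProbabilityMeasure P] in
theorem LimitWeight.field_zero (b : ℝ) :
    limitField P W θ (b, 0) = -((∫ ω, W ω ∂P) * Real.tanh b) := by
  simp [limitField, integral_mul_const]

omit [IsProbabilityMeasure P] in
theorem LimitWeight.moment_two_le (h : LimitWeight P W) (x : ℝ × ℝ) :
    limitMoment P W θ 2 x ≤ ∫ ω, W ω ^ 2 ∂P := by
  refine integral_mono (h.integrable_pow_mul x) h.integrable_sq fun ω => ?_
  exact mul_le_of_le_one_right (sq_nonneg _) (abs_le.1 (abs_one_sub_tanh_sq_le _)).2

theorem LimitWeight.action_le_of_field (h : LimitWeight P W) (hθ : 0 ≤ θ) {b z : ℝ} {I : Set ℝ}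
    (hI : Convex ℝ I) (hz : z ∈ I)
    (h1 : ∀ u ∈ I, u ≤ z → limitField P W θ (b, u) ≤ 0)
    (h2 : ∀ u ∈ I, z ≤ u → 0 ≤ limitField P W θ (b, u)) {u : ℝ} (hu : u ∈ I) :
    limitAction P W θ (b, u) ≤ limitAction P W θ (b, z) := by
  rcases le_total u z with hle | hle
  · have hsub : Set.Icc u z ⊆ I := hI.ordConnected.out hu hz
    refine (monotoneOn_of_deriv_nonneg (convex_Icc u z)
      (fun v _ => (h.hasDerivAt_action b v).continuousAt.continuousWithinAt)
      (fun v _ => (h.hasDerivAt_action b v).differentiableAt.differentiableWithinAt)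
      fun v hv => ?_) ⟨le_rfl, hle⟩ ⟨hle, le_rfl⟩ hle
    have hv' := interior_subset hv
    rw [(h.hasDerivAt_action b v).deriv]
    nlinarith [h1 v (hsub hv') hv'.2]
  · have hsub : Set.Icc z u ⊆ I := hI.ordConnected.out hz hu
    refine (antitoneOn_of_deriv_nonpos (convex_Icc z u)
      (fun v _ => (h.hasDerivAt_action b v).continuousAt.continuousWithinAt)
      (fun v _ => (h.hasDerivAt_action b v).differentiableAt.differentiableWithinAt)
      fun v hv => ?_) ⟨le_rfl, hle⟩ ⟨hle, le_rfl⟩ hle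
    have hv' := interior_subset hv
    rw [(h.hasDerivAt_action b v).deriv]
    nlinarith [h2 v (hsub hv') hv'.1]

/-- Above the mean-field critical point the mean-field equation has a unique solution. -/
theorem LimitWeight.exists_zero_of_lt (h : LimitWeight P W) (hθ : 0 ≤ θ)
    (hlt : θ * ∫ ω, W ω ^ 2 ∂P < ∫ ω, W ω ∂P) (b : ℝ) :
    ∃ z, limitField P W θ (b, z) = 0 ∧ (∀ u, limitField P W θ (b, u) = 0 → u = z) ∧
      (0 < ∫ ω, W ω ∂P - θ * limitMoment P W θ 2 (b, z)) ∧
      ∀ u, limitAction P W θ (b, u) ≤ limitAction P W θ (b, z) := by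
  have hd (u : ℝ) : 0 < ∫ ω, W ω ∂P - θ * limitMoment P W θ 2 (b, u) := by
    have := mul_le_mul_of_nonneg_left (h.moment_two_le (θ := θ) (b, u)) hθ
    linarith
  -- The `u`-derivative of the field is at least `E[W] - θ E[W²] > 0`, whatever the value of `b`.
  have hmono : StrictMono fun u => limitField P W θ (b, u) :=
    strictMono_of_deriv_pos fun u => by rw [(h.hasDerivAt_field b u).deriv]; exact hd u
  obtain ⟨z, -, hz⟩ := intermediate_value_Icc (show (-1 : ℝ) ≤ 1 by norm_num)
    (h.continuous_field b).continuousOn ⟨h.field_neg_one_nonpos b, h.field_one_nonneg b⟩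
  simp only at hz
  refine ⟨z, hz, fun u hu => hmono.injective (by simp only [hu, hz]), hd z, fun u => ?_⟩
  refine h.action_le_of_field hθ convex_univ (Set.mem_univ z) (fun v _ hv => ?_) (fun v _ hv => ?_)
    (Set.mem_univ u)
  · exact (hmono.monotone hv).trans_eq hz
  · exact hz.symm.trans_le (hmono.monotone hv)

-- Concavity of `tanh` on `[0, ∞)`; `b ≥ 0`, `θ ≥ 0` and `W ≥ 0` keep its argument there.
omit [IsProbabilityMeasure P] in
theorem LimitWeight.convexOn_field (h : LimitWeight P W) (hθ : 0 ≤ θ) {b : ℝ} (hb : 0 ≤ b) :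
    ConvexOn ℝ (Set.Ici 0) fun u => limitField P W θ (b, u) := by
  refine MonotoneOn.convexOn_of_deriv (convex_Ici 0) (h.continuous_field b).continuousOn
    (fun u _ => (h.hasDerivAt_field b u).differentiableAt.differentiableWithinAt) ?_
  intro u hu v hv huv
  rw [interior_Ici, Set.mem_Ioi] at hu hv
  rw [(h.hasDerivAt_field b u).deriv, (h.hasDerivAt_field b v).deriv]
  refine sub_le_sub_left (mul_le_mul_of_nonneg_left ?_ hθ) _
  refine integral_mono_ae (h.integrable_pow_mul (b, v)) (h.integrable_pow_mul (b, u)) ?_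
  filter_upwards [h.nonneg] with ω hω
  have h1 : 0 ≤ θ * W ω * u + b := by positivity
  have h2 : θ * W ω * u + b ≤ θ * W ω * v + b := by gcongr
  have h3 : 0 ≤ Real.tanh (θ * W ω * u + b) := by
    have := tanh_strictMono.monotone h1
    rwa [Real.tanh_zero] at this
  have h4 := tanh_strictMono.monotone h2
  exact mul_le_mul_of_nonneg_left (sub_le_sub_left (pow_le_pow_left₀ h3 h4 2) 1) (sq_nonneg _)

/-- In a positive field the mean-field equation has a unique positive solution. -/
theorem LimitWeight.exists_zero_of_pos (h : LimitWeight P W) (hθ : 0 ≤ θ) {b : ℝ} (hb : 0 < b) :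
    ∃ z, 0 < z ∧ limitField P W θ (b, z) = 0 ∧
      (∀ u, 0 < u → limitField P W θ (b, u) = 0 → u = z) ∧
      (0 < ∫ ω, W ω ∂P - θ * limitMoment P W θ 2 (b, z)) ∧
      (∀ u, limitAction P W θ (b, u) ≤ limitAction P W θ (b, z)) ∧
      ∀ u, z < u → 0 < limitField P W θ (b, u) := by
  have hneg : limitField P W θ (b, 0) < 0 := by
    rw [LimitWeight.field_zero, neg_lt_zero]
    exact mul_pos h.mean_pos (tanh_pos hb)
  obtain ⟨z, hz01, hz⟩ := intermediate_value_Icc (show (0 : ℝ) ≤ 1 by norm_num)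
    (h.continuous_field (θ := θ) b).continuousOn ⟨hneg.le, h.field_one_nonneg b⟩
  simp only at hz
  have hz0 : 0 < z := hz01.1.lt_of_ne fun h0 => by rw [← h0] at hz; exact hneg.ne hz
  have hconv := h.convexOn_field hθ hb.le
  -- The chord inequality between `0` and `u`, multiplied by `u`. A convex function negative at `0`
  -- has only one positive zero and crosses it upwards.
  have key {s u : ℝ} (hs : 0 ≤ s) (hsu : s ≤ u) (hu : 0 < u) : u * limitField P W θ (b, s) ≤
      (u - s) * limitField P W θ (b, 0) + s * limitField P W θ (b, u) := by
    have := hconv.2 (Set.mem_Ici.2 le_rfl) (Set.mem_Ici.2 hu.le)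
      (sub_nonneg.2 (div_le_one_of_le₀ hsu hu.le)) (div_nonneg hs hu.le)
      (sub_add_cancel 1 (s / u))
    simp only [smul_eq_mul, mul_zero, zero_add, div_mul_cancel₀ s hu.ne'] at this
    have h2 := mul_le_mul_of_nonneg_left this hu.le
    refine h2.trans_eq ?_
    field_simp
  have hbelow {s : ℝ} (hs : 0 ≤ s) (hsz : s < z) : limitField P W θ (b, s) < 0 := by
    have := key hs hsz.le hz0
    rw [hz, mul_zero, add_zero] at this
    nlinarith
  have habove {u : ℝ} (hu : z < u) : 0 < limitField P W θ (b, u) := by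
    have := key hz0.le hu.le (hz0.trans hu)
    rw [hz, mul_zero] at this
    nlinarith
  refine ⟨z, hz0, hz, fun u hu hu0 => ?_, ?_, fun u => ?_, fun u hu => habove hu⟩
  · rcases lt_trichotomy u z with hlt | heq | hlt
    · exact absurd hu0 (hbelow hu.le hlt).ne
    · exact heq
    · exact absurd hu0 (habove hlt).ne'
  · have hs := hconv.slope_le_of_hasDerivAt (Set.mem_Ici.2 le_rfl) (Set.mem_Ici.2 hz0.le) hz0
      (h.hasDerivAt_field b z)
    refine lt_of_lt_of_le ?_ hs
    rw [slope_def_field, hz, zero_sub, sub_zero]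
    exact div_pos (neg_pos.2 hneg) hz0
  · have hnonneg {u : ℝ} (hu : 0 ≤ u) : limitAction P W θ (b, u) ≤ limitAction P W θ (b, z) := by
      refine h.action_le_of_field hθ (convex_Ici 0) (Set.mem_Ici.2 hz0.le) (fun v hv hvz => ?_)
        (fun v hv hvz => ?_) (Set.mem_Ici.2 hu)
      · rcases hvz.lt_or_eq with hlt | rfl
        exacts [(hbelow hv hlt).le, hz.le]
      · rcases hvz.lt_or_eq with hlt | rfl
        exacts [(habove hlt).le, hz.ge]
    rcases le_or_gt 0 u with hu | hu
    · exact hnonneg hu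
    -- As `b > 0`, replacing a negative `u` by `-u` increases `|θ W u + b|`, hence the action.
    · refine le_trans ?_ (hnonneg (neg_nonneg.2 hu.le))
      rw [limitAction, limitAction, neg_sq]
      refine sub_le_sub_right (integral_mono_ae (h.integrable_log_cosh (b, u))
        (h.integrable_log_cosh (b, -u)) ?_) _
      filter_upwards [h.nonneg] with ω hω
      refine Real.log_le_log (by positivity) (mul_le_mul_of_nonneg_left ?_ zero_le_two)
      rw [Real.cosh_le_cosh]
      have : 0 ≤ θ * W ω * -u := mul_nonneg (mul_nonneg hθ hω) (by linarith)
      rw [abs_of_nonneg (show 0 ≤ θ * W ω * -u + b by linarith), abs_le]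
      constructor <;> linarith

end Limit

theorem WeightRegularity.limitWeight {Ω : Type*} [MeasurableSpace Ω] {P : Measure Ω}
    [IsProbabilityMeasure P] {W : Ω → ℝ} {w : (N : ℕ+) → Fin N → ℝ≥0}
    (hreg : WeightRegularity w P W) : LimitWeight P W :=
  ⟨hreg.integrable, hreg.integrable_sq, hreg.ae_nonneg, hreg.mean_pos⟩

/-! ### The limiting pressure -/

theorem log_two_cosh_le (y : ℝ) : Real.log (2 * Real.cosh y) ≤ Real.log 2 + |y| := by
  rw [Real.log_mul two_ne_zero (Real.cosh_pos y).ne']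
  gcongr
  rw [Real.log_le_iff_le_exp (Real.cosh_pos y), ← Real.cosh_abs, Real.cosh_eq]
  have : Real.exp (-|y|) ≤ Real.exp |y| := Real.exp_le_exp.2 (by linarith [abs_nonneg y])
  linarith

theorem LimitWeight.action_le {Ω : Type*} [MeasurableSpace Ω] {P : Measure Ω}
    [IsProbabilityMeasure P] {W : Ω → ℝ} (h : LimitWeight P W) {θ : ℝ} (hθ : 0 ≤ θ) (b u : ℝ) :
    limitAction P W θ (b, u) ≤ Real.log 2 + |b| + θ * (∫ ω, W ω ∂P) / 2 := by
  have h1 : ∫ ω, Real.log (2 * Real.cosh (θ * W ω * u + b)) ∂P ≤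
      ∫ ω, (Real.log 2 + |b| + θ * |u| * W ω) ∂P := by
    refine integral_mono_ae (h.integrable_log_cosh (b, u))
      ((integrable_const _).add (h.integrable.const_mul _)) ?_
    filter_upwards [h.nonneg] with ω hω
    refine (log_two_cosh_le _).trans ?_
    have := abs_add_le (θ * W ω * u) b
    rw [abs_mul, abs_mul, abs_of_nonneg hθ, abs_of_nonneg hω] at this
    calc _ ≤ Real.log 2 + (θ * W ω * |u| + |b|) := by gcongr
      _ = _ := by ring
  rw [integral_add (integrable_const _) (h.integrable.const_mul _), integral_const_mul] at h1
  simp only [integral_const, probReal_univ, one_smul] at h1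
  have h2 : 0 ≤ θ * ∫ ω, W ω ∂P := mul_nonneg hθ h.mean_pos.le
  rw [limitAction]
  simp only
  -- The linear growth is absorbed by the quadratic term through `2|u| ≤ u² + 1`.
  nlinarith [mul_nonneg h2 (sq_nonneg (|u| - 1)), sq_abs u]

theorem LimitWeight.bddAbove_action {Ω : Type*} [MeasurableSpace Ω] {P : Measure Ω}
    [IsProbabilityMeasure P] {W : Ω → ℝ} (h : LimitWeight P W) {θ : ℝ} (hθ : 0 ≤ θ) (b : ℝ) :
    BddAbove (Set.range fun u => limitAction P W θ (b, u)) :=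
  ⟨_, by rintro _ ⟨u, rfl⟩; exact h.action_le hθ b u⟩

/-! ### Upper and lower bounds for the finite-volume pressure. -/

section FiniteVolume

variable {N : ℕ} (w : Fin N → ℝ≥0)

/-- The finite-volume analogue of `limitAction`. -/
def averageAction (θ b u : ℝ) : ℝ :=
  1 / (N : ℝ) * ∑ i, Real.log (2 * Real.cosh (θ * (w i : ℝ) * u + b)) -
    θ * (1 / (N : ℝ) * ∑ i, (w i : ℝ)) / 2 * u ^ 2

theorem sum_exp_spin (b : ℝ) (a : Fin N → ℝ) :
    ∑ σ : SpinConfig N, Real.exp (b * totalSpin σ + ∑ i, a i * spinVal (σ i)) =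
      ∏ i, (2 * Real.cosh (a i + b)) := by
  have h := Finset.prod_univ_sum (fun _ : Fin N => (Finset.univ : Finset ℤˣ))
    fun i s => Real.exp ((a i + b) * spinVal s)
  rw [Fintype.piFinset_univ] at h
  have e (i : Fin N) : ∑ s, Real.exp ((a i + b) * spinVal s) = 2 * Real.cosh (a i + b) := by
    rw [sum_spin, spinVal_one, spinVal_neg_one, Real.cosh_eq]
    ring_nf
  simp only [e] at h
  rw [h]
  refine Finset.sum_congr rfl fun σ _ => ?_
  rw [← Real.exp_sum, totalSpin, Finset.mul_sum, ← Finset.sum_add_distrib]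
  congr 1
  exact Finset.sum_congr rfl fun i _ => by ring

/-- For fixed `u`, replacing `L² / ℓ` by its tangent `2 u L - u² ℓ` leaves independent spins, whose
partition function is a product of hyperbolic cosines. -/
theorem exp_averageAction (hN : 0 < N) (θ b u : ℝ) :
    Real.exp (N * averageAction w θ b u) = ∑ σ : SpinConfig N, Real.exp (b * totalSpin σ +
      (θ * u * ∑ i, (w i : ℝ) * spinVal (σ i) - θ / 2 * u ^ 2 * ∑ i, (w i : ℝ))) := by
  have hN' : (N : ℝ) ≠ 0 := (Nat.cast_pos.2 hN).ne'
  have e : (N : ℝ) * averageAction w θ b u = ∑ i, Real.log (2 * Real.cosh (θ * (w i : ℝ) * u + b)) -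
      θ / 2 * u ^ 2 * ∑ i, (w i : ℝ) := by
    rw [averageAction, mul_sub, ← mul_assoc, mul_one_div_cancel hN', one_mul]
    congr 1
    field_simp
  rw [e, Real.exp_sub, Real.exp_sum]
  simp only [Real.exp_log (show 0 < 2 * Real.cosh _ by positivity)]
  rw [← sum_exp_spin b fun i => θ * (w i : ℝ) * u, Finset.sum_div]
  refine Finset.sum_congr rfl fun σ _ => ?_
  rw [← Real.exp_sub]
  have e2 : ∑ i, θ * (w i : ℝ) * u * spinVal (σ i) = θ * u * ∑ i, (w i : ℝ) * spinVal (σ i) := by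
    rw [Finset.mul_sum]
    exact Finset.sum_congr rfl fun i _ => by ring
  rw [e2, add_sub_assoc]

/-- The error in the Curie--Weiss approximation of the annealed weight. -/
def annealedError (β : ℝ) : ℝ :=
  (Real.cosh β - 1 + Real.sinh β) / 2 * ((∑ i, (w i : ℝ) ^ 2) / ∑ i, (w i : ℝ)) +
      (Real.exp (2 * β) + 1) / 2 * ((∑ i, (w i : ℝ) ^ 2) / ∑ i, (w i : ℝ)) ^ 2

/-- A square lies above its tangents, so every `u` gives a lower bound. -/
theorem le_annealedPressure (hw : ∀ i, 0 < w i) (hN : 0 < N) {β : ℝ} (hβ : 0 ≤ β) (b u : ℝ) :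
    (Real.cosh β - 1) / 2 * (1 / (N : ℝ) * ∑ i, (w i : ℝ)) + averageAction w (Real.sinh β) b u -
      1 / (N : ℝ) * annealedError w β ≤ annealedPressure w β b := by
  have hN' : (0 : ℝ) < N := Nat.cast_pos.2 hN
  have hpos : 0 < ∑ i, (w i : ℝ) :=
    Finset.sum_pos (fun i _ => NNReal.coe_pos.2 (hw i)) ⟨⟨0, hN⟩, Finset.mem_univ _⟩
  have hs := Real.sinh_nonneg_iff.2 hβ
  have h1 : Real.exp ((Real.cosh β - 1) / 2 * ∑ i, (w i : ℝ) - annealedError w β) *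
      Real.exp (N * averageAction w (Real.sinh β) b u) ≤ annealedPartition w β b := by
    rw [exp_averageAction w hN, annealedPartition_eq, Finset.mul_sum]
    refine Finset.sum_le_sum fun σ _ => ?_
    rw [← Real.exp_add, ← Real.le_log_iff_exp_le (annealedFactor_pos w β b σ)]
    have h2 := (abs_le.1 (abs_log_annealedFactor_sub_le w hw hβ b hN σ)).1
    have h3 : 2 * u * (∑ i, (w i : ℝ) * spinVal (σ i)) - u ^ 2 * ∑ i, (w i : ℝ) ≤
        (∑ i, (w i : ℝ) * spinVal (σ i)) ^ 2 / ∑ i, (w i : ℝ) := by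
      rw [le_div_iff₀ hpos]
      nlinarith [sq_nonneg (∑ i, (w i : ℝ) * spinVal (σ i) - u * ∑ i, (w i : ℝ))]
    have h4 := mul_le_mul_of_nonneg_left h3 (div_nonneg hs zero_le_two)
    rw [annealedError]
    linarith
  rw [← Real.exp_add, ← Real.le_log_iff_exp_le (annealedPartition_pos w β b)] at h1
  rw [annealedPressure]
  refine le_trans (le_of_eq ?_) (mul_le_mul_of_nonneg_left h1 (by positivity : 0 ≤ 1 / (N : ℝ)))
  field_simp
  ring

/-- Since `L / ℓ` lies in `[-1, 1]`, some point `u` of a grid of mesh `2 / K` is within `2 / K` of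
it, and the tangent at `u` misses `L² / ℓ` by at most `4 ℓ / K²`. Summing over all `K + 1` grid
points costs only `log (K + 1)` before division by `N`. -/
theorem annealedPressure_le (hw : ∀ i, 0 < w i) (hN : 0 < N) {β : ℝ} (hβ : 0 ≤ β) (b : ℝ)
    {K : ℕ} (hK : 0 < K) {M : ℝ}
    (hM : ∀ k ∈ Finset.range (K + 1), averageAction w (Real.sinh β) b (2 * k / K - 1) ≤ M) :
    annealedPressure w β b ≤ (Real.cosh β - 1) / 2 * (1 / (N : ℝ) * ∑ i, (w i : ℝ)) + M +
      1 / (N : ℝ) * (annealedError w β + Real.log (K + 1)) +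
      2 * Real.sinh β / K ^ 2 * (1 / (N : ℝ) * ∑ i, (w i : ℝ)) := by
  have hN' : (0 : ℝ) < N := Nat.cast_pos.2 hN
  have hK' : (0 : ℝ) < K := Nat.cast_pos.2 hK
  have hpos : 0 < ∑ i, (w i : ℝ) :=
    Finset.sum_pos (fun i _ => NNReal.coe_pos.2 (hw i)) ⟨⟨0, hN⟩, Finset.mem_univ _⟩
  have hs := Real.sinh_nonneg_iff.2 hβ
  set ℓ := ∑ i, (w i : ℝ) with hℓ
  have h1 : annealedPartition w β b ≤ ∑ k ∈ Finset.range (K + 1),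
      Real.exp ((Real.cosh β - 1) / 2 * ℓ + annealedError w β + 2 * Real.sinh β / K ^ 2 * ℓ) *
      Real.exp (N * averageAction w (Real.sinh β) b (2 * k / K - 1)) := by
    rw [annealedPartition_eq, Finset.sum_congr rfl fun (k : ℕ) _ => by
      rw [exp_averageAction w hN, Finset.mul_sum], Finset.sum_comm]
    refine Finset.sum_le_sum fun σ _ => ?_
    set L := ∑ i, (w i : ℝ) * spinVal (σ i) with hL
    have hLℓ : |L| ≤ ℓ := by
      refine (Finset.abs_sum_le_sum_abs _ _).trans_eq (Finset.sum_congr rfl fun i _ => ?_)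
      rw [abs_mul, abs_spinVal, mul_one, NNReal.abs_eq]
    -- The position of `L / ℓ` in grid units; its integer part indexes the nearest grid point from
    -- below.
    set y := (L / ℓ + 1) * K / 2 with hy
    have hLr : |L / ℓ| ≤ 1 := by
      rw [abs_div, abs_of_pos hpos]
      exact div_le_one_of_le₀ hLℓ hpos.le
    rw [abs_le] at hLr
    have hy0 : 0 ≤ y := by
      have : 0 ≤ L / ℓ + 1 := by linarith
      positivity
    have hyK : y ≤ K := by
      rw [hy]
      nlinarith
    have hmem : ⌊y⌋₊ ∈ Finset.range (K + 1) := by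
      rw [Finset.mem_range, Nat.lt_succ_iff]
      exact (Nat.floor_le_floor hyK).trans_eq (Nat.floor_natCast K)
    refine le_trans ?_ (Finset.single_le_sum (f := fun k : ℕ => Real.exp
      ((Real.cosh β - 1) / 2 * ℓ + annealedError w β + 2 * Real.sinh β / K ^ 2 * ℓ) * Real.exp
      (b * totalSpin σ + (Real.sinh β * (2 * k / K - 1) * L -
        Real.sinh β / 2 * (2 * k / K - 1) ^ 2 * ℓ))) (fun k _ => by positivity) hmem)
    set u : ℝ := 2 * (⌊y⌋₊ : ℝ) / K - 1 with hu
    rw [← Real.exp_add, ← Real.log_le_iff_le_exp (annealedFactor_pos w β b σ)]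
    have h2 := (abs_le.1 (abs_log_annealedFactor_sub_le w hw hβ b hN σ)).2
    have hdiff : |L / ℓ - u| ≤ 2 / K := by
      have e : L / ℓ - u = 2 / K * (y - ⌊y⌋₊) := by
        rw [hu, hy]; field_simp; ring
      have f1 := Nat.floor_le hy0
      have f2 := Nat.lt_floor_add_one y
      rw [e, abs_mul, abs_of_pos (by positivity : (0 : ℝ) < 2 / K)]
      refine mul_le_of_le_one_right (by positivity) ?_
      rw [abs_le]
      constructor <;> linarith
    have h3 : L ^ 2 / ℓ ≤ 2 * u * L - u ^ 2 * ℓ + 4 / K ^ 2 * ℓ := by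
      have e : L ^ 2 / ℓ = 2 * u * L - u ^ 2 * ℓ + (L / ℓ - u) ^ 2 * ℓ := by
        field_simp; ring
      rw [e]
      gcongr
      calc (L / ℓ - u) ^ 2 = |L / ℓ - u| ^ 2 := (sq_abs _).symm
        _ ≤ (2 / K) ^ 2 := by gcongr
        _ = 4 / K ^ 2 := by rw [div_pow]; norm_num
    have h4 := mul_le_mul_of_nonneg_left h3 (div_nonneg hs zero_le_two)
    have e5 : Real.sinh β / 2 * (2 * u * L - u ^ 2 * ℓ + 4 / K ^ 2 * ℓ) =
      Real.sinh β * u * L - Real.sinh β / 2 * u ^ 2 * ℓ + 2 * Real.sinh β / K ^ 2 * ℓ := by ring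
    rw [e5] at h4
    rw [annealedError]
    linarith
  have h2 : annealedPartition w β b ≤ Real.exp ((Real.cosh β - 1) / 2 * ℓ + annealedError w β +
      2 * Real.sinh β / K ^ 2 * ℓ + N * M + Real.log (K + 1)) := by
    refine h1.trans ((Finset.sum_le_card_nsmul _ _ (Real.exp ((Real.cosh β - 1) / 2 * ℓ +
      annealedError w β + 2 * Real.sinh β / K ^ 2 * ℓ) * Real.exp (N * M)) fun k hk => ?_).trans ?_)
    · gcongr
      exact hM k hk
    · rw [Finset.card_range, nsmul_eq_mul, Real.exp_add _ (Real.log _),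
        Real.exp_log (by positivity), Real.exp_add _ (N * M)]
      push_cast
      rw [mul_comm]
  rw [← Real.log_le_iff_le_exp (annealedPartition_pos w β b)] at h2
  rw [annealedPressure]
  refine (mul_le_mul_of_nonneg_left h2 (by positivity : 0 ≤ 1 / (N : ℝ))).trans_eq ?_
  field_simp
  ring

end FiniteVolume

/-! ### Convergence of the pressure. -/

section PressureLimit

variable {Ω : Type*} [MeasurableSpace Ω] {P : Measure Ω} [IsProbabilityMeasure P]
  {W : Ω → ℝ} {w : (N : ℕ+) → Fin N → ℝ≥0}

theorem tendsto_pnat_val : Tendsto (fun N : ℕ+ => ((N : ℕ) : ℝ)) atTop atTop := by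
  refine tendsto_natCast_atTop_atTop.comp (tendsto_atTop_atTop.2 fun n => ⟨n.succPNat, fun N hN => ?_⟩)
  have : n.succ ≤ (N : ℕ) := hN
  omega

theorem tendsto_one_div_pnat : Tendsto (fun N : ℕ+ => 1 / ((N : ℕ) : ℝ)) atTop (𝓝 0) := by
  simp only [one_div]
  exact tendsto_inv_atTop_zero.comp tendsto_pnat_val

theorem WeightRegularity.tendsto_averageAction (hreg : WeightRegularity w P W) (θ b u : ℝ) :
    Tendsto (fun N : ℕ+ => averageAction (w N) θ b u) atTop (𝓝 (limitAction P W θ (b, u))) := by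
  have hL : LipschitzWith (Real.nnabs (θ * u)) fun x => Real.log (2 * Real.cosh (θ * x * u + b)) := by
    refine lipschitzWith_of_nnnorm_deriv_le (fun x => ?_) fun x => ?_
    · exact (HasDerivAt.comp x (hasDerivAt_log_two_cosh (θ * x * u + b))
        ((((hasDerivAt_id x).const_mul θ).mul_const u).add_const b)).differentiableAt
    · have hd : HasDerivAt (fun x => θ * x * u + b) (θ * u) x := by
        simpa using ((((hasDerivAt_id x).const_mul θ).mul_const u).add_const b)
      have h := (hasDerivAt_log_two_cosh (θ * x * u + b)).comp x hd
      rw [← NNReal.coe_le_coe, coe_nnnorm]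
      have e : deriv (fun x => Real.log (2 * Real.cosh (θ * x * u + b))) x =
        Real.tanh (θ * x * u + b) * (θ * u) := h.deriv
      rw [e, Real.norm_eq_abs, abs_mul, Real.coe_nnabs]
      exact mul_le_of_le_one_left (abs_nonneg _) (Real.abs_tanh_lt_one _).le
  exact (hreg.tendsto_average hL).sub (((hreg.tendsto_mean.const_mul θ).div_const 2).mul_const _)

theorem WeightRegularity.tendsto_annealedError (hreg : WeightRegularity w P W) (β C : ℝ) :
    Tendsto (fun N : ℕ+ => 1 / ((N : ℕ) : ℝ) * (annealedError (w N) β + C)) atTop (𝓝 0) := by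
  have h := tendsto_one_div_pnat.mul (((hreg.tendsto_ratio.const_mul
    ((Real.cosh β - 1 + Real.sinh β) / 2)).add ((hreg.tendsto_ratio.pow 2).const_mul
      ((Real.exp (2 * β) + 1) / 2))).add_const C)
  rwa [zero_mul] at h

/-- The limiting annealed pressure. -/
def limitPressure {Ω : Type*} [MeasurableSpace Ω] (P : Measure Ω) (W : Ω → ℝ) (β b : ℝ) : ℝ :=
  (Real.cosh β - 1) / 2 * (∫ ω, W ω ∂P) + limitSup P W (Real.sinh β) b

theorem WeightRegularity.tendsto_pressure (hreg : WeightRegularity w P W)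
    (hw : ∀ N i, 0 < w N i) {β : ℝ} (hβ : 0 ≤ β) (b : ℝ) :
    Tendsto (fun N : ℕ+ => annealedPressure (w N) β b) atTop (𝓝 (limitPressure P W β b)) := by
  have hs := Real.sinh_nonneg_iff.2 hβ
  have hbdd := hreg.limitWeight.bddAbove_action hs b
  have hmean := hreg.tendsto_mean
  have herr (C : ℝ) := hreg.tendsto_annealedError β C
  refine tendsto_order.2 ⟨fun a ha => ?_, fun a ha => ?_⟩
  · rw [limitPressure, ← sub_lt_iff_lt_add'] at ha
    obtain ⟨u, hu⟩ := exists_lt_of_lt_ciSup ha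
    have h := (((hmean.const_mul ((Real.cosh β - 1) / 2)).add
      (hreg.tendsto_averageAction (Real.sinh β) b u)).sub (herr 0)).eventually
      (lt_mem_nhds (a := a) (by linarith))
    filter_upwards [h] with N hN
    rw [add_zero] at hN
    exact hN.trans_le (le_annealedPressure (w N) (hw N) N.pos hβ b u)
  -- One `ε` pays for the grid mesh and one for the maximum over the grid; the third keeps the
  -- inequality strict. The mesh is fixed before `N` grows, so only finitely many averages must
  -- converge.
  · set ε := (a - limitPressure P W β b) / 3 with hε
    have hε0 : 0 < ε := div_pos (sub_pos.2 ha) three_pos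
    have hK : Tendsto (fun K : ℕ => 2 * Real.sinh β / (K : ℝ) ^ 2 * ∫ ω, W ω ∂P) atTop (𝓝 0) := by
      have : Tendsto (fun K : ℕ => (K : ℝ) ^ 2) atTop atTop :=
        (tendsto_pow_atTop two_ne_zero).comp tendsto_natCast_atTop_atTop
      simpa using (this.const_div_atTop (2 * Real.sinh β)).mul_const (∫ ω, W ω ∂P)
    obtain ⟨K, hKlt, hK0⟩ := ((hK.eventually (gt_mem_nhds hε0)).and (eventually_gt_atTop 0)).exists
    have hM : ∀ᶠ N : ℕ+ in atTop, ∀ k ∈ Finset.range (K + 1),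
        averageAction (w N) (Real.sinh β) b (2 * k / K - 1) ≤ limitSup P W (Real.sinh β) b + ε := by
      rw [Filter.eventually_all_finset]
      intro k _
      have hle : limitAction P W (Real.sinh β) (b, 2 * k / K - 1) <
          limitSup P W (Real.sinh β) b + ε := by
        have := le_ciSup hbdd (2 * (k : ℝ) / K - 1)
        simp only [limitSup]
        linarith
      filter_upwards [(hreg.tendsto_averageAction (Real.sinh β) b (2 * k / K - 1)).eventually
        (gt_mem_nhds hle)] with N hN using hN.le
    have h := (((hmean.const_mul ((Real.cosh β - 1) / 2)).add_const
      (limitSup P W (Real.sinh β) b + ε)).add (herr (Real.log (K + 1)))).add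
      (hmean.const_mul (2 * Real.sinh β / (K : ℝ) ^ 2))
    have h' := h.eventually (gt_mem_nhds (show (Real.cosh β - 1) / 2 * (∫ ω, W ω ∂P) +
      (limitSup P W (Real.sinh β) b + ε) + 0 + 2 * Real.sinh β / (K : ℝ) ^ 2 * ∫ ω, W ω ∂P < a by
        rw [limitPressure] at hε ha
        linarith))
    filter_upwards [h', hM] with N hN hMN
    exact (annealedPressure_le (w N) (hw N) N.pos hβ b hK0 hMN).trans_lt hN

end PressureLimit

/-! ### The limiting magnetization and susceptibility -/

section Susceptibility

variable {Ω : Type*} [MeasurableSpace Ω] {P : Measure Ω} [IsProbabilityMeasure P]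
  {W : Ω → ℝ} {w : (N : ℕ+) → Fin N → ℝ≥0} {β : ℝ}

/-- Finite-volume pressures are convex in the field, so their derivatives converge wherever the
limit is differentiable. -/
theorem WeightRegularity.tendsto_magnetization (hreg : WeightRegularity w P W)
    (hw : ∀ N i, 0 < w N i) (hβ : 0 ≤ β) {b m : ℝ} (hm : HasDerivAt (limitPressure P W β) m b) :
    Tendsto (fun N : ℕ+ => annealedMagnetization (w N) β b) atTop (𝓝 m) :=
  tendsto_deriv_of_monotoneOn univ_mem
    (fun N x _ => hasDerivAt_annealedPressure (w N) (hw N) β x)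
    (fun N => (monotone_annealedMagnetization (w N) (hw N) β).monotoneOn _)
    (fun x _ => hreg.tendsto_pressure hw hβ x) hm tendsto_const_nhds

theorem antitoneOn_annealedSusceptibility {N : ℕ} {w : Fin N → ℝ≥0} (hw : ∀ i, 0 < w i)
    (hβ : 0 ≤ β) : AntitoneOn (annealedSusceptibility w β) (Set.Ici 0) := by
  intro x hx y hy hxy
  rw [annealedSusceptibility_eq w hw, annealedSusceptibility_eq w hw]
  exact div_le_div_of_nonneg_right
    (antitoneOn_isingVar _ _ _ (annealedCoupling_nonneg w hβ) hx hy hxy) (Nat.cast_nonneg _)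

/-- The limiting susceptibility at `B` is `χ`: it is the derivative of the limiting magnetization,
which is itself the derivative of the limiting pressure `ψ` near `B`, and the finite-volume
susceptibilities converge to it, locally uniformly at `B`. -/
structure HasLimitSusceptibility (w : (N : ℕ+) → Fin N → ℝ≥0) (ψ : ℝ → ℝ) (β B χ : ℝ) :
    Prop where
  hasDerivAt : ∃ m : ℝ → ℝ, (∀ᶠ b in 𝓝 B, HasDerivAt ψ (m b) b) ∧ HasDerivAt m χ B
  tendsto {xs : ℕ+ → ℝ} : Tendsto xs atTop (𝓝 B) →
    Tendsto (fun N : ℕ+ => annealedSusceptibility (w N) β (xs N)) atTop (𝓝 χ)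

/-- GHS makes the magnetizations concave on `(0, ∞)`, so the convexity argument applies once more,
to their negatives. -/
theorem WeightRegularity.hasLimitSusceptibility_of_pos (hreg : WeightRegularity w P W)
    (hw : ∀ N i, 0 < w N i) (hβ : 0 ≤ β) {B : ℝ} (hB : 0 < B) :
    ∃ χ, HasLimitSusceptibility w (limitPressure P W β) β B χ := by
  have hs := Real.sinh_nonneg_iff.2 hβ
  have H (b : ℝ) (hb : 0 < b) := hreg.limitWeight.exists_zero_of_pos hs hb
  choose! z hz0 hz huniq hpos hmax habove using H
  have hd (b : ℝ) (hb : 0 < b) := hreg.limitWeight.derivatives_of_zero (D := Set.Ioi 0)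
    (A := Set.Ioi 0) isOpen_Ioi isOpen_Ioi hz0 hz huniq hpos hmax hb
  have hm (b : ℝ) (hb : 0 < b) :
      HasDerivAt (limitPressure P W β) (limitMag P W (Real.sinh β) (b, z b)) b :=
    (hd b hb).1.const_add _
  refine ⟨_, ⟨_, eventually_of_mem (Ioi_mem_nhds hB) hm, (hd B hB).2⟩, fun {xs} hxs => ?_⟩
  have h := tendsto_deriv_of_monotoneOn (l := (atTop : Filter ℕ+)) (D := Set.Ioi 0)
    (Ioi_mem_nhds hB) (F := fun N b => -annealedMagnetization (w N) β b)
    (F' := fun N b => -annealedSusceptibility (w N) β b)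
    (fun N x _ => (hasDerivAt_annealedMagnetization (w N) (hw N) β x).neg)
    (fun N x hx y hy hxy => neg_le_neg (antitoneOn_annealedSusceptibility (hw N) hβ
      (Set.Ioi_subset_Ici_self hx) (Set.Ioi_subset_Ici_self hy) hxy))
    (fun x hx => (hreg.tendsto_magnetization hw hβ (hm x hx)).neg) (hd B hB).2.neg hxs
  simpa only [neg_neg] using h.neg

theorem WeightRegularity.limitPressure_neg (hreg : WeightRegularity w P W)
    (hw : ∀ N i, 0 < w N i) (hβ : 0 ≤ β) (b : ℝ) :
    limitPressure P W β (-b) = limitPressure P W β b := by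
  refine tendsto_nhds_unique (hreg.tendsto_pressure hw hβ (-b)) ?_
  simp only [fun N => annealedPressure_neg (w N) (hw N) β b]
  exact hreg.tendsto_pressure hw hβ b

theorem HasLimitSusceptibility.neg {ψ : ℝ → ℝ} {B χ : ℝ}
    (h : HasLimitSusceptibility w ψ β B χ) (hw : ∀ N i, 0 < w N i) (hψ : ∀ b, ψ (-b) = ψ b) :
    HasLimitSusceptibility w ψ β (-B) χ := by
  obtain ⟨m, hm, hχ⟩ := h.hasDerivAt
  refine ⟨⟨fun b => -m (-b), ?_, ?_⟩, fun {xs} hxs => ?_⟩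
  · have hm' : ∀ᶠ b in 𝓝 (-B), HasDerivAt ψ (m (-b)) (-b) :=
      (show Tendsto (fun b : ℝ => -b) (𝓝 (-B)) (𝓝 B) by
        simpa using (continuous_neg.tendsto (-B))).eventually hm
    filter_upwards [hm'] with b hb
    have := hb.comp b (hasDerivAt_neg b)
    rw [mul_neg_one] at this
    refine this.congr_of_eventuallyEq (Eventually.of_forall fun x => (hψ x).symm)
  · rw [← neg_neg B] at hχ
    have := (hχ.comp (-B) (hasDerivAt_neg (-B))).neg
    rwa [mul_neg_one, neg_neg] at this
  · have hx : Tendsto (fun N => -xs N) atTop (𝓝 B) := by simpa using hxs.neg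
    refine (h.tendsto hx).congr fun N => annealedSusceptibility_neg (w N) (hw N) β (xs N)

theorem annealedSusceptibility_le_of_abs_le {N : ℕ} {w : Fin N → ℝ≥0} (hw : ∀ i, 0 < w i)
    (hβ : 0 ≤ β) {x y : ℝ} (hxy : |x| ≤ |y|) :
    annealedSusceptibility w β y ≤ annealedSusceptibility w β x := by
  have e (x : ℝ) : annealedSusceptibility w β |x| = annealedSusceptibility w β x := by
    rcases abs_choice x with h | h <;> rw [h]
    exact annealedSusceptibility_neg w hw β x
  rw [← e x, ← e y]
  exact antitoneOn_annealedSusceptibility hw hβ (abs_nonneg x) (abs_nonneg y) hxy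

/-- Zero field is the maximum of the even function `χ_N`, so the magnetization changes from convex
to concave there and the two-sided argument fails. One-sided concavity gives the lower bound; the
upper bound is the correlation estimate at zero field, whose limit `hval` identifies with the
derivative of the limiting magnetization. -/
theorem WeightRegularity.hasLimitSusceptibility_zero (hreg : WeightRegularity w P W)
    (hw : ∀ N i, 0 < w N i) (hβ : 0 ≤ β)
    (hlt : Real.sinh β * ∫ ω, W ω ^ 2 ∂P < ∫ ω, W ω ∂P) :
    ∃ χ, HasLimitSusceptibility w (limitPressure P W β) β 0 χ := by
  have hs := Real.sinh_nonneg_iff.2 hβ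
  have hmean := hreg.mean_pos
  have H (b : ℝ) := hreg.limitWeight.exists_zero_of_lt hs hlt b
  choose z hz huniq hpos hmax using H
  have hd (b : ℝ) := hreg.limitWeight.derivatives_of_zero isOpen_univ isOpen_univ
    (fun b _ => Set.mem_univ (z b)) (fun b _ => hz b) (fun b _ u _ => huniq b u)
    (fun b _ => hpos b) (fun b _ => hmax b) (Set.mem_univ b)
  have hm (b : ℝ) :
      HasDerivAt (limitPressure P W β) (limitMag P W (Real.sinh β) (b, z b)) b :=
    (hd b).1.const_add _
  refine ⟨_, ⟨_, Eventually.of_forall hm, (hd 0).2⟩, fun {xs} hxs => ?_⟩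
  have hz0 : z 0 = 0 := (huniq 0 0 (by simp [LimitWeight.field_zero])).symm
  refine tendsto_order.2 ⟨fun a ha => ?_, fun a ha => ?_⟩
  · obtain ⟨r, hr, hev⟩ := exists_eventually_deriv_lt (l := (atTop : Filter ℕ+)) one_pos
      (F := fun N b => -annealedMagnetization (w N) β b)
      (F' := fun N b => -annealedSusceptibility (w N) β b)
      (fun N x _ => (hasDerivAt_annealedMagnetization (w N) (hw N) β x).neg)
      (fun N x hx y hy hxy => neg_le_neg (antitoneOn_annealedSusceptibility (hw N) hβ
        (Set.mem_Ici.2 hx.1.le) (Set.mem_Ici.2 hy.1.le) hxy))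
      (fun x _ => (hreg.tendsto_magnetization hw hβ (hm x)).neg) (hd 0).2.neg (neg_lt_neg ha)
    have hx : ∀ᶠ N in atTop, |xs N| < r := by
      have := hxs.abs
      rw [abs_zero] at this
      exact this.eventually (gt_mem_nhds hr.1)
    filter_upwards [hev, hx] with N hN hxN
    rw [zero_add, neg_lt_neg_iff] at hN
    exact hN.trans_le (annealedSusceptibility_le_of_abs_le (hw N) hβ
      (hxN.le.trans_eq (abs_of_pos hr.1).symm))
  · have hlim : Tendsto (fun N : ℕ+ => 1 + Real.sinh β * (1 / ((N : ℕ) : ℝ) * ∑ i, (w N i : ℝ)) /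
        (1 - Real.sinh β * ((∑ i, (w N i : ℝ) ^ 2) / ∑ i, (w N i : ℝ)))) atTop
        (𝓝 (1 + Real.sinh β * (∫ ω, W ω ∂P) /
          (1 - Real.sinh β * ((∫ ω, W ω ^ 2 ∂P) / ∫ ω, W ω ∂P)))) := by
      refine tendsto_const_nhds.add ((hreg.tendsto_mean.const_mul _).div
        (tendsto_const_nhds.sub (hreg.tendsto_ratio.const_mul _)) ?_)
      rw [← mul_div_assoc]
      exact (sub_pos.2 ((div_lt_one hmean).2 hlt)).ne'
    have hlt' : ∀ᶠ N : ℕ+ in atTop,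
        Real.sinh β * ((∑ i, (w N i : ℝ) ^ 2) / ∑ i, (w N i : ℝ)) < 1 := by
      refine (hreg.tendsto_ratio.const_mul (Real.sinh β)).eventually (gt_mem_nhds ?_)
      rwa [← mul_div_assoc, div_lt_one hmean]
    have hval : 1 + Real.sinh β * (∫ ω, W ω ∂P) /
        (1 - Real.sinh β * ((∫ ω, W ω ^ 2 ∂P) / ∫ ω, W ω ∂P)) < a := by
      refine lt_of_eq_of_lt ?_ ha
      rw [hz0]
      have := (sub_pos.2 hlt).ne'
      simp only [limitMoment, mul_zero, add_zero, Real.tanh_zero, pow_zero, pow_one,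
        zero_pow two_ne_zero, sub_zero, mul_one, integral_const, probReal_univ, smul_eq_mul]
      have h1 : 1 - Real.sinh β * ((∫ ω, W ω ^ 2 ∂P) / ∫ ω, W ω ∂P) =
        (∫ ω, W ω ∂P - Real.sinh β * ∫ ω, W ω ^ 2 ∂P) / ∫ ω, W ω ∂P := by field_simp
      rw [h1]
      field_simp
    filter_upwards [hlim.eventually (gt_mem_nhds hval), hlt'] with N hN hN'
    refine lt_of_le_of_lt ?_ hN
    refine (annealedSusceptibility_le_of_abs_le (hw N) hβ ?_).trans
      (annealedSusceptibility_zero_le (w N) (hw N) hβ hN' N.pos)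
    rw [abs_zero]
    exact abs_nonneg _

/-- Below the mean-field critical point there is spontaneous magnetization. -/
theorem WeightRegularity.exists_spontaneousMagnetization (hreg : WeightRegularity w P W)
    (hw : ∀ N i, 0 < w N i) (hβ : 0 ≤ β)
    (hlt : ∫ ω, W ω ∂P < Real.sinh β * ∫ ω, W ω ^ 2 ∂P) :
    ∃ m, HasSpontaneousMagnetization w β m ∧ 0 < m := by
  have hs := Real.sinh_nonneg_iff.2 hβ
  have hs0 : 0 < Real.sinh β := hs.lt_of_ne fun h => by
    rw [← h, zero_mul] at hlt
    exact lt_asymm hlt hreg.mean_pos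
  have hW := hreg.limitWeight
  have H (b : ℝ) (hb : 0 < b) := hW.exists_zero_of_pos hs hb
  choose! z hz0 hz huniq hpos hmax habove using H
  have hd (b : ℝ) (hb : 0 < b) := hW.derivatives_of_zero (D := Set.Ioi 0)
    (A := Set.Ioi 0) isOpen_Ioi isOpen_Ioi hz0 hz huniq hpos hmax hb
  set m : ℝ → ℝ := fun b => limitMag P W (Real.sinh β) (b, z b) with hmdef
  have hM (b : ℝ) (hb : 0 < b) :
      Tendsto (fun N : ℕ+ => annealedMagnetization (w N) β b) atTop (𝓝 (m b)) :=
    hreg.tendsto_magnetization hw hβ ((hd b hb).1.const_add _)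
  have hmono : MonotoneOn m (Set.Ioi 0) := fun x hx y hy hxy =>
    le_of_tendsto_of_tendsto' (hM x hx) (hM y hy) fun N =>
      monotone_annealedMagnetization (w N) (hw N) β hxy
  -- At `b = 0` the field vanishes at `0` with negative slope. A positive `b` only lowers it, so the
  -- positive zero `z b` stays to the right of `u₁` as `b → 0+`.
  obtain ⟨u₁, hu₁, hfu₁⟩ : ∃ u₁, 0 < u₁ ∧ limitField P W (Real.sinh β) (0, u₁) < 0 := by
    have hder := hW.hasDerivAt_field (θ := Real.sinh β) 0 0
    have hneg : ∫ ω, W ω ∂P - Real.sinh β * limitMoment P W (Real.sinh β) 2 (0, 0) < 0 := by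
      simp only [limitMoment, mul_zero, add_zero, Real.tanh_zero, zero_pow two_ne_zero, sub_zero,
        mul_one]
      linarith
    have h1 := (hasDerivAt_iff_tendsto_slope_zero.1 hder).mono_left
      (nhdsWithin_mono (0 : ℝ) fun x (hx : x ∈ Set.Ioi (0 : ℝ)) => (Set.mem_Ioi.1 hx).ne')
    obtain ⟨u, hu, hu0⟩ := ((h1.eventually (gt_mem_nhds hneg)).and
      self_mem_nhdsWithin).exists
    rw [LimitWeight.field_zero, Real.tanh_zero, mul_zero, neg_zero, sub_zero, zero_add,
      smul_eq_mul] at hu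
    exact ⟨u, hu0, neg_of_mul_neg_right hu (inv_pos.2 hu0).le⟩
  have hzu (b : ℝ) (hb : 0 < b) : u₁ ≤ z b := by
    by_contra! h
    refine (habove b hb u₁ h).not_ge (le_trans ?_ hfu₁.le)
    refine sub_le_sub_left (integral_mono_ae (hW.integrable_mul_tanh (0, u₁))
      (hW.integrable_mul_tanh (b, u₁)) ?_) _
    filter_upwards [hW.nonneg] with ω hω
    exact mul_le_mul_of_nonneg_left (tanh_strictMono.monotone (add_le_add_right hb.le _)) hω
  -- A lower bound for the magnetization independent of `b`, positive because `W` is not almost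
  -- surely zero.
  set c := limitMag P W (Real.sinh β) (0, u₁) with hc
  have hc0 : 0 < c := by
    have hnn : 0 ≤ᵐ[P] fun ω => Real.tanh (Real.sinh β * W ω * u₁ + 0) := by
      filter_upwards [hW.nonneg] with ω hω
      have := tanh_strictMono.monotone
        (show 0 ≤ Real.sinh β * W ω * u₁ + 0 by positivity)
      rwa [Real.tanh_zero] at this
    refine (integral_nonneg_of_ae hnn).lt_of_ne fun h => ?_
    have h0 := (integral_eq_zero_iff_of_nonneg_ae hnn (hW.integrable_tanh (0, u₁))).1 h.symm
    refine hreg.mean_pos.ne' (integral_eq_zero_of_ae ?_)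
    filter_upwards [h0] with ω hω
    have := tanh_strictMono.injective (hω.trans Real.tanh_zero.symm)
    simpa [hs0.ne', hu₁.ne'] using this
  have hcm (b : ℝ) (hb : 0 < b) : c ≤ m b := by
    refine integral_mono_ae (hW.integrable_tanh (0, u₁)) (hW.integrable_tanh (b, z b)) ?_
    filter_upwards [hW.nonneg] with ω hω
    refine tanh_strictMono.monotone (add_le_add ?_ hb.le)
    exact mul_le_mul_of_nonneg_left (hzu b hb) (mul_nonneg hs hω)
  have hbdd : BddBelow (m '' Set.Ioi 0) := ⟨c, by rintro _ ⟨b, hb, rfl⟩; exact hcm b hb⟩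
  refine ⟨sInf (m '' Set.Ioi 0), ⟨m, hM, hmono.tendsto_nhdsGT hbdd⟩, hc0.trans_le ?_⟩
  exact le_csInf ((Set.nonempty_Ioi).image _) (by rintro _ ⟨b, hb, rfl⟩; exact hcm b hb)

/-- If the inequality failed at `β`, it would fail strictly at some `β'` between `β` and the
critical value, where spontaneous magnetization contradicts the infimum. Passing to `β'` also
excludes equality. -/
theorem WeightRegularity.sinh_mul_lt_of_lt_criticalInverseTemp (hreg : WeightRegularity w P W)
    (hw : ∀ N i, 0 < w N i) (hβ : 0 < β) (hlt : (β : EReal) < criticalInverseTemp w) :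
    Real.sinh β * ∫ ω, W ω ^ 2 ∂P < ∫ ω, W ω ∂P := by
  by_contra! h
  obtain ⟨β', h1, h2⟩ := EReal.lt_iff_exists_real_btwn.1 hlt
  rw [EReal.coe_lt_coe_iff] at h1
  have hβ' : 0 < β' := hβ.trans h1
  obtain ⟨m, hm, hm0⟩ := hreg.exists_spontaneousMagnetization hw hβ'.le
    (h.trans_lt (mul_lt_mul_of_pos_right (Real.sinh_lt_sinh.2 h1) hreg.sq_pos))
  exact h2.not_ge (sInf_le ⟨β', rfl, hβ', m, hm, hm0⟩)

theorem WeightRegularity.exists_hasLimitSusceptibility (hreg : WeightRegularity w P W)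
    (hw : ∀ N i, 0 < w N i) {B : ℝ} (h : (β, B) ∈ UniquenessRegime w) :
    0 ≤ β ∧ ∃ χ, HasLimitSusceptibility w (limitPressure P W β) β B χ := by
  rcases h with ⟨hβ, hB⟩ | ⟨hβ, hlt, hB⟩
  · refine ⟨hβ, ?_⟩
    rcases lt_or_gt_of_ne hB with hB | hB
    · obtain ⟨χ, hχ⟩ := hreg.hasLimitSusceptibility_of_pos hw hβ (neg_pos.2 hB)
      have := hχ.neg hw (hreg.limitPressure_neg hw hβ)
      rw [neg_neg] at this
      exact ⟨χ, this⟩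
    · exact hreg.hasLimitSusceptibility_of_pos hw hβ hB
  · simp only at hβ hlt hB
    subst hB
    exact ⟨hβ.le, hreg.hasLimitSusceptibility_zero hw hβ.le
      (hreg.sinh_mul_lt_of_lt_criticalInverseTemp hw hβ hlt)⟩

end Susceptibility

/-! ### The central limit theorem -/

/-- Second-order Taylor expansion with Lagrange remainder. -/
theorem exists_taylor_two {f f' f'' : ℝ → ℝ} (hf : ∀ x, HasDerivAt f (f' x) x)
    (hf' : ∀ x, HasDerivAt f' (f'' x) x) (x h : ℝ) :
    ∃ s ∈ Set.Ioo (0 : ℝ) 1, f (x + h) - f x - h * f' x = h ^ 2 / 2 * f'' (x + s * h) := by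
  set K := f (x + h) - f x - h * f' x with hK
  have hl (s : ℝ) : HasDerivAt (fun s => x + s * h) h s := by
    simpa using ((hasDerivAt_id s).mul_const h).const_add x
  -- Subtracting `s² K` gives the auxiliary function equal values at `0` and `1`, and its derivative
  -- vanishes at `0`; Rolle's theorem is applied to it and then to its derivative.
  have hg (s : ℝ) : HasDerivAt (fun s => f (x + s * h) - s * (h * f' x) - s ^ 2 * K)
      (f' (x + s * h) * h - h * f' x - 2 * s * K) s := by
    have h1 := (((hf (x + s * h)).comp s (hl s)).sub ((hasDerivAt_id s).mul_const (h * f' x))).sub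
      ((hasDerivAt_pow 2 s).mul_const K)
    simpa using! h1
  have hg' (s : ℝ) : HasDerivAt (fun s => f' (x + s * h) * h - h * f' x - 2 * s * K)
      (f'' (x + s * h) * h * h - 2 * K) s := by
    have h1 := ((((hf' (x + s * h)).comp s (hl s)).mul_const h).sub_const (h * f' x)).sub
      (((hasDerivAt_id s).const_mul 2).mul_const K)
    simpa using! h1
  obtain ⟨s, hs, hs0⟩ := exists_hasDerivAt_eq_zero (zero_lt_one' ℝ)
    (fun s _ => (hg s).continuousAt.continuousWithinAt)
    (by simp only [hK, zero_mul, one_mul, add_zero]; ring) fun s _ => hg s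
  obtain ⟨r, hr, hr0⟩ := exists_hasDerivAt_eq_zero hs.1
    (fun s _ => (hg' s).continuousAt.continuousWithinAt)
    (by rw [hs0]; ring_nf) fun s _ => hg' s
  exact ⟨r, ⟨hr.1, hr.2.trans hs.2⟩, by linarith⟩

/-! ### The moment generating function of the normalized spin. -/

section FiniteVolume

variable {N : ℕ} (w : Fin N → ℝ≥0)

/-- The annealed total spin, centered and divided by `√N`. -/
def normalizedSpin (β B : ℝ) (σ : SpinConfig N) : ℝ :=
  (totalSpin σ - ∫ τ, totalSpin τ ∂(annealedMeasure w β B)) / √(N : ℝ)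

theorem integral_exp_totalSpin (hw : ∀ i, 0 < w i) (β B t : ℝ) :
    ∫ σ, Real.exp (t * totalSpin σ) ∂(annealedMeasure w β B) =
      annealedPartition w β (B + t) / annealedPartition w β B := by
  have hC := (annealedConst_pos w β).ne'
  rw [integral_annealedMeasure w hw, annealedPartition_eq, annealedPartition_eq]
  simp only [annealedFactor_eq_isingWeight w hw, ← Finset.mul_sum]
  rw [mul_div_mul_left _ _ hC, gibbsMean]
  congr 1
  refine Finset.sum_congr rfl fun σ _ => ?_
  rw [isingWeight_eq _ _ _ B, isingWeight_eq _ _ _ (B + t), mul_assoc, ← Real.exp_add, totalSpin,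
    ← add_mul]

/-- An exponential tilt of `S_N` is a shift of the field, so the logarithm of the moment generating
function is an increment of `log Q_N(Z_N)`. Centering removes the first-order term, and the second
derivative is `N χ_N`. -/
theorem exists_mgf_normalizedSpin_eq (hw : ∀ i, 0 < w i) (hN : 0 < N) (β B t : ℝ) :
    ∃ c, |c - B| ≤ |t| / √(N : ℝ) ∧ mgf (normalizedSpin w β B) (annealedMeasure w β B) t =
      Real.exp (t ^ 2 / 2 * annealedSusceptibility w β c) := by
  have hN' : (0 : ℝ) < N := Nat.cast_pos.2 hN
  have hsq : 0 < √(N : ℝ) := Real.sqrt_pos.2 hN'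
  set E := ∫ τ, totalSpin τ ∂(annealedMeasure w β B) with hE
  have hE' : E = isingMean (annealedCoupling w β) (fun e => e.1.1) (fun e => e.1.2) B := by
    rw [hE, integral_annealedMeasure w hw]; rfl
  obtain ⟨s, hs, h⟩ := exists_taylor_two (hasDerivAt_log_annealedPartition w hw β)
    (hasDerivAt_isingMean _ _ _) B (t / √(N : ℝ))
  refine ⟨B + s * (t / √(N : ℝ)), ?_, ?_⟩
  · rw [add_sub_cancel_left, abs_mul, abs_div, abs_of_pos hsq, abs_of_pos hs.1]
    exact mul_le_of_le_one_left (by positivity) hs.2.le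
  · have e (σ : SpinConfig N) : t * normalizedSpin w β B σ =
        t / √(N : ℝ) * totalSpin σ + -(t / √(N : ℝ) * E) := by
      rw [normalizedSpin, ← hE]; ring
    simp only [mgf, e, Real.exp_add, integral_mul_const]
    rw [integral_exp_totalSpin w hw, annealedSusceptibility_eq w hw,
      ← Real.exp_log (annealedPartition_pos w β B),
      ← Real.exp_log (annealedPartition_pos w β (B + t / √(N : ℝ))), ← Real.exp_sub,
      ← Real.exp_add]
    congr 1
    rw [← sub_eq_add_neg, hE', h, div_pow, Real.sq_sqrt hN'.le]
    field_simp

end FiniteVolume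

theorem HasLimitSusceptibility.tendsto_mgf {w : (N : ℕ+) → Fin N → ℝ≥0} {ψ : ℝ → ℝ} {β B χ : ℝ}
    (h : HasLimitSusceptibility w ψ β B χ) (hw : ∀ N i, 0 < w N i) (t : ℝ) :
    Tendsto (fun N : ℕ+ => mgf (normalizedSpin (w N) β B) (annealedMeasure (w N) β B) t) atTop
      (𝓝 (Real.exp (t ^ 2 / 2 * χ))) := by
  choose c hc hmgf using fun N : ℕ+ => exists_mgf_normalizedSpin_eq (w N) (hw N) N.pos β B t
  simp only [hmgf]
  refine (Real.continuous_exp.tendsto _).comp ((h.tendsto ?_).const_mul _)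
  refine tendsto_iff_norm_sub_tendsto_zero.2 (squeeze_zero (fun N => norm_nonneg _) hc ?_)
  exact (Real.tendsto_sqrt_atTop.comp tendsto_pnat_val).const_div_atTop |t|

theorem HasLimitSusceptibility.tendstoInDistribution {w : (N : ℕ+) → Fin N → ℝ≥0} {ψ : ℝ → ℝ}
    {β B : ℝ} {χ : ℝ≥0} (h : HasLimitSusceptibility w ψ β B χ) (hw : ∀ N i, 0 < w N i) :
    TendstoInDistribution (fun N : ℕ+ => normalizedSpin (w N) β B) atTop (id : ℝ → ℝ)
      (fun N : ℕ+ => annealedMeasure (w N) β B) (gaussianReal 0 χ) := by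
  have hm (N : ℕ+) : Measurable (normalizedSpin (w N) β B) := Measurable.of_discrete
  refine ⟨fun N => (hm N).aemeasurable, aemeasurable_id, ?_⟩
  -- The passage to sequences matches the `ℕ`-indexed continuity theorem, where convergence at `1`
  -- and `-1` bounds the whole sequence and hence gives tightness.
  refine tendsto_of_seq_tendsto fun ns hns => tendsto_of_tendsto_mgf (fun n t => ?_) fun t => ?_
  · change Integrable _ (Measure.map (normalizedSpin (w (ns n)) β B) _)
    rw [integrable_map_measure (by fun_prop) (hm _).aemeasurable]
    exact Integrable.of_finite
  · change Tendsto (fun n => mgf id (Measure.map (normalizedSpin (w (ns n)) β B)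
      (annealedMeasure (w (ns n)) β B)) t) atTop (𝓝 (mgf id (Measure.map id (gaussianReal 0 χ)) t))
    rw [Measure.map_id, mgf_id_gaussianReal]
    simp only [mgf_id_map (hm _).aemeasurable]
    have e : 0 * t + χ * t ^ 2 / 2 = t ^ 2 / 2 * χ := by ring
    rw [e]
    exact (h.tendsto_mgf hw t).comp hns

end AnnealedGRG

end

theorem mainTheorem1 {Ω : Type*} [MeasurableSpace Ω] (P : Measure Ω) [IsProbabilityMeasure P]
    (W : Ω → ℝ) (w : (N : ℕ+) → Fin N → ℝ≥0) (hw : ∀ N i, 0 < w N i)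
    (hreg : AnnealedGRG.WeightRegularity w P W)
    (β B : ℝ) (hβB : (β, B) ∈ AnnealedGRG.UniquenessRegime w) :
    ∃ (ψ : ℝ → ℝ) (χ : ℝ≥0),
      -- `ψ` is the limiting annealed pressure at inverse temperature `β`, as a function of the field
      (∀ b : ℝ, Tendsto (fun N : ℕ+ => AnnealedGRG.annealedPressure (w N) β b) atTop (𝓝 (ψ b))) ∧
      -- the second derivative of the limiting pressure in the field exists at `B` and equals `χ`
      (∀ᶠ b in 𝓝 B, DifferentiableAt ℝ ψ b) ∧ HasDerivAt (deriv ψ) (χ : ℝ) B ∧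
      -- `χ` is the limit of the finite-volume susceptibilities
      Tendsto (fun N : ℕ+ => AnnealedGRG.annealedSusceptibility (w N) β B) atTop (𝓝 (χ : ℝ)) ∧
      -- central limit theorem for the total spin under the annealed measure
      TendstoInDistribution
        (fun (N : ℕ+) (σ : AnnealedGRG.SpinConfig N) =>
          (AnnealedGRG.totalSpin σ
            - ∫ τ, AnnealedGRG.totalSpin τ ∂(AnnealedGRG.annealedMeasure (w N) β B))
              / √((N : ℕ) : ℝ))
        atTop (id : ℝ → ℝ)
        (fun N : ℕ+ => AnnealedGRG.annealedMeasure (w N) β B) (gaussianReal 0 χ) := by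
  obtain ⟨hβ, χ, hχ⟩ := hreg.exists_hasLimitSusceptibility hw hβB
  have hlim := hχ.tendsto tendsto_const_nhds
  -- The limit inherits nonnegativity from the finite-volume variances.
  lift χ to ℝ≥0 using ge_of_tendsto' hlim fun N =>
    AnnealedGRG.annealedSusceptibility_nonneg (w N) (hw N) β B
  obtain ⟨m, hm, hmχ⟩ := hχ.hasDerivAt
  refine ⟨_, χ, hreg.tendsto_pressure hw hβ, hm.mono fun b hb => hb.differentiableAt,
    hmχ.congr_of_eventuallyEq (hm.mono fun b hb => hb.deriv), hlim, hχ.tendstoInDistribution hw⟩
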